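/- **Problem DPL (duality over a product of lattices).** Input: finite non-empty lattices $\mathcal L_1,\dots,\mathcal L_k$, each given explicitly by its order matrix, and two antichains $\mathcal A,\mathcal B\subseteq\mathcal L=\mathcal L_1\times\dots\times\mathcal L_k$ (componentwise order), listed element by element, such that $A\not\le B$ for all $A\in\mathcal A$, $B\in\mathcal B$. Question: are $\mathcal A$ and $\mathcal B$ dual, i.e. does every $P\in\mathcal L$ satisfy $P\le B$ for some $B\in\mathcal B$ or $A\le P$ for some $A\in\mathcal A$? **Problem MIBR (minimum implication base recognition).** Input: a finite formal context $\mathbb K=(G,M,I)$, given by its cross-table, and a finite set $\mathcal J$ of implications $X\to Y$ with $X,Y\subseteq M$. An implication $X\to Y$ holds in $\mathbb K$ if every object having all attributes of $X$ has all attributes of $Y$. Question: is $\mathcal J$ an implication base of $\mathbb K$, i.e. an inclusion-minimal set of implications holding in $\mathbb K$ from which all implications holding in $\mathbb K$ can be deduced by the Armstrong rules $$\frac{}{X\to X},\qquad \frac{X\to Y}{X\cup Z\to Y},\qquad \frac{X\to Y,\ \ Y\cup Z\to W}{X\cup Z\to W}\ ?$$ **Proposition.** MIBR is DPL-hard under polynomial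 Karp reductions: there is a function, computable by a Turing machine in time polynomial in the length of the (binary encoded) input, that maps every instance $x$ of DPL to an instance $(\mathbb K,\mathcal J)$ of MIBR such that the answer to $x$ is yes if and only if the answer to $(\mathbb K,\mathcal J)$ is yes. The same holds for the two variants of MIBR in which one asks whether $\mathcal J$ is a set of implications of $\mathbb K$ from which all implications of $\mathbb K$ can be deduced (with no minimality required), or whether it is such a set of minimum cardinality. -/

import Mathlib

namespace LatticeDuality

/-! ### Binary encodings -/

/-- A natural number in unary, followed by an end marker. -/
def encodeNat (n : ℕ) : List Bool := List.replicate n true ++ [false]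

/-- A single bit. -/
def encodeBit (b : Bool) : List Bool := [b]

/-- A tuple of known length: the codes of its entries one after another. -/
def encodeTuple {k : ℕ} {α : Fin k → Type} (enc : ∀ i, α i → List Bool) (f : ∀ i, α i) :
    List Bool :=
  (List.ofFn fun i => enc i (f i)).flatten

/-- A list: its length followed by the codes of its entries. -/
def encodeList {α : Type} (enc : α → List Bool) (l : List α) : List Bool :=
  encodeNat l.length ++ l.flatMap enc

/-- A Boolean matrix of known dimensions, row by row. -/
def encodeMatrix {g m : ℕ} (a : Fin g → Fin m → Bool) : List Bool :=
  encodeTuple (fun _ => encodeTuple fun _ => encodeBit) a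

/-- A subset of an `m`-element set, as its characteristic vector. -/
def encodeSubset {m : ℕ} (S : Finset (Fin m)) : List Bool :=
  encodeTuple (fun _ => encodeBit) fun j => decide (j ∈ S)

/-- The code can be recognized as a prefix of a longer word and then determines the object. -/
def PrefixInjective {α : Type} (enc : α → List Bool) : Prop :=
  ∀ a b s t, enc a ++ s = enc b ++ t → a = b ∧ s = t

theorem PrefixInjective.injective {α : Type} {enc : α → List Bool} (h : PrefixInjective enc) :
    Function.Injective enc := fun a b hab => (h a b [] [] (by rw [hab])).1

theorem prefixInjective_nat : PrefixInjective encodeNat := by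
  intro a
  induction a with
  | zero =>
    intro b s t h
    cases b with
    | zero => simpa [encodeNat] using h
    | succ b => simp [encodeNat, List.replicate_succ] at h
  | succ a ih =>
    intro b s t h
    cases b with
    | zero => simp [encodeNat, List.replicate_succ] at h
    | succ b =>
      have h' : encodeNat a ++ s = encodeNat b ++ t := by
        simpa [encodeNat, List.replicate_succ] using h
      obtain ⟨h1, h2⟩ := ih b s t h'
      exact ⟨by rw [h1], h2⟩

theorem prefixInjective_bit : PrefixInjective encodeBit := by
  intro a b s t h
  simpa [encodeBit] using h

theorem prefixInjective_tuple {k : ℕ} {α : Fin k → Type} {enc : ∀ i, α i → List Bool}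
    (henc : ∀ i, PrefixInjective (enc i)) : PrefixInjective (encodeTuple enc) := by
  intro f g s t h
  induction k generalizing s t with
  | zero => exact ⟨funext fun i => i.elim0, by simpa [encodeTuple] using h⟩
  | succ k ih =>
    simp only [encodeTuple, List.ofFn_succ, List.flatten_cons, List.append_assoc] at h
    obtain ⟨h1, h2⟩ := henc 0 _ _ _ _ h
    obtain ⟨h3, h4⟩ := ih (enc := fun i => enc i.succ) (fun i => henc i.succ)
      (fun i => f i.succ) (fun i => g i.succ) s t h2
    exact ⟨funext fun i => Fin.cases h1 (fun j => congrFun h3 j) i, h4⟩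

theorem prefixInjective_list {α : Type} {enc : α → List Bool} (henc : PrefixInjective enc) :
    PrefixInjective (encodeList enc) := by
  intro a b s t h
  simp only [encodeList, List.append_assoc] at h
  obtain ⟨hl, h'⟩ := prefixInjective_nat _ _ _ _ h
  clear h
  induction a generalizing b with
  | nil =>
    cases b with
    | nil => simpa using h'
    | cons y b => simp at hl
  | cons x a ih =>
    cases b with
    | nil => simp at hl
    | cons y b =>
      simp only [List.flatMap_cons, List.append_assoc] at h'
      obtain ⟨h1, h2⟩ := henc _ _ _ _ h'
      obtain ⟨h3, h4⟩ := ih b (by simpa using hl) h2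
      exact ⟨by rw [h1, h3], h4⟩

theorem prefixInjective_matrix {g m : ℕ} :
    PrefixInjective (encodeMatrix : (Fin g → Fin m → Bool) → List Bool) :=
  prefixInjective_tuple fun _ => prefixInjective_tuple fun _ => prefixInjective_bit

theorem prefixInjective_subset {m : ℕ} :
    PrefixInjective (encodeSubset : Finset (Fin m) → List Bool) := by
  intro S T s t h
  obtain ⟨h1, h2⟩ := prefixInjective_tuple (fun _ => prefixInjective_bit) _ _ _ _ h
  exact ⟨Finset.ext fun j => by simpa using congrFun h1 j, h2⟩

/-! ### Decision problems and polynomial-time many-one reductions -/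

/-- A decision problem: its instances, their binary encoding, and the yes-instances. -/
structure DecisionProblem where
  Instance : Type
  encode : Instance → List Bool
  encode_injective : Function.Injective encode
  Yes : Instance → Prop

/-- `P` is Karp-reducible to `Q`: some function from instances of `P` to instances of `Q`,
computed by a Turing machine in time polynomial in the length of the encoded input, maps
yes-instances to yes-instances and no-instances to no-instances. -/
def KarpReducible (P Q : DecisionProblem) : Prop :=
  ∃ f : P.Instance → Q.Instance,
    Nonempty (Turing.TM2ComputableInPolyTime P.encode Q.encode f) ∧ ∀ x, P.Yes x ↔ Q.Yes (f x)

/-! ### Duality in a partially ordered set -/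

/-- No element of `A` lies below an element of `B`. -/
def Separated {P : Type} [PartialOrder P] (A B : Set P) : Prop :=
  ∀ a ∈ A, ∀ b ∈ B, ¬ a ≤ b

/-- `A` and `B` are dual antichains. -/
structure AreDual {P : Type} [PartialOrder P] (A B : Set P) : Prop where
  antichain_left : IsAntichain (· ≤ ·) A
  antichain_right : IsAntichain (· ≤ ·) B
  separated : Separated A B
  cover : ∀ p : P, (∃ b ∈ B, p ≤ b) ∨ ∃ a ∈ A, a ≤ p

/-! ### Explicitly given lattices and the problem DPL -/

/-- A finite non-empty lattice on `{0, …, card - 1}` given by the matrix of its order relation. -/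
structure ExplicitLattice where
  card : ℕ
  card_pos : 0 < card
  leq : Fin card → Fin card → Bool
  leq_refl : ∀ x, leq x x = true
  leq_trans : ∀ x y z, leq x y = true → leq y z = true → leq x z = true
  leq_antisymm : ∀ x y, leq x y = true → leq y x = true → x = y
  exists_inf : ∀ x y, ∃ z, leq z x = true ∧ leq z y = true ∧
    ∀ w, leq w x = true → leq w y = true → leq w z = true
  exists_sup : ∀ x y, ∃ z, leq x z = true ∧ leq y z = true ∧
    ∀ w, leq x w = true → leq y w = true → leq z w = true

/-- The set of elements of an explicitly given lattice. -/
def ExplicitLattice.Elem (L : ExplicitLattice) : Type := Fin L.card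

instance (L : ExplicitLattice) : PartialOrder L.Elem where
  le x y := L.leq x y = true
  le_refl := L.leq_refl
  le_trans := L.leq_trans
  le_antisymm := L.leq_antisymm

/-- The encoding of a lattice by its size and its order matrix. -/
def ExplicitLattice.encode (L : ExplicitLattice) : List Bool :=
  encodeNat L.card ++ encodeMatrix L.leq

/-- The encoding of an element of a lattice by its index. -/
def ExplicitLattice.encodeElem (L : ExplicitLattice) (x : L.Elem) : List Bool :=
  encodeNat (Fin.val x)

/-- An instance of DPL: lattices `L₁, …, Lₖ`, and antichains `A`, `B` of the product
`L₁ × ⋯ × Lₖ` (with the componentwise order), listed element by element, such that no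
element of `A` lies below an element of `B`. -/
structure DPLInstance where
  k : ℕ
  L : Fin k → ExplicitLattice
  A : List (∀ i, (L i).Elem)
  B : List (∀ i, (L i).Elem)
  antichain_A : IsAntichain (· ≤ ·) {a | a ∈ A}
  antichain_B : IsAntichain (· ≤ ·) {b | b ∈ B}
  separated : Separated {a | a ∈ A} {b | b ∈ B}

/-- The encoding of an instance of DPL. -/
def DPLInstance.encode (x : DPLInstance) : List Bool :=
  encodeNat x.k ++ encodeTuple (fun _ => ExplicitLattice.encode) x.L ++
    encodeList (encodeTuple fun i => (x.L i).encodeElem) x.A ++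
    encodeList (encodeTuple fun i => (x.L i).encodeElem) x.B

theorem ExplicitLattice.prefixInjective_encode : PrefixInjective ExplicitLattice.encode := by
  rintro ⟨n, _, a, _, _, _, _, _⟩ ⟨m, _, b, _, _, _, _, _⟩ s t h
  simp only [ExplicitLattice.encode, List.append_assoc] at h
  obtain ⟨rfl, h1⟩ := prefixInjective_nat _ _ _ _ h
  obtain ⟨rfl, h2⟩ := prefixInjective_matrix _ _ _ _ h1
  exact ⟨rfl, h2⟩

theorem ExplicitLattice.prefixInjective_encodeElem (L : ExplicitLattice) :
    PrefixInjective L.encodeElem := by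
  intro x y s t h
  obtain ⟨h1, h2⟩ := prefixInjective_nat _ _ _ _ h
  exact ⟨Fin.ext h1, h2⟩

theorem DPLInstance.encode_injective : Function.Injective DPLInstance.encode := by
  rintro ⟨k, L, A, B, _, _, _⟩ ⟨k', L', A', B', _, _, _⟩ h
  simp only [DPLInstance.encode, List.append_assoc] at h
  obtain ⟨rfl, h1⟩ := prefixInjective_nat _ _ _ _ h
  obtain ⟨rfl, h2⟩ :=
    prefixInjective_tuple (fun _ => ExplicitLattice.prefixInjective_encode) _ _ _ _ h1
  have hE : PrefixInjective (encodeTuple fun i => (L i).encodeElem) :=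
    prefixInjective_tuple fun i => (L i).prefixInjective_encodeElem
  obtain ⟨rfl, h3⟩ := prefixInjective_list hE _ _ _ _ h2
  obtain rfl := (prefixInjective_list hE).injective h3
  rfl

/-- Duality over a product of explicitly given lattices (DPL). -/
def DPL : DecisionProblem where
  Instance := DPLInstance
  encode := DPLInstance.encode
  encode_injective := DPLInstance.encode_injective
  Yes x := AreDual {a | a ∈ x.A} {b | b ∈ x.B}

/-! ### Implications of a formal context -/

/-- An implication `X → Y` between sets of attributes, as the pair `(X, Y)`. -/
abbrev Implication (M : Type) : Type := Finset M × Finset M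

/-- The implication `X → Y` holds in the context `(G, M, I)`: every object that has all attributes
from `X` also has all attributes from `Y`, i.e. `X' ⊆ Y'`. -/
def Implication.Holds {G M : Type} (I : G → M → Prop) (i : Implication M) : Prop :=
  lowerPolar I (i.1 : Set M) ⊆ lowerPolar I (i.2 : Set M)

/-- Deducibility from a set `J` of implications by means of the Armstrong rules. -/
inductive Deducible {M : Type} [DecidableEq M] (J : Set (Implication M)) : Implication M → Prop
  | hyp (i : Implication M) : i ∈ J → Deducible J i
  | refl (X : Finset M) : Deducible J (X, X)
  | augment (X Y Z : Finset M) : Deducible J (X, Y) → Deducible J (X ∪ Z, Y)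
  | pseudotrans (X Y Z W : Finset M) :
      Deducible J (X, Y) → Deducible J (Y ∪ Z, W) → Deducible J (X ∪ Z, W)

/-- `J` is a set of implications of the context from which all other implications of the context
can be deduced (a sound and complete set of implications). -/
structure Generates {G M : Type} [DecidableEq M] (I : G → M → Prop) (J : Set (Implication M)) :
    Prop where
  sound : ∀ i ∈ J, i.Holds I
  complete : ∀ i : Implication M, i.Holds I → Deducible J i

/-- `J` is an implication base of the context: an inclusion-minimal set of implications of the
context from which all other implications of the context can be deduced. -/
def IsImplicationBase {G M : Type} [DecidableEq M] (I : G → M → Prop)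
    (J : Set (Implication M)) : Prop :=
  Minimal (Generates I) J

/-- `J` is a cardinality-minimum implication base of the context. -/
def IsMinimumImplicationBase {G M : Type} [DecidableEq M] (I : G → M → Prop)
    (J : Set (Implication M)) : Prop :=
  Generates I J ∧ ∀ S : Set (Implication M), Generates I S → J.encard ≤ S.encard

/-! ### The problem MIBR -/

/-- An instance of MIBR: a finite formal context given by its cross-table, and a list of
implications over its attributes. -/
structure MIBRInstance where
  objects : ℕ
  attributes : ℕ
  table : Fin objects → Fin attributes → Bool
  J : List (Implication (Fin attributes))

/-- The incidence relation of the given context. -/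
def MIBRInstance.I (x : MIBRInstance) : Fin x.objects → Fin x.attributes → Prop :=
  fun g m => x.table g m = true

/-- The given set of implications. -/
def MIBRInstance.implications (x : MIBRInstance) : Set (Implication (Fin x.attributes)) :=
  {i | i ∈ x.J}

/-- The encoding of an instance of MIBR. -/
def MIBRInstance.encode (x : MIBRInstance) : List Bool :=
  encodeNat x.objects ++ encodeNat x.attributes ++ encodeMatrix x.table ++
    encodeList (fun i => encodeSubset i.1 ++ encodeSubset i.2) x.J

theorem MIBRInstance.encode_injective : Function.Injective MIBRInstance.encode := by
  rintro ⟨g, m, a, J⟩ ⟨g', m', a', J'⟩ h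
  simp only [MIBRInstance.encode, List.append_assoc] at h
  obtain ⟨rfl, h1⟩ := prefixInjective_nat _ _ _ _ h
  obtain ⟨rfl, h2⟩ := prefixInjective_nat _ _ _ _ h1
  obtain ⟨rfl, h3⟩ := prefixInjective_matrix _ _ _ _ h2
  have hI : PrefixInjective
      (fun i : Implication (Fin m) => encodeSubset i.1 ++ encodeSubset i.2) := by
    rintro ⟨X, Y⟩ ⟨X', Y'⟩ s t h
    simp only [List.append_assoc] at h
    obtain ⟨rfl, h4⟩ := prefixInjective_subset _ _ _ _ h
    obtain ⟨rfl, h5⟩ := prefixInjective_subset _ _ _ _ h4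
    exact ⟨rfl, h5⟩
  obtain rfl := (prefixInjective_list hI).injective h3
  rfl

/-- Minimum implication base recognition (MIBR): is the given set of implications an implication
base (an inclusion-minimal generating set of implications) of the given context? -/
def MIBR : DecisionProblem where
  Instance := MIBRInstance
  encode := MIBRInstance.encode
  encode_injective := MIBRInstance.encode_injective
  Yes x := IsImplicationBase x.I x.implications

/-- The variant of MIBR in which a base is only required to be sound and complete. -/
def GeneratingSetRecognition : DecisionProblem where
  Instance := MIBRInstance
  encode := MIBRInstance.encode
  encode_injective := MIBRInstance.encode_injective
  Yes x := Generates x.I x.implications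

/-- The variant of MIBR in which a base is required to have minimum cardinality. -/
def CardinalityMinimumBaseRecognition : DecisionProblem where
  Instance := MIBRInstance
  encode := MIBRInstance.encode
  encode_injective := MIBRInstance.encode_injective
  Yes x := IsMinimumImplicationBase x.I x.implications

end LatticeDuality

/-! Each lattice is replaced by a block of attributes: two copies of its elements and one extra
attribute. Two further attributes, `guard` and `goal`, are shared by all blocks. A join implication
leads from the first copy of p and the second copy of q to both copies of the ideal below p ∨ q and
the extra attribute. So a block of a model either misses one copy altogether, and is then not
constrained by the join implications, or is the same principal ideal in both copies
(`JoinClosed.side_or_ideal`). A goal implication, one for each a ∈ A, leads from the ideal of a in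
all blocks together with `guard` to `goal`.

A model with `guard` whose blocks are all principal ideals is thus a point P of the product, and it
is forced to contain `goal` as soon as a ≤ P for some a ∈ A. The objects are models. Those that do
not come from B separate every model from every attribute it misses, except for `goal` in the case
of such a point. There only the object of some b ∈ B with P ≤ b can help. Since a set of sound
implications is complete iff its models are intersections of object intents (`generates_iff`),
generation is equivalent to duality: `exists_obj_of_cover`, `cover_of_exists_obj`,
`generates_toMIBR_iff`.

The same map settles the two minimality variants, because a generating set of this shape
automatically has minimum cardinality (`Generates.isMinimum`, `DPLInstance.isMinimum_of_generates`).
Due to the two copies, the premises of join implications are two-element sets whose proper subsets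
are closed. Without `guard` the goal implications are inactive, and the premises of goal
implications are kept apart by the antichain property.

For the time bound, the map is written as a loop program on stacks. A program compiles to a machine
(`Cmd.steps_run`), and a stratification of its variables by ranks keeps sizes and running time
polynomial (`Cmd.exists_growth`, `Cmd.exists_cost_le`, `Cmd.computableInPolyTime`).
`Reduction.run_program` shows that the concrete program outputs the code of the constructed
instance. -/

namespace LatticeDuality

open Function Turing

/-! ### Loop programs on stacks -/

/-- The contents of the stacks of a program. -/
abbrev Store (V : Type) := V → List Bool

/-- Loop programs whose variables are stacks of bits. -/
inductive Cmd (V : Type) : Type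
  | skip : Cmd V
  /-- Push a bit. -/
  | push (v : V) (b : Bool) : Cmd V
  /-- Drop the top bit. -/
  | pop (v : V) : Cmd V
  /-- Branch on the top bit (absent, `false` or `true`). -/
  | test (v : V) (cn cf ct : Cmd V) : Cmd V
  | seq (c d : Cmd V) : Cmd V
  /-- Put a copy of `v` on top of `w`. -/
  | copy (v w : V) : Cmd V
  /-- Move the unary number on top of `v` to `w`, and drop its end marker. -/
  | scan (v w : V) : Cmd V
  /-- Repeat as often as `v` initially has bits. -/
  | loop (v : V) (c : Cmd V) : Cmd V

namespace Cmd

variable {V : Type} [DecidableEq V]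

/-- The effect of a program. -/
def run : Cmd V → Store V → Store V
  | skip, s => s
  | push v b, s => update s v (b :: s v)
  | pop v, s => update s v (s v).tail
  | test v cn cf ct, s =>
    match (s v).head? with
    | none => cn.run s
    | some false => cf.run s
    | some true => ct.run s
  | seq c d, s => d.run (c.run s)
  | copy v w, s => update s w (s v ++ s w)
  | scan v w, s =>
    update (update s v ((s v).dropWhile id).tail) w
      (List.replicate ((s v).takeWhile id).length true ++ s w)
  | loop v c, s => c.run^[(s v).length] s

/-- A bound for the number of machine steps. -/
def cost : Cmd V → Store V → ℕ
  | skip, _ => 1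
  | push _ _, _ => 1
  | pop _, _ => 1
  | test _ cn cf ct, s => cn.cost s + cf.cost s + ct.cost s + 1
  | seq c d, s => c.cost s + d.cost (c.run s)
  | copy v _, s => 2 * (s v).length + 2
  | scan v _, s => (s v).length + 1
  -- One step sets the end marker, two passes of one step more than the length move the stack to the
  -- buffer and back, and one step reads the marker at the end. Every round costs one additional
  -- step to pop its token.
  | loop v c, s => 2 * (s v).length + 4 +
      ∑ j ∈ Finset.range (s v).length, (c.cost (c.run^[j] s) + 1)

/-- The rank condition: variables of rank below `m` do not grow, and a variable can only grow by
copying variables of smaller rank and inside loops controlled by variables of smaller rank. -/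
def Ranked (rk : V → ℕ) : ℕ → Cmd V → Prop
  | _, skip => True
  | m, push v _ => m ≤ rk v
  | _, pop _ => True
  | m, test _ cn cf ct => Ranked rk m cn ∧ Ranked rk m cf ∧ Ranked rk m ct
  | m, seq c d => Ranked rk m c ∧ Ranked rk m d
  | m, copy v w => m ≤ rk w ∧ rk v < rk w
  | m, scan v w => m ≤ rk w ∧ rk v < rk w
  | m, loop v c => Ranked rk (max m (rk v + 1)) c

/-! ### Compilation to a Turing machine -/

/-- The machine labels used by a program. -/
def Label : Cmd V → Type
  | skip => Unit
  | push _ _ => Unit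
  | pop _ => Unit
  | test _ cn cf ct => Unit ⊕ (cn.Label ⊕ (cf.Label ⊕ ct.Label))
  | seq c d => c.Label ⊕ d.Label
  | copy _ _ => Bool
  | scan _ _ => Unit
  | loop _ c => Fin 4 ⊕ c.Label

instance fintypeLabel : (c : Cmd V) → Fintype c.Label
  | skip => inferInstanceAs (Fintype Unit)
  | push _ _ => inferInstanceAs (Fintype Unit)
  | pop _ => inferInstanceAs (Fintype Unit)
  | test _ cn cf ct =>
    letI := fintypeLabel cn
    letI := fintypeLabel cf
    letI := fintypeLabel ct
    inferInstanceAs (Fintype (Unit ⊕ (cn.Label ⊕ (cf.Label ⊕ ct.Label))))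
  | seq c d =>
    letI := fintypeLabel c
    letI := fintypeLabel d
    inferInstanceAs (Fintype (c.Label ⊕ d.Label))
  | copy _ _ => inferInstanceAs (Fintype Bool)
  | scan _ _ => inferInstanceAs (Fintype Unit)
  | loop _ c =>
    letI := fintypeLabel c
    inferInstanceAs (Fintype (Fin 4 ⊕ c.Label))

/-- The label at which a program starts. -/
def entry : (c : Cmd V) → c.Label
  | skip => ()
  | push _ _ => ()
  | pop _ => ()
  | test _ _ _ _ => Sum.inl ()
  | seq c _ => Sum.inl c.entry
  | copy _ _ => false
  | scan _ _ => ()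
  | loop _ _ => Sum.inl (0 : Fin 4)

/-- The stacks of the compiled machine: the variables, a control stack and a buffer. -/
abbrev StackIdx (V : Type) := V ⊕ Bool

/-- Machine statements: all stacks hold bits, and the register holds the bit read last. -/
abbrev Code (V Λ : Type) := TM2.Stmt (fun _ : StackIdx V => Bool) Λ (Option Bool)

/-- Jump to a fixed label. -/
def jump {Λ : Type} (l : Λ) : Code V Λ := TM2.Stmt.goto fun _ => l

/-- Pop a bit into the register and branch on whether there was one. -/
def popBranch {Λ : Type} (k : StackIdx V) (q q' : Code V Λ) : Code V Λ :=
  TM2.Stmt.pop k (fun _ o => o) (TM2.Stmt.branch Option.isSome q q')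

/-- Push the bit in the register. -/
def pushReg {Λ : Type} (k : StackIdx V) (q : Code V Λ) : Code V Λ :=
  TM2.Stmt.push k (fun r => r.getD false) q

/-- The machine code of a program, with an embedding of its labels and an exit label. -/
def code {Λ : Type} : (c : Cmd V) → (c.Label → Λ) → Λ → c.Label → Code V Λ
  | skip, _, exit, _ => jump exit
  | push v b, _, exit, _ => TM2.Stmt.push (Sum.inl v) (fun _ => b) (jump exit)
  | pop v, _, exit, _ => TM2.Stmt.pop (Sum.inl v) (fun _ o => o) (jump exit)
  | test v cn cf ct, emb, exit, l =>
    match l with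
    | Sum.inl _ =>
      TM2.Stmt.peek (Sum.inl v) (fun _ o => o) <|
        TM2.Stmt.branch Option.isSome
          (TM2.Stmt.branch (fun r => r.getD false)
            (jump (emb (Sum.inr (Sum.inr (Sum.inr ct.entry)))))
            (jump (emb (Sum.inr (Sum.inr (Sum.inl cf.entry))))))
          (jump (emb (Sum.inr (Sum.inl cn.entry))))
    | Sum.inr (Sum.inl l) => cn.code (fun l => emb (Sum.inr (Sum.inl l))) exit l
    | Sum.inr (Sum.inr (Sum.inl l)) => cf.code (fun l => emb (Sum.inr (Sum.inr (Sum.inl l)))) exit l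
    | Sum.inr (Sum.inr (Sum.inr l)) => ct.code (fun l => emb (Sum.inr (Sum.inr (Sum.inr l)))) exit l
  | seq c d, emb, exit, l =>
    match l with
    | Sum.inl l => c.code (fun l => emb (Sum.inl l)) (emb (Sum.inr d.entry)) l
    | Sum.inr l => d.code (fun l => emb (Sum.inr l)) exit l
  | copy v w, emb, exit, l =>
    match l with
    | false => popBranch (Sum.inl v) (pushReg (Sum.inr true) (jump (emb false))) (jump (emb true))
    | true => popBranch (Sum.inr true)
        (pushReg (Sum.inl v) (pushReg (Sum.inl w) (jump (emb true)))) (jump exit)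
  | scan v w, emb, exit, _ =>
    popBranch (Sum.inl v)
      (TM2.Stmt.branch (fun r => r.getD false) (pushReg (Sum.inl w) (jump (emb ()))) (jump exit))
      (jump exit)
  | loop v c, emb, exit, l =>
    match l with
    -- The control stack receives a `false` marker and on top of it one `true` for each round.
    -- Nested loops can share this stack, since each of them stops at its own marker.
    | Sum.inl (0 : Fin 4) =>
      TM2.Stmt.push (Sum.inr false) (fun _ => false) (jump (emb (Sum.inl (1 : Fin 4))))
    | Sum.inl (1 : Fin 4) =>
      popBranch (Sum.inl v) (pushReg (Sum.inr true) (jump (emb (Sum.inl (1 : Fin 4)))))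
        (jump (emb (Sum.inl (2 : Fin 4))))
    | Sum.inl (2 : Fin 4) =>
      popBranch (Sum.inr true)
        (pushReg (Sum.inl v) (TM2.Stmt.push (Sum.inr false) (fun _ => true)
          (jump (emb (Sum.inl (2 : Fin 4))))))
        (jump (emb (Sum.inl (3 : Fin 4))))
    | Sum.inl (3 : Fin 4) =>
      popBranch (Sum.inr false)
        (TM2.Stmt.branch (fun r => r.getD false) (jump (emb (Sum.inr c.entry))) (jump exit))
        (jump exit)
    | Sum.inr l => c.code (fun l => emb (Sum.inr l)) (emb (Sum.inl (3 : Fin 4))) l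

end Cmd

/-! ### Correctness of the compilation -/

/-- `n` steps of the machine at most lead from `c` to `c'`. -/
def ReachesWithin {α : Type} (f : α → Option α) (n : ℕ) (c c' : α) : Prop :=
  ∃ m ≤ n, (flip bind f)^[m] (some c) = some c'

theorem replicate_append_cons_self {α : Type*} (n : ℕ) (a : α) (l : List α) :
    List.replicate n a ++ a :: l = List.replicate (n + 1) a ++ l := by
  rw [List.replicate_succ', List.append_assoc, List.singleton_append]

namespace ReachesWithin

variable {α : Type} {f : α → Option α}

theorem trans {m n : ℕ} {a b c : α} (h : ReachesWithin f m a b) (h' : ReachesWithin f n b c) :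
    ReachesWithin f (m + n) a c := by
  obtain ⟨i, hi, h⟩ := h
  obtain ⟨j, hj, h'⟩ := h'
  exact ⟨j + i, by omega, by rw [iterate_add_apply, h, h']⟩

theorem single {a b : α} (h : f a = some b) : ReachesWithin f 1 a b :=
  ⟨1, le_rfl, by simpa [flip] using h⟩

theorem head {n : ℕ} {a b c : α} (h : f a = some b) (h' : ReachesWithin f n b c) :
    ReachesWithin f (n + 1) a c :=
  add_comm 1 n ▸ (single h).trans h'

theorem mono {m n : ℕ} {a b : α} (h : ReachesWithin f m a b) (hmn : m ≤ n) :
    ReachesWithin f n a b := by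
  obtain ⟨i, hi, h⟩ := h
  exact ⟨i, hi.trans hmn, h⟩

end ReachesWithin

namespace Cmd

variable {V : Type}

/-- The stacks of the machine: variables, control stack and buffer. -/
def stk (s : Store V) (a t : List Bool) : StackIdx V → List Bool :=
  Sum.elim s fun b => cond b t a

variable (s : Store V) (a t : List Bool)

@[simp] theorem stk_inl (v : V) : stk s a t (Sum.inl v) = s v := rfl
@[simp] theorem stk_false : stk s a t (Sum.inr false) = a := rfl
@[simp] theorem stk_true : stk s a t (Sum.inr true) = t := rfl

variable [DecidableEq V]

@[simp] theorem update_stk_inl (v : V) (x : List Bool) :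
    update (stk s a t) (Sum.inl v) x = stk (update s v x) a t := by
  funext k
  rcases k with u | b
  · by_cases h : u = v
    · subst h; simp
    · simp [update_of_ne h, update_of_ne (fun h' => h (Sum.inl.inj h') : (Sum.inl u : StackIdx V) ≠ _)]
  · cases b <;> simp

@[simp] theorem update_stk_false (x : List Bool) :
    update (stk s a t) (Sum.inr false) x = stk s x t := by
  funext k
  rcases k with u | b
  · simp
  · cases b <;> simp

@[simp] theorem update_stk_true (x : List Bool) :
    update (stk s a t) (Sum.inr true) x = stk s a x := by
  funext k
  rcases k with u | b
  · simp
  · cases b <;> simp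

/-- The machine configurations. -/
abbrev MCfg (V Λ : Type) := TM2.Cfg (fun _ : StackIdx V => Bool) Λ (Option Bool)

/-- From label `l` with variables `s`, the machine gets to label `l'` with variables `s'` within
`n` steps, whatever the control stack. -/
def Steps {Λ : Type} (M : Λ → Code V Λ) (n : ℕ) (l : Λ) (s : Store V) (l' : Λ) (s' : Store V) :
    Prop :=
  ∀ r a, ∃ r', ReachesWithin (TM2.step M) n (⟨some l, r, stk s a []⟩ : MCfg V Λ)
    ⟨some l', r', stk s' a []⟩

theorem Steps.trans {Λ : Type} {M : Λ → Code V Λ} {m n : ℕ} {l l' l'' : Λ} {s s' s'' : Store V}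
    (h : Steps M m l s l' s') (h' : Steps M n l' s' l'' s'') : Steps M (m + n) l s l'' s'' := by
  intro r a
  obtain ⟨r', h1⟩ := h r a
  obtain ⟨r'', h2⟩ := h' r' a
  exact ⟨r'', h1.trans h2⟩

theorem Steps.mono {Λ : Type} {M : Λ → Code V Λ} {m n : ℕ} {l l' : Λ} {s s' : Store V}
    (h : Steps M m l s l' s') (hmn : m ≤ n) : Steps M n l s l' s' := by
  intro r a
  obtain ⟨r', h1⟩ := h r a
  exact ⟨r', h1.mono hmn⟩


section Moves

variable {Λ : Type} {M : Λ → Code V Λ} {v w : V} {l l' : Λ}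

theorem reaches_toBuffer
    (hM : M l = popBranch (Sum.inl v) (pushReg (Sum.inr true) (jump l)) (jump l'))
    (x : List Bool) : ∀ (s : Store V) (r : Option Bool) (a t : List Bool), s v = x →
    ∃ r', ReachesWithin (TM2.step M) (x.length + 1) (⟨some l, r, stk s a t⟩ : MCfg V Λ)
      ⟨some l', r', stk (update s v []) a (x.reverse ++ t)⟩ := by
  induction x with
  | nil =>
    intro s r a t h
    exact ⟨none, ReachesWithin.single (by simp [hM, popBranch, jump, h])⟩
  | cons b x ih =>
    intro s r a t h
    obtain ⟨r', h'⟩ := ih (update s v x) (some b) a (b :: t) (by simp)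
    refine ⟨r', ReachesWithin.head (b := ⟨some l, some b, stk (update s v x) a (b :: t)⟩) ?_
      (by simpa using h')⟩
    simp [hM, popBranch, pushReg, jump, h]

/-- The buffer holds the contents in reverse, so popping it restores the original order on both
targets. -/
theorem reaches_copyBack (hvw : w ≠ v)
    (hM : M l = popBranch (Sum.inr true)
        (pushReg (Sum.inl v) (pushReg (Sum.inl w) (jump l))) (jump l'))
    (x : List Bool) : ∀ (s : Store V) (r : Option Bool) (a : List Bool),
    ∃ r', ReachesWithin (TM2.step M) (x.length + 1) (⟨some l, r, stk s a x⟩ : MCfg V Λ)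
      ⟨some l', r', stk (update (update s v (x.reverse ++ s v)) w (x.reverse ++ s w)) a []⟩ := by
  induction x with
  | nil =>
    intro s r a
    exact ⟨none, ReachesWithin.single (by simp [hM, popBranch, jump])⟩
  | cons b x ih =>
    intro s r a
    obtain ⟨r', h'⟩ := ih (update (update s v (b :: s v)) w (b :: s w)) (some b) a
    refine ⟨r', ReachesWithin.head
      (b := ⟨some l, some b, stk (update (update s v (b :: s v)) w (b :: s w)) a x⟩) ?_ ?_⟩
    · simp [hM, popBranch, pushReg, jump, update_of_ne hvw]
    · rw [List.length_cons]
      convert h' using 3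
      funext u
      by_cases hw : u = w
      · subst hw; simp
      · by_cases hv : u = v
        · subst hv; simp [hw]
        · simp [hw, hv]

theorem reaches_loopBack
    (hM : M l = popBranch (Sum.inr true)
        (pushReg (Sum.inl v) (TM2.Stmt.push (Sum.inr false) (fun _ => true) (jump l))) (jump l'))
    (x : List Bool) : ∀ (s : Store V) (r : Option Bool) (a : List Bool),
    ∃ r', ReachesWithin (TM2.step M) (x.length + 1) (⟨some l, r, stk s a x⟩ : MCfg V Λ)
      ⟨some l', r', stk (update s v (x.reverse ++ s v)) (List.replicate x.length true ++ a) []⟩ := by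
  induction x with
  | nil =>
    intro s r a
    exact ⟨none, ReachesWithin.single (by simp [hM, popBranch, jump])⟩
  | cons b x ih =>
    intro s r a
    obtain ⟨r', h'⟩ := ih (update s v (b :: s v)) (some b) (true :: a)
    refine ⟨r', ReachesWithin.head
      (b := ⟨some l, some b, stk (update s v (b :: s v)) (true :: a) x⟩) ?_ ?_⟩
    · simp [hM, popBranch, pushReg, jump]
    · rw [List.length_cons]
      convert h' using 3
      · simp
      · exact (replicate_append_cons_self _ _ _).symm

theorem reaches_scan (hvw : w ≠ v)
    (hM : M l = popBranch (Sum.inl v)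
      (TM2.Stmt.branch (fun r => r.getD false) (pushReg (Sum.inl w) (jump l)) (jump l'))
      (jump l'))
    (x : List Bool) : ∀ (s : Store V) (r : Option Bool) (a : List Bool), s v = x →
    ∃ r', ReachesWithin (TM2.step M) (x.length + 1) (⟨some l, r, stk s a []⟩ : MCfg V Λ)
      ⟨some l', r', stk ((scan v w).run s) a []⟩ := by
  induction x with
  | nil =>
    intro s r a h
    refine ⟨none, ReachesWithin.single ?_⟩
    have hs : (scan v w).run s = update s v [] := by
      funext u; by_cases hw : u = w <;> by_cases hv : u = v <;> simp_all [run]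
    simp [hM, popBranch, jump, h, hs]
  | cons b x ih =>
    intro s r a h
    cases b with
    | false =>
      refine ⟨some false, (ReachesWithin.single ?_).mono (Nat.le_add_left _ _)⟩
      have hs : (scan v w).run s = update s v x := by
        funext u; by_cases hw : u = w <;> by_cases hv : u = v <;> simp_all [run]
      simp [hM, popBranch, jump, h, hs]
    | true =>
      obtain ⟨r', h'⟩ := ih (update (update s v x) w (true :: s w)) (some true) a
        (by simp [update_of_ne hvw.symm])
      refine ⟨r', ReachesWithin.head
        (b := ⟨some l, some true, stk (update (update s v x) w (true :: s w)) a []⟩) ?_ ?_⟩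
      · simp [hM, popBranch, pushReg, jump, h, update_of_ne hvw]
      · rw [List.length_cons]
        convert h' using 3
        funext u
        by_cases hw : u = w
        · subst hw; simp [run, h, hvw.symm, replicate_append_cons_self]
        · by_cases hv : u = v
          · subst hv; simp [run, hw, h]
          · simp [run, hw, hv]

end Moves

end Cmd

end LatticeDuality

namespace LatticeDuality

open Function Turing

namespace Cmd

variable {V : Type} [DecidableEq V]

theorem steps_of_step {Λ : Type} {M : Λ → Code V Λ} {l l' : Λ} {s s' : Store V}
    (h : ∀ r a, ∃ r', TM2.step M (⟨some l, r, stk s a []⟩ : MCfg V Λ) =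
      some ⟨some l', r', stk s' a []⟩) : Steps M 1 l s l' s' := fun r a => by
  obtain ⟨r', h'⟩ := h r a
  exact ⟨r', .single h'⟩

/-- The embedding of labels, the exit and the ambient machine are arbitrary, so that the induction
hypotheses apply to subprograms placed inside a larger machine. The ranks serve only to make source
and target of `copy` and `scan` distinct. -/
theorem steps_run {rk : V → ℕ} (c : Cmd V) : ∀ {m : ℕ}, Ranked rk m c →
    ∀ {Λ : Type} (M : Λ → Code V Λ) (emb : c.Label → Λ) (exit : Λ),
    (∀ l, M (emb l) = c.code emb exit l) → ∀ s : Store V,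
    Steps M (c.cost s) (emb c.entry) s exit (c.run s) := by
  induction c with
  | skip =>
    intro m hc Λ M emb exit hM s
    exact steps_of_step fun r a => ⟨r, by simp [hM, code, jump, run]⟩
  | push v b =>
    intro m hc Λ M emb exit hM s
    exact steps_of_step fun r a => ⟨r, by simp [hM, code, jump, run]⟩
  | pop v =>
    intro m hc Λ M emb exit hM s
    exact steps_of_step fun r a => ⟨(s v).head?, by simp [hM, code, jump, run]⟩
  | test v cn cf ct ihn ihf iht =>
    intro m hc Λ M emb exit hM s
    have hn := ihn hc.1 M (fun l => emb (Sum.inr (Sum.inl l))) exit (fun l => hM _) s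
    have hf := ihf hc.2.1 M (fun l => emb (Sum.inr (Sum.inr (Sum.inl l)))) exit (fun l => hM _) s
    have ht := iht hc.2.2 M (fun l => emb (Sum.inr (Sum.inr (Sum.inr l)))) exit (fun l => hM _) s
    have h0 := hM (Sum.inl ())
    rcases hv : (s v).head? with _ | b
    · rw [show (test v cn cf ct).run s = cn.run s by simp [run, hv]]
      refine ((steps_of_step (l' := _) (s' := s) fun r a => ⟨none, ?_⟩).trans hn).mono
        (by simp only [cost]; omega)
      simp [entry, h0, code, jump, hv]
    · cases b with
      | false =>
        rw [show (test v cn cf ct).run s = cf.run s by simp [run, hv]]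
        refine ((steps_of_step (l' := _) (s' := s) fun r a => ⟨some false, ?_⟩).trans hf).mono
          (by simp only [cost]; omega)
        simp [entry, h0, code, jump, hv]
      | true =>
        rw [show (test v cn cf ct).run s = ct.run s by simp [run, hv]]
        refine ((steps_of_step (l' := _) (s' := s) fun r a => ⟨some true, ?_⟩).trans ht).mono
          (by simp only [cost]; omega)
        simp [entry, h0, code, jump, hv]
  | seq c d ihc ihd =>
    intro m hc Λ M emb exit hM s
    exact (ihc hc.1 M (fun l => emb (Sum.inl l)) (emb (Sum.inr d.entry)) (fun l => hM _) s).trans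
      (ihd hc.2 M (fun l => emb (Sum.inr l)) exit (fun l => hM _) (c.run s))
  | copy v w =>
    intro m hc Λ M emb exit hM s r a
    have hvw : w ≠ v := fun h => (h ▸ hc.2).false
    obtain ⟨r1, h1⟩ := reaches_toBuffer (hM false) (s v) s r a [] rfl
    obtain ⟨r2, h2⟩ := reaches_copyBack hvw (hM true) (s v).reverse (update s v []) r1 a
    rw [List.append_nil] at h1
    refine ⟨r2, ((h1.trans h2).mono (n := (copy v w).cost s) (by simp [cost]; omega)) |> fun h => ?_⟩
    convert h using 3
    · rfl
    funext u
    by_cases hw : u = w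
    · subst hw; simp [run, hvw]
    · by_cases hv : u = v
      · subst hv; simp [run, hw]
      · simp [run, hw]
  | scan v w =>
    intro m hc Λ M emb exit hM s r a
    have hvw : w ≠ v := fun h => (h ▸ hc.2).false
    exact reaches_scan hvw (hM ()) (s v) s r a rfl
  | loop v c ih =>
    intro m hc Λ M emb exit hM s
    have hM0 := hM (Sum.inl (0 : Fin 4))
    have hM3 := hM (Sum.inl (3 : Fin 4))
    have hbody := ih hc M (fun l => emb (Sum.inr l)) (emb (Sum.inl (3 : Fin 4))) (fun l => hM _)
    -- Here i rounds are done and n tokens are left above the marker. The induction is on n, while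
    -- the store is expressed by i.
    have key : ∀ n i, i + n = (s v).length → ∀ r a, ∃ r', ReachesWithin (TM2.step M)
        (1 + ∑ j ∈ Finset.Ico i (s v).length, (c.cost (c.run^[j] s) + 1))
        (⟨some (emb (Sum.inl (3 : Fin 4))), r,
          stk (c.run^[i] s) (List.replicate n true ++ false :: a) []⟩ : MCfg V Λ)
        ⟨some exit, r', stk (c.run^[(s v).length] s) a []⟩ := by
      intro n
      induction n with
      | zero =>
        rintro i hi r a
        obtain rfl : i = (s v).length := by omega
        refine ⟨some false, (ReachesWithin.single ?_).mono (Nat.le_add_right _ _)⟩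
        simp [hM3, code, popBranch, jump]
      | succ n ihn =>
        rintro i hi r a
        obtain ⟨r1, h1⟩ := hbody (c.run^[i] s) (some true) (List.replicate n true ++ false :: a)
        obtain ⟨r2, h2⟩ := ihn (i + 1) (by omega) r1 a
        rw [iterate_succ_apply'] at h2
        refine ⟨r2, (ReachesWithin.head (b := ⟨some (emb (Sum.inr c.entry)), some true,
          stk (c.run^[i] s) (List.replicate n true ++ false :: a) []⟩) ?_ (h1.trans h2)).mono ?_⟩
        · simp [hM3, code, popBranch, jump, List.replicate_succ]
        · rw [Finset.sum_eq_sum_Ico_succ_bot (by omega : i < (s v).length)]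
          omega
    intro r a
    obtain ⟨r1, h1⟩ := reaches_toBuffer (hM (Sum.inl (1 : Fin 4))) (s v) s r (false :: a) [] rfl
    obtain ⟨r2, h2⟩ := reaches_loopBack (hM (Sum.inl (2 : Fin 4))) (s v).reverse (update s v []) r1
      (false :: a)
    obtain ⟨r3, h3⟩ := key (s v).length 0 (by simp) r2 a
    rw [List.append_nil] at h1
    have hs : update (update s v []) v ((s v).reverse.reverse ++ update s v [] v) = s := by simp
    rw [hs, List.length_reverse] at h2
    refine ⟨r3, (ReachesWithin.head (b := ⟨some (emb (Sum.inl (1 : Fin 4))), r,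
      stk s (false :: a) []⟩) ?_ (h1.trans (h2.trans h3))).mono ?_⟩
    · simp [hM0, code, jump, entry]
    · rw [← Finset.range_eq_Ico, cost]
      omega

end Cmd

end LatticeDuality

/-! ### Polynomial bounds for ranked programs -/

namespace LatticeDuality

open Function Turing Polynomial

theorem eval_le_eval (p : ℕ[X]) {a b : ℕ} (h : a ≤ b) : p.eval a ≤ p.eval b := by
  rw [eval_eq_sum_range, eval_eq_sum_range]
  gcongr

namespace Cmd

variable {V : Type} [Fintype V] (rk : V → ℕ)

/-- The total length of the stacks of rank less than `r`. -/
def size (r : ℕ) (s : Store V) : ℕ := ∑ v with rk v < r, (s v).length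

variable {rk}

theorem size_mono {r r' : ℕ} (h : r ≤ r') (s : Store V) : size rk r s ≤ size rk r' s :=
  Finset.sum_le_sum_of_subset fun _ hv => by
    simp only [Finset.mem_filter, Finset.mem_univ, true_and] at hv ⊢
    exact hv.trans_le h

theorem length_le_size {r : ℕ} {v : V} (h : rk v < r) (s : Store V) :
    (s v).length ≤ size rk r s :=
  Finset.single_le_sum (f := fun v => (s v).length) (fun _ _ => Nat.zero_le _)
    (Finset.mem_filter.2 ⟨Finset.mem_univ v, h⟩)

theorem size_le_add {r b : ℕ} {s s' : Store V}
    (h : ∀ v, rk v < r → (s' v).length ≤ (s v).length + b) :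
    size rk r s' ≤ size rk r s + Fintype.card V * b := by
  unfold size
  calc ∑ v with rk v < r, (s' v).length
      ≤ ∑ v with rk v < r, ((s v).length + b) :=
        Finset.sum_le_sum fun v hv => h v (Finset.mem_filter.1 hv).2
    _ ≤ _ := by
        rw [Finset.sum_add_distrib, Finset.sum_const, smul_eq_mul]
        gcongr
        exact Finset.card_le_univ _

/-- `p` bounds the growth of every variable in terms of the variables of smaller rank, and
variables of rank below `m` do not grow. -/
def Growth (rk : V → ℕ) (m : ℕ) (F : Store V → Store V) (p : ℕ[X]) : Prop :=
  ∀ s v, (F s v).length ≤ (s v).length + if m ≤ rk v then p.eval (size rk (rk v) s) else 0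

theorem Growth.le {m : ℕ} {F : Store V → Store V} {p : ℕ[X]} (h : Growth rk m F p)
    (s : Store V) (v : V) : (F s v).length ≤ (s v).length + p.eval (size rk (rk v) s) :=
  (h s v).trans (by split_ifs <;> omega)

theorem Growth.size_le {m : ℕ} {F : Store V → Store V} {p : ℕ[X]} (h : Growth rk m F p)
    (s : Store V) (r : ℕ) :
    size rk r (F s) ≤ size rk r s + Fintype.card V * p.eval (size rk r s) :=
  size_le_add fun v hv => (h.le s v).trans (by gcongr; exact eval_le_eval p (size_mono hv.le s))

theorem Growth.mono {m : ℕ} {F : Store V → Store V} {p q : ℕ[X]} (h : Growth rk m F p)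
    (hpq : ∀ n, p.eval n ≤ q.eval n) : Growth rk m F q := fun s v =>
  (h s v).trans (by split_ifs; · gcongr; exact hpq _
                    · rfl)

/-- A polynomial bound for the sizes of all stores occurring in a loop. -/
theorem Growth.iterate_size {m : ℕ} {F : Store V → Store V} {p : ℕ[X]} {v : V}
    (h : Growth rk (max m (rk v + 1)) F p) (r : ℕ) :
    ∃ q : ℕ[X], ∀ s, ∀ j ≤ (s v).length,
      size rk r (F^[j] s) ≤ q.eval (size rk r s) := by
  induction r with
  | zero => exact ⟨0, fun s j _ => by simp [size]⟩
  | succ r ih =>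
    obtain ⟨q, hq⟩ := ih
    -- The factor `X` bounds the number of rounds, and `p.comp q` bounds the growth in a single
    -- round, because this growth depends only on variables of smaller rank, whose size stays below
    -- `q` by induction.
    refine ⟨X + C (Fintype.card V) * (X * p.comp q), fun s j hj => ?_⟩
    have key : ∀ u, rk u < r + 1 → ∀ i ≤ j, ((F^[i] s) u).length ≤ (s u).length +
        i * if rk v < rk u then p.eval (q.eval (size rk r s)) else 0 := by
      intro u hu i hi
      induction i with
      | zero => simp
      | succ i ihi =>
        rw [iterate_succ_apply']
        refine (h _ u).trans ((Nat.add_le_add_right (ihi (by omega)) _).trans ?_)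
        rw [add_assoc, add_mul, one_mul]
        gcongr
        split_ifs with h1 h2
        · refine eval_le_eval p ((size_mono (by omega) _).trans (hq s i (by omega)))
        · omega
        · exact Nat.zero_le _
        · exact le_rfl
    simp only [eval_add, eval_X, eval_mul, eval_C, eval_comp]
    refine size_le_add fun u hu => (key u hu j le_rfl).trans (Nat.add_le_add_left ?_ _)
    split_ifs with h1
    -- A variable that grows has rank above that of the loop variable, so the number of rounds is
    -- bounded in terms of the variables of smaller rank.
    · gcongr
      · exact hj.trans (length_le_size (by omega) s)
      · exact eval_le_eval p (eval_le_eval q (size_mono (by omega) s))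
    · simp

variable [DecidableEq V]

/-- The growth is additive, with a bound that depends on smaller ranks only. This form survives
iteration: repetition multiplies the bound by the number of rounds, whereas a multiplicative bound
would become exponential. -/
theorem exists_growth (c : Cmd V) : ∀ {m : ℕ}, Ranked rk m c → ∃ p, Growth rk m c.run p := by
  induction c with
  | skip => exact fun _ => ⟨0, fun s v => by simp [run]⟩
  | push w b =>
    refine fun hm => ⟨1, fun s v => ?_⟩
    by_cases h : v = w
    · subst h
      simp only [Ranked] at hm
      simp [run, hm]
    · simp [run, h]
  | pop w =>
    refine fun hm => ⟨0, fun s v => ?_⟩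
    by_cases h : v = w
    · subst h
      simp [run]
    · simp [run, h]
  | test w cn cf ct ihn ihf iht =>
    intro m hm
    obtain ⟨pn, hn⟩ := ihn hm.1
    obtain ⟨pf, hf⟩ := ihf hm.2.1
    obtain ⟨pt, ht⟩ := iht hm.2.2
    refine ⟨pn + pf + pt, fun s v => ?_⟩
    rcases hv : (s w).head? with _ | _ | _
    · simpa [run, hv] using hn.mono (q := pn + pf + pt) (by simp; omega) s v
    · simpa [run, hv] using hf.mono (q := pn + pf + pt) (by simp; omega) s v
    · simpa [run, hv] using ht.mono (q := pn + pf + pt) (by simp) s v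
  | seq c d ihc ihd =>
    intro m hm
    obtain ⟨p, hp⟩ := ihc hm.1
    obtain ⟨q, hq⟩ := ihd hm.2
    refine ⟨p + q.comp (X + C (Fintype.card V) * p), fun s v => ?_⟩
    refine (hq (c.run s) v).trans ((Nat.add_le_add_right (hp s v) _).trans ?_)
    split_ifs
    · simp only [eval_add, eval_comp, eval_X, eval_mul, eval_C, add_assoc]
      gcongr
      exact eval_le_eval q (hp.size_le s _)
    · simp
  | copy u w =>
    refine fun hm => ⟨X, fun s v => ?_⟩
    by_cases h : v = w
    · subst h
      have := length_le_size hm.2 s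
      simp only [run, update_self, List.length_append, if_pos hm.1, eval_X]
      omega
    · simp [run, h]
  | scan u w =>
    refine fun hm => ⟨X, fun s v => ?_⟩
    by_cases h : v = w
    · subst h
      have := length_le_size hm.2 s
      have h2 := (List.takeWhile_sublist id (l := s u)).length_le
      simp only [run, update_self, List.length_append, if_pos hm.1, eval_X, List.length_replicate]
      omega
    · by_cases h' : v = u
      · subst h'
        have h2 := (List.dropWhile_sublist id (l := s v)).length_le
        simp only [run, update_of_ne h, update_self, List.length_tail]
        omega
      · simp [run, h, h']
  | loop u c ih =>
    intro m hm
    obtain ⟨p, hp⟩ := ih hm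
    choose q hq using hp.iterate_size
    let R := Finset.univ.sup rk
    -- The polynomial bounding the sizes inside the loop depends on the rank. The sum over the
    -- finitely many ranks that occur serves all variables at once.
    have hle : ∀ v : V, ∀ n, (q (rk v)).eval n ≤ (∑ r ∈ Finset.range (R + 1), q r).eval n := by
      intro v n
      rw [eval_finsetSum]
      exact Finset.single_le_sum (f := fun r => (q r).eval n) (fun _ _ => Nat.zero_le _)
        (Finset.mem_range.2 (Nat.lt_succ_of_le (Finset.le_sup (Finset.mem_univ v))))
    refine ⟨X * p.comp (∑ r ∈ Finset.range (R + 1), q r), fun s v => ?_⟩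
    have key : ∀ i ≤ (s u).length, ((c.run^[i] s) v).length ≤ (s v).length +
        i * if max m (rk u + 1) ≤ rk v then
          p.eval ((∑ r ∈ Finset.range (R + 1), q r).eval (size rk (rk v) s)) else 0 := by
      intro i hi
      induction i with
      | zero => simp
      | succ i ihi =>
        rw [iterate_succ_apply']
        refine (hp _ v).trans ((Nat.add_le_add_right (ihi (by omega)) _).trans ?_)
        rw [add_assoc, add_mul, one_mul]
        gcongr
        split_ifs
        · exact eval_le_eval p ((hq _ s i (by omega)).trans (hle v _))
        · exact le_rfl
    refine (key _ le_rfl).trans (Nat.add_le_add_left ?_ _)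
    split_ifs with h1 h2
    · simp only [eval_mul, eval_X, eval_comp]
      gcongr
      exact length_le_size (by omega) s
    · omega
    · simp
    · simp

/-- All stores met during the run have polynomial size by `exists_growth` and `Growth.iterate_size`.
It remains to compose the bounds, and in a loop to multiply by the number of rounds. -/
theorem exists_cost_le (c : Cmd V) : ∀ {m r : ℕ}, (∀ v, rk v < r) → Ranked rk m c →
    ∃ p : ℕ[X], ∀ s, c.cost s ≤ p.eval (size rk r s) := by
  induction c with
  | skip => exact fun _ _ => ⟨1, fun s => by simp [cost]⟩
  | push w b => exact fun _ _ => ⟨1, fun s => by simp [cost]⟩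
  | pop w => exact fun _ _ => ⟨1, fun s => by simp [cost]⟩
  | test w cn cf ct ihn ihf iht =>
    intro m r hr hm
    obtain ⟨pn, hn⟩ := ihn hr hm.1
    obtain ⟨pf, hf⟩ := ihf hr hm.2.1
    obtain ⟨pt, ht⟩ := iht hr hm.2.2
    refine ⟨pn + pf + pt + 1, fun s => ?_⟩
    have := hn s
    have := hf s
    have := ht s
    simp only [cost, eval_add, eval_one]
    omega
  | seq c d ihc ihd =>
    intro m r hr hm
    obtain ⟨p, hp⟩ := ihc hr hm.1
    obtain ⟨q, hq⟩ := ihd hr hm.2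
    obtain ⟨g, hg⟩ := exists_growth c hm.1
    refine ⟨p + q.comp (X + C (Fintype.card V) * g), fun s => ?_⟩
    simp only [cost, eval_add, eval_comp, eval_X, eval_mul, eval_C]
    gcongr
    · exact hp s
    · exact (hq _).trans (eval_le_eval q (hg.size_le s _))
  | copy u w =>
    intro m r hr hm
    refine ⟨2 * X + 2, fun s => ?_⟩
    have := length_le_size (hr u) s
    simp [cost]
    omega
  | scan u w =>
    intro m r hr hm
    refine ⟨X + 1, fun s => ?_⟩
    have := length_le_size (hr u) s
    simp [cost]
    omega
  | loop u c ih =>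
    intro m r hr hm
    obtain ⟨p, hp⟩ := ih hr hm
    obtain ⟨g, hg⟩ := exists_growth c hm
    obtain ⟨q, hq⟩ := hg.iterate_size r
    refine ⟨2 * X + 4 + X * (p.comp q + 1), fun s => ?_⟩
    have h1 := length_le_size (hr u) s
    simp only [cost, eval_add, eval_mul, eval_comp, eval_one, eval_X, eval_ofNat]
    refine Nat.add_le_add (by omega) ?_
    calc _ ≤ ∑ j ∈ Finset.range (s u).length, (p.eval (q.eval (size rk r s)) + 1) :=
          Finset.sum_le_sum fun j hj => by
            gcongr
            exact (hp _).trans (eval_le_eval p (hq s j (Finset.mem_range.1 hj).le))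
      _ ≤ _ := by
          rw [Finset.sum_const, Finset.card_range, smul_eq_mul]
          gcongr

/-- Empty a stack. -/
def clear (v : V) : Cmd V := loop v (pop v)

omit [Fintype V] in
theorem run_clear (v : V) (s : Store V) : (clear v).run s = update s v [] := by
  have : ∀ (n : ℕ) (s : Store V), (pop v).run^[n] s = update s v ((s v).drop n) := by
    intro n
    induction n with
    | zero => simp
    | succ n ih =>
      intro s
      rw [iterate_succ_apply, ih]
      simp [run]
  rw [clear, run, this, List.drop_length]

/-- Empty all stacks from a list. -/
def clearAll : List V → Cmd V
  | [] => skip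
  | v :: l => seq (clear v) (clearAll l)

omit [Fintype V] in
theorem run_clearAll (l : List V) : ∀ s : Store V,
    (clearAll l).run s = fun v => if v ∈ l then [] else s v := by
  induction l with
  | nil => intro s; simp [clearAll, run]
  | cons u l ih =>
    intro s
    funext v
    simp only [clearAll, run, ih, run_clear]
    by_cases h : v = u
    · subst h; simp
    · simp [h]

omit [Fintype V] [DecidableEq V] in
theorem ranked_clearAll (m : ℕ) (l : List V) : Ranked rk m (clearAll l) := by
  induction l with
  | nil => trivial
  | cons v l ih => exact ⟨trivial, ih⟩

/-- The store in which only one stack is not empty. -/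
def single (v : V) (x : List Bool) : Store V := fun u => if u = v then x else []

/-- The compiled machine. -/
def machine (c : Cmd V) (inp out : V) : FinTM2 where
  K := StackIdx V
  k₀ := Sum.inl inp
  k₁ := Sum.inl out
  Γ _ := Bool
  Λ := Option c.Label
  main := some c.entry
  σ := Option Bool
  initialState := none
  Γk₀Fin := inferInstanceAs (Fintype Bool)
  m l := match l with
    | none => TM2.Stmt.load (fun _ => none) TM2.Stmt.halt
    | some l => c.code some none l

/-- A function computed by a ranked loop program is computable in polynomial time. -/
theorem computableInPolyTime {α β : Type} {ea : α → List Bool} {eb : β → List Bool} {f : α → β}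
    (c : Cmd V) {inp out : V} (hc : Ranked rk 0 c)
    (h : ∀ x, c.run (single inp (ea x)) out = eb (f x)) :
    Nonempty (TM2ComputableInPolyTime ea eb f) := by
  classical
  -- The final configuration must have all stacks but the output empty, hence the clearing. The
  -- register is reset in one final step, which accounts for the `+ 1` in the time bound.
  let c' := seq c (clearAll (Finset.univ.toList.filter (· ≠ out)))
  have hc' : Ranked rk 0 c' := ⟨hc, ranked_clearAll _ _⟩
  have hrun : ∀ x, c'.run (single inp (ea x)) = single out (eb (f x)) := by
    intro x
    funext v
    simp only [c', run, run_clearAll, List.mem_filter, Finset.mem_toList, Finset.mem_univ,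
      true_and, single]
    by_cases hv : v = out
    · subst hv; simpa using h x
    · simp [hv]
  let r := Finset.univ.sup rk + 1
  have hr : ∀ v, rk v < r := fun v => Nat.lt_succ_of_le (Finset.le_sup (Finset.mem_univ v))
  obtain ⟨p, hp⟩ := exists_cost_le c' hr hc'
  have hsize : ∀ x, size rk r (single inp (ea x)) = (ea x).length := by
    intro x
    rw [size, Finset.sum_eq_single_of_mem inp (by simp [hr])]
    · simp [single]
    · intro v _ hv
      simp [single, hv]
  refine ⟨⟨⟨machine c' inp out, Equiv.refl Bool, Equiv.refl Bool⟩, p + 1, fun x => ?_⟩⟩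
  have hex : ReachesWithin (machine c' inp out).step ((p + 1).eval (ea x).length)
      (initList (machine c' inp out) (ea x)) (haltList (machine c' inp out) (eb (f x))) := by
    obtain ⟨r', h1⟩ := steps_run c' hc' (machine c' inp out).m some none (fun l => rfl)
      (single inp (ea x)) none []
    have h2 : ReachesWithin (machine c' inp out).step 1
        (⟨some none, r', stk (c'.run (single inp (ea x))) [] []⟩ : MCfg V (Option c'.Label))
        ⟨none, none, stk (single out (eb (f x))) [] []⟩ :=
      .single (by rw [hrun]; rfl)
    have h0 : initList (machine c' inp out) (ea x) = (⟨some (some c'.entry), none,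
        stk (single inp (ea x)) [] []⟩ : MCfg V (Option c'.Label)) := by
      unfold initList
      congr 1
      funext k
      split_ifs with hk
      · obtain rfl : k = Sum.inl inp := hk
        exact (if_pos rfl).symm
      · rcases k with v | b
        · exact (if_neg fun h => hk (congrArg Sum.inl h)).symm
        · cases b <;> rfl
    have h3 : haltList (machine c' inp out) (eb (f x)) = (⟨none, none,
        stk (single out (eb (f x))) [] []⟩ : MCfg V (Option c'.Label)) := by
      unfold haltList
      congr 1
      funext k
      split_ifs with hk
      · obtain rfl : k = Sum.inl out := hk
        exact (if_pos rfl).symm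
      · rcases k with v | b
        · exact (if_neg fun h => hk (congrArg Sum.inl h)).symm
        · cases b <;> rfl
    rw [h0, h3]
    refine (h1.trans h2).mono ?_
    rw [eval_add, eval_one, ← hsize]
    gcongr
    exact hp _
  choose n hn hs using hex
  refine ⟨⟨n, ?_⟩, hn⟩
  exact (congrArg₂ (fun a b => (flip bind (machine c' inp out).step)^[n]
    (some (initList (machine c' inp out) a)) = some (haltList (machine c' inp out) b))
    (List.map_id (ea x)) (List.map_id (eb (f x)))).mpr hs

end Cmd

end LatticeDuality

namespace LatticeDuality

open Finset

/-! ### Models of sets of implications -/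

section Models

variable {G M : Type} [DecidableEq M] {I : G → M → Prop} {J : Set (Implication M)}

/-- The set `S` respects all implications from `J`. -/
def IsModel (J : Set (Implication M)) (S : Finset M) : Prop :=
  ∀ i ∈ J, i.1 ⊆ S → i.2 ⊆ S

theorem Deducible.subset {i : Implication M} (h : Deducible J i) :
    ∀ {S : Finset M}, IsModel J S → i.1 ⊆ S → i.2 ⊆ S := by
  induction h with
  | hyp i hi => exact fun hS => hS i hi
  | refl X => exact fun _ h => h
  | augment X Y Z _ ih => exact fun hS h => ih hS (union_subset_iff.1 h).1
  | pseudotrans X Y Z W _ _ ih1 ih2 =>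
    intro S hS h
    obtain ⟨hX, hZ⟩ := union_subset_iff.1 h
    exact ih2 hS (union_subset (ih1 hS hX) hZ)

theorem Deducible.union {X Y Z : Finset M} (h : Deducible J (X, Y)) (h' : Deducible J (X, Z)) :
    Deducible J (X, Y ∪ Z) := by
  have h1 := Deducible.pseudotrans X Y Z (Y ∪ Z) h (.refl _)
  rw [union_comm] at h1
  have h2 := Deducible.pseudotrans X Z X (Y ∪ Z) h' h1
  rwa [union_self] at h2

theorem Deducible.mono_right {X Y Z : Finset M} (h : Deducible J (X, Y)) (hZ : Z ⊆ Y) :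
    Deducible J (X, Z) := by
  have h1 := Deducible.augment Z Z Y (.refl (J := J) Z)
  have h2 := Deducible.pseudotrans X Y ∅ Z h
    (by rwa [union_empty, ← union_eq_right.2 hZ])
  rwa [union_empty] at h2

/-- Completeness of the Armstrong rules: the attributes deducible from X form a model containing X,
because finitely many deduced attributes can be collected into one conclusion. -/
theorem deducible_iff [Fintype M] {X Y : Finset M} :
    Deducible J (X, Y) ↔ ∀ S, IsModel J S → X ⊆ S → Y ⊆ S := by
  classical
  refine ⟨fun h S hS => h.subset hS, fun h => ?_⟩
  let C : Finset M := univ.filter fun m => Deducible J (X, {m})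
  have key : ∀ Z : Finset M, Z ⊆ C → Deducible J (X, Z) := by
    intro Z
    induction Z using Finset.induction_on with
    | empty => exact fun _ => (Deducible.refl X).mono_right (empty_subset _)
    | insert m Z _ ih =>
      intro hZ
      rw [insert_subset_iff] at hZ
      rw [insert_eq]
      exact (mem_filter.1 hZ.1).2.union (ih hZ.2)
  have hX : X ⊆ C := fun m hm =>
    mem_filter.2 ⟨mem_univ _, (Deducible.refl X).mono_right (singleton_subset_iff.2 hm)⟩
  have hC : IsModel J C := by
    intro i hi hiC m hm
    refine mem_filter.2 ⟨mem_univ _, ?_⟩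
    have h2 := Deducible.pseudotrans X i.1 ∅ i.2 (key _ hiC) (by
      rw [union_empty]; exact .hyp i hi)
    rw [union_empty] at h2
    exact h2.mono_right (singleton_subset_iff.2 hm)
  exact key Y (h C hC hX)

omit [DecidableEq M] in
theorem holds_iff {i : Implication M} :
    i.Holds I ↔ ∀ g, (∀ m ∈ i.1, I g m) → ∀ m ∈ i.2, I g m := by
  rfl

/-- A set of implications is sound and complete iff it is sound and each of its models is an
intersection of object intents. -/
theorem generates_iff [Fintype M] : Generates I J ↔ (∀ i ∈ J, i.Holds I) ∧
    ∀ S, IsModel J S → ∀ m ∉ S, ∃ g, (∀ n ∈ S, I g n) ∧ ¬ I g m := by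
  classical
  constructor
  · rintro ⟨hs, hc⟩
    refine ⟨hs, fun S hS m hm => ?_⟩
    -- If no object separates m from S, then S → {m} holds in the context and is deducible, so the
    -- model S contains m.
    by_contra! hg
    exact hm ((hc (S, {m}) (holds_iff.2 fun g h n hn => by
      rw [mem_singleton.1 hn]; exact hg g h)).subset hS Subset.rfl (mem_singleton_self m))
  · rintro ⟨hs, hc⟩
    refine ⟨hs, fun i hi => deducible_iff.2 fun S hS hiS m hm => ?_⟩
    by_contra hmS
    obtain ⟨g, hg, hgm⟩ := hc S hS m hmS
    exact hgm (holds_iff.1 hi g (fun n hn => hg n (hiS hn)) m hm)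

/-- A sufficient condition for a generating set of implications to have minimum cardinality. -/
theorem Generates.isMinimum [Fintype M] (hJ : Generates I J) (h1 : ∀ i ∈ J, ¬ i.2 ⊆ i.1)
    (h2 : ∀ i ∈ J, ∀ j ∈ J, i ≠ j →
      ∃ S, IsModel J S ∧ i.1 ∩ j.1 ⊆ S ∧ (S ⊆ i.1 ∨ S ⊆ j.1)) :
    IsMinimumImplicationBase I J := by
  refine ⟨hJ, fun S hS => ?_⟩
  -- The premise of i is not a model of S, as i is deducible from S and its conclusion is not
  -- contained in its premise.
  have hex : ∀ i ∈ J, ∃ s ∈ S, s.1 ⊆ i.1 ∧ ¬ s.2 ⊆ i.1 := by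
    intro i hi
    by_contra! h
    exact h1 i hi ((hS.complete i (hJ.sound i hi)).subset h Subset.rfl)
  choose! φ hφS hφ hφ' using hex
  refine Set.encard_le_encard_of_injOn (f := φ) hφS fun i hi j hj hij => ?_
  -- If i and j shared the same s, the premise of s would lie in both premises, hence in the model
  -- T. Then its conclusion would lie in T, and so in one of the two premises, against the choice of
  -- s.
  by_contra hne
  obtain ⟨T, hT, hsub, hor⟩ := h2 i hi j hj hne
  have hj1 := hφ j hj
  have hj2 := hφ' j hj
  rw [← hij] at hj1 hj2
  have h3 := (hJ.complete _ (hS.sound _ (hφS i hi))).subset hT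
    ((subset_inter (hφ i hi) hj1).trans hsub)
  rcases hor with h | h
  · exact hφ' i hi (h3.trans h)
  · exact hj2 (h3.trans h)

/-- A generating proper subset of a finite set would have smaller cardinality. -/
theorem IsMinimumImplicationBase.isImplicationBase (hfin : J.Finite)
    (h : IsMinimumImplicationBase I J) : IsImplicationBase I J :=
  ⟨h.1, fun S hS hSJ => (hfin.eq_of_subset_of_encard_le' hSJ (h.2 S hS)).ge⟩

end Models

/-! ### Instances given by lists of Boolean rows -/

section OfLists

variable {α : Type}

/-- The context with the given lists of attributes and objects, with a list of implications. Objects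
and sets of attributes are given by their characteristic functions. -/
def MIBRInstance.ofLists (attrs : List α) (O : List (α → Bool))
    (J : List ((α → Bool) × (α → Bool))) : MIBRInstance where
  objects := O.length
  attributes := attrs.length
  table g j := O.get g (attrs.get j)
  J := J.map fun p =>
    (univ.filter fun j => p.1 (attrs.get j) = true, univ.filter fun j => p.2 (attrs.get j) = true)

theorem encodeTuple_bit {m : ℕ} (f : Fin m → Bool) :
    encodeTuple (fun _ => encodeBit) f = List.ofFn f := by
  induction m with
  | zero => rfl
  | succ m ih =>
    have := ih fun i => f i.succ
    simp only [encodeTuple, List.ofFn_succ, List.flatten_cons] at this ⊢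
    rw [this]
    rfl

theorem ofFn_comp_get (attrs : List α) (o : α → Bool) :
    List.ofFn (fun j => o (attrs.get j)) = attrs.map o := by
  apply List.ext_get <;> simp

theorem MIBRInstance.encode_ofLists (attrs : List α) (O : List (α → Bool))
    (J : List ((α → Bool) × (α → Bool))) :
    (MIBRInstance.ofLists attrs O J).encode =
      encodeNat O.length ++ encodeNat attrs.length ++ O.flatMap (fun o => attrs.map o) ++
        (encodeNat J.length ++ J.flatMap fun p => attrs.map p.1 ++ attrs.map p.2) := by
  have h1 : encodeMatrix (fun (g : Fin O.length) (j : Fin attrs.length) => O.get g (attrs.get j)) =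
      O.flatMap fun o => attrs.map o := by
    rw [encodeMatrix, encodeTuple]
    simp only [encodeTuple_bit, ofFn_comp_get]
    rw [List.flatMap_def]
    congr 1
    apply List.ext_get <;> simp
  have h2 : ∀ p : α → Bool, encodeSubset (univ.filter fun j => p (attrs.get j) = true) =
      attrs.map p := by
    intro p
    rw [encodeSubset, encodeTuple_bit, ← ofFn_comp_get]
    simp
  unfold MIBRInstance.encode MIBRInstance.ofLists encodeList
  simp only [h1, List.length_map, List.flatMap_map, h2]

variable {attrs : List α} {O : List (α → Bool)} {J : List ((α → Bool) × (α → Bool))}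

/-- The characteristic function `p` implies `q`. -/
def Below (p q : α → Bool) : Prop := ∀ a, p a = true → q a = true

/-- The characteristic function `T` respects all implications from `J`. -/
def Respects (J : List ((α → Bool) × (α → Bool))) (T : α → Bool) : Prop :=
  ∀ p ∈ J, Below p.1 T → Below p.2 T

theorem filter_subset_iff (hattrs : ∀ a, a ∈ attrs) {p q : α → Bool} :
    (univ.filter fun j => p (attrs.get j) = true) ⊆ (univ.filter fun j => q (attrs.get j) = true) ↔
      Below p q := by
  constructor
  · intro h a ha
    obtain ⟨j, rfl⟩ := List.get_of_mem (hattrs a)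
    exact (mem_filter.1 (h (mem_filter.2 ⟨mem_univ _, ha⟩))).2
  · intro h j hj
    exact mem_filter.2 ⟨mem_univ _, h _ (mem_filter.1 hj).2⟩

theorem exists_eq_filter (hnodup : attrs.Nodup) (S : Finset (Fin attrs.length)) :
    ∃ T : α → Bool, S = univ.filter fun j => T (attrs.get j) = true := by
  classical
  refine ⟨fun a => decide (∃ j ∈ S, attrs.get j = a), ?_⟩
  ext j
  simp only [mem_filter, mem_univ, true_and, decide_eq_true_eq]
  constructor
  · exact fun h => ⟨j, h, rfl⟩
  · rintro ⟨k, hk, h⟩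
    rwa [← List.nodup_iff_injective_get.1 hnodup h]

theorem isModel_ofLists_iff (hattrs : ∀ a, a ∈ attrs) {T : α → Bool} :
    IsModel (MIBRInstance.ofLists attrs O J).implications
      (univ.filter fun j => T (attrs.get j) = true) ↔ Respects J T := by
  constructor
  · intro h p hp h1
    exact (filter_subset_iff hattrs).1
      (h _ (List.mem_map_of_mem hp) ((filter_subset_iff hattrs).2 h1))
  · intro h i hi
    obtain ⟨p, hp, rfl⟩ := List.mem_map.1 hi
    exact fun h1 => (filter_subset_iff hattrs).2 (h p hp ((filter_subset_iff hattrs).1 h1))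

theorem holds_ofLists_iff (hattrs : ∀ a, a ∈ attrs) {p : (α → Bool) × (α → Bool)} :
    Implication.Holds (MIBRInstance.ofLists attrs O J).I
      (univ.filter fun j => p.1 (attrs.get j) = true,
        univ.filter fun j => p.2 (attrs.get j) = true) ↔ ∀ o ∈ O, Below p.1 o → Below p.2 o := by
  rw [holds_iff]
  have key : ∀ (q : α → Bool) (g : Fin O.length),
      (∀ m ∈ univ.filter fun j => q (attrs.get j) = true,
        (MIBRInstance.ofLists attrs O J).I g m) ↔ Below q (O.get g) := by
    intro q g
    rw [← filter_subset_iff hattrs]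
    exact ⟨fun h j hj => mem_filter.2 ⟨mem_univ _, h j hj⟩,
      fun h j hj => (mem_filter.1 (h hj)).2⟩
  constructor
  · intro h o ho h1
    obtain ⟨g, rfl⟩ := List.get_of_mem ho
    exact (key p.2 g).1 (h g ((key p.1 g).2 h1))
  · intro h g h1
    exact (key p.2 g).2 (h _ (List.get_mem _ _) ((key p.1 g).1 h1))

/-- This transfers `generates_iff` from positions in the list to the attributes themselves. Without
repetitions, each set of positions comes from a characteristic function on attributes. -/
theorem generates_ofLists_iff (hnodup : attrs.Nodup) (hattrs : ∀ a, a ∈ attrs) :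
    Generates (MIBRInstance.ofLists attrs O J).I (MIBRInstance.ofLists attrs O J).implications ↔
      (∀ p ∈ J, ∀ o ∈ O, Below p.1 o → Below p.2 o) ∧
      ∀ T, Respects J T → ∀ a, T a = false → ∃ o ∈ O, Below T o ∧ o a = false := by
  rw [generates_iff]
  refine and_congr ⟨fun h p hp => (holds_ofLists_iff hattrs).1 (h _ (List.mem_map.2 ⟨p, hp, rfl⟩)),
    fun h i hi => ?_⟩ ⟨fun h T hT a ha => ?_, fun h S hS j hj => ?_⟩
  · obtain ⟨p, hp, rfl⟩ := List.mem_map.1 hi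
    exact (holds_ofLists_iff hattrs).2 (h p hp)
  · obtain ⟨j, rfl⟩ := List.get_of_mem (hattrs a)
    obtain ⟨g, hg, hgj⟩ := h _ ((isModel_ofLists_iff hattrs).2 hT) j
      fun hj => Bool.eq_false_iff.1 ha (mem_filter.1 hj).2
    refine ⟨O.get g, List.get_mem _ _, ?_, Bool.eq_false_iff.2 hgj⟩
    rw [← filter_subset_iff hattrs]
    exact fun k hk => mem_filter.2 ⟨mem_univ _, hg k hk⟩
  · obtain ⟨T, rfl⟩ := exists_eq_filter hnodup S
    obtain ⟨o, ho, hTo, hoj⟩ := h T ((isModel_ofLists_iff hattrs).1 hS) (attrs.get j)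
      (Bool.eq_false_iff.2 fun h => hj (mem_filter.2 ⟨mem_univ _, h⟩))
    obtain ⟨g, rfl⟩ := List.get_of_mem ho
    exact ⟨g, fun k hk => hTo _ (mem_filter.1 hk).2, Bool.eq_false_iff.1 hoj⟩

theorem isMinimum_ofLists (hattrs : ∀ a, a ∈ attrs)
    (hJ : Generates (MIBRInstance.ofLists attrs O J).I
      (MIBRInstance.ofLists attrs O J).implications)
    (h1 : ∀ p ∈ J, ¬ Below p.2 p.1)
    (h2 : ∀ p ∈ J, ∀ q ∈ J, p ≠ q → ∃ T, Respects J T ∧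
      (∀ a, p.1 a = true → q.1 a = true → T a = true) ∧ (Below T p.1 ∨ Below T q.1)) :
    IsMinimumImplicationBase (MIBRInstance.ofLists attrs O J).I
      (MIBRInstance.ofLists attrs O J).implications := by
  refine hJ.isMinimum ?_ ?_
  · intro i hi
    obtain ⟨p, hp, rfl⟩ := List.mem_map.1 hi
    exact fun h => h1 p hp ((filter_subset_iff hattrs).1 h)
  · intro i hi j hj hij
    obtain ⟨p, hp, rfl⟩ := List.mem_map.1 hi
    obtain ⟨q, hq, rfl⟩ := List.mem_map.1 hj
    obtain ⟨T, hT, hpq, hor⟩ := h2 p hp q hq (by rintro rfl; exact hij rfl)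
    refine ⟨_, (isModel_ofLists_iff hattrs).2 hT, ?_,
      hor.imp (filter_subset_iff hattrs).2 (filter_subset_iff hattrs).2⟩
    intro k hk
    have hk' := mem_inter.1 hk
    exact mem_filter.2 ⟨mem_univ _, hpq _ (mem_filter.1 hk'.1).2 (mem_filter.1 hk'.2).2⟩

theorem MIBRInstance.finite_implications (x : MIBRInstance) : x.implications.Finite :=
  x.J.finite_toSet

end OfLists

end LatticeDuality

namespace LatticeDuality

open Function

/-! ### The reduction -/

section Blocks

variable (L : ExplicitLattice)

instance : DecidableEq L.Elem := inferInstanceAs (DecidableEq (Fin L.card))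

instance : Fintype L.Elem := inferInstanceAs (Fintype (Fin L.card))

/-- The elements of an explicit lattice in their order of enumeration. -/
def ExplicitLattice.elems : List L.Elem := List.finRange L.card

theorem ExplicitLattice.mem_elems (p : L.Elem) : p ∈ L.elems := List.mem_finRange p

/-- Is `z` below the join of `p` and `q`? -/
def ExplicitLattice.belowJoin (p q z : L.Elem) : Bool :=
  decide (∀ u : Fin L.card, L.leq p u = true → L.leq q u = true → L.leq z u = true)

variable {L}

theorem ExplicitLattice.belowJoin_iff {p q z : L.Elem} :
    L.belowJoin p q z = true ↔ ∀ u, p ≤ u → q ≤ u → z ≤ u :=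
  decide_eq_true_iff

theorem ExplicitLattice.belowJoin_self {p z : L.Elem} : L.belowJoin p p z = true ↔ z ≤ p :=
  belowJoin_iff.trans ⟨fun h => h p le_rfl le_rfl, fun h _ hu _ => h.trans hu⟩

/-- A set of attributes of the block of a lattice. The block contains two copies of every element
of the lattice and one further attribute. -/
abbrev ExplicitLattice.Block (L : ExplicitLattice) := Option (L.Elem × Bool) → Bool

/-- Everything. -/
def blockFull : L.Block := fun _ => true

/-- Nothing. -/
def blockEmpty : L.Block := fun _ => false

/-- Both copies of the principal ideal generated by the join of `p` and `q`. -/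
def blockIdeal (p q : L.Elem) : L.Block
  | none => true
  | some (z, _) => L.belowJoin p q z

/-- One copy of the lattice, possibly with the further attribute. -/
def blockSide (c b : Bool) : L.Block
  | none => b
  | some (_, c') => c' == c

/-- One copy of the lattice without the element `p`, and the further attribute. -/
def blockSideErase (c : Bool) (p : L.Elem) : L.Block
  | none => true
  | some (z, c') => (c' == c) && !decide (z = p)

/-- The first copy of `p` and the second copy of `q`. -/
def blockPair (p q : L.Elem) : L.Block
  | none => false
  | some (z, c) => bif c then decide (z = q) else decide (z = p)

end Blocks

namespace DPLInstance

variable (x : DPLInstance)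

/-- The attributes of the constructed context. -/
inductive Attr
  | cell (i : Fin x.k) (a : Option ((x.L i).Elem × Bool))
  | guard
  | goal

variable {x} in
/-- The set of attributes with given blocks. -/
def row (β : ∀ i, (x.L i).Block) (g t : Bool) : x.Attr → Bool
  | .cell i a => β i a
  | .guard => g
  | .goal => t

/-- All attributes except for the block of one lattice. -/
def fullExcept (i : Fin x.k) (β : (x.L i).Block) : ∀ i, (x.L i).Block :=
  update (fun _ => blockFull) i β

/-- Only attributes from the block of one lattice. -/
def emptyExcept (i : Fin x.k) (β : (x.L i).Block) : ∀ i, (x.L i).Block :=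
  update (fun _ => blockEmpty) i β

/-- The blocks of the principal ideal of a tuple. -/
def ideal (a : ∀ i, (x.L i).Elem) : ∀ i, (x.L i).Block := fun i => blockIdeal (a i) (a i)

/-- The attributes of the block of a lattice. -/
def blockAttrs (i : Fin x.k) : List x.Attr :=
  (x.L i).elems.map (fun z => .cell i (some (z, false))) ++
    ((x.L i).elems.map (fun z => .cell i (some (z, true))) ++ [.cell i none])

/-- The list of all attributes. -/
def attrs : List x.Attr := (List.finRange x.k).flatMap x.blockAttrs ++ [.guard, .goal]

/-- The objects belonging to a side of the block of a lattice and an element. -/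
def sideObjects (i : Fin x.k) (p : (x.L i).Elem) (c : Bool) : List (x.Attr → Bool) :=
  [row (x.fullExcept i (blockSide c true)) true false,
    row (x.fullExcept i (blockSide c true)) true true,
    row (x.fullExcept i (blockSide c false)) true true,
    row (x.fullExcept i (blockSideErase c p)) true true]

/-- The objects belonging to an element of a lattice. -/
def elemObjects (i : Fin x.k) (p : (x.L i).Elem) : List (x.Attr → Bool) :=
  row (x.fullExcept i (blockIdeal p p)) true true ::
    (x.sideObjects i p false ++ x.sideObjects i p true)

/-- The objects of the constructed context. -/
def objs : List (x.Attr → Bool) :=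
  (List.finRange x.k).flatMap (fun i => (x.L i).elems.flatMap (x.elemObjects i)) ++
    (x.B.map (fun b => row (x.ideal b) true false) ++
      [row (fun _ => blockFull) false true, row (fun _ => blockFull) false false])

/-- The implication computing the join of two elements. -/
def joinImp (i : Fin x.k) (p q : (x.L i).Elem) : (x.Attr → Bool) × (x.Attr → Bool) :=
  (row (x.emptyExcept i (blockPair p q)) false false,
    row (x.emptyExcept i (blockIdeal p q)) false false)

/-- The implication belonging to a member of the first antichain. -/
def goalImp (a : ∀ i, (x.L i).Elem) : (x.Attr → Bool) × (x.Attr → Bool) :=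
  (row (x.ideal a) true false, row (fun _ => blockEmpty) false true)

/-- The constructed implications. -/
def imps : List ((x.Attr → Bool) × (x.Attr → Bool)) :=
  (List.finRange x.k).flatMap (fun i => (x.L i).elems.flatMap fun p =>
    (x.L i).elems.map (x.joinImp i p)) ++ x.A.map x.goalImp

/-- The constructed instance. -/
def toMIBR : MIBRInstance := MIBRInstance.ofLists x.attrs x.objs x.imps

variable {x}

theorem mem_attrs (a : x.Attr) : a ∈ x.attrs := by
  rcases a with ⟨i, _ | ⟨z, c⟩⟩ | _ | _
  · exact List.mem_append_left _ (List.mem_flatMap.2 ⟨i, List.mem_finRange i, by simp [blockAttrs]⟩)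
  · refine List.mem_append_left _ (List.mem_flatMap.2 ⟨i, List.mem_finRange i, ?_⟩)
    cases c <;> simp [blockAttrs, ExplicitLattice.mem_elems]
  · simp [attrs]
  · simp [attrs]

theorem nodup_blockAttrs (i : Fin x.k) : (x.blockAttrs i).Nodup := by
  have h : ∀ c, ((x.L i).elems.map fun z => (Attr.cell i (some (z, c)) : x.Attr)).Nodup :=
    fun c => (List.nodup_finRange _).map fun p q h => by simpa using h
  refine (h false).append ((h true).append (List.nodup_singleton _) ?_) ?_
  · simp
  · simp [List.disjoint_left]

theorem nodup_attrs : x.attrs.Nodup := by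
  refine List.Nodup.append (List.nodup_flatMap.2 ⟨fun i _ => nodup_blockAttrs i, ?_⟩) (by simp) ?_
  · refine (List.nodup_finRange _).imp fun {i j} hij => ?_
    simp only [onFun, List.disjoint_left, blockAttrs]
    intro a ha hb
    have h1 : ∃ b, a = Attr.cell i b := by
      simp only [List.mem_append, List.mem_map, List.mem_singleton] at ha
      rcases ha with ⟨z, _, rfl⟩ | ⟨z, _, rfl⟩ | rfl <;> exact ⟨_, rfl⟩
    have h2 : ∃ b, a = Attr.cell j b := by
      simp only [List.mem_append, List.mem_map, List.mem_singleton] at hb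
      rcases hb with ⟨z, _, rfl⟩ | ⟨z, _, rfl⟩ | rfl <;> exact ⟨_, rfl⟩
    obtain ⟨b, rfl⟩ := h1
    obtain ⟨b', h⟩ := h2
    cases h
    exact hij rfl
  · simp [List.disjoint_left, blockAttrs]
    grind

theorem below_row_iff {T : x.Attr → Bool} {β : ∀ i, (x.L i).Block} {g t : Bool} :
    Below T (row β g t) ↔ (∀ i a, T (.cell i a) = true → β i a = true) ∧
      (T .guard = true → g = true) ∧ (T .goal = true → t = true) :=
  ⟨fun h => ⟨fun i a => h (.cell i a), h .guard, h .goal⟩, fun h a => by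
    cases a
    · exact h.1 _ _
    · exact h.2.1
    · exact h.2.2⟩

theorem row_below_iff {T : x.Attr → Bool} {β : ∀ i, (x.L i).Block} {g t : Bool} :
    Below (row β g t) T ↔ (∀ i a, β i a = true → T (.cell i a) = true) ∧
      (g = true → T .guard = true) ∧ (t = true → T .goal = true) :=
  ⟨fun h => ⟨fun i a => h (.cell i a), h .guard, h .goal⟩, fun h a => by
    cases a
    · exact h.1 _ _
    · exact h.2.1
    · exact h.2.2⟩

theorem below_fullExcept_iff {T : x.Attr → Bool} {i : Fin x.k} {β : (x.L i).Block} {g t : Bool} :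
    Below T (row (x.fullExcept i β) g t) ↔ (∀ a, T (.cell i a) = true → β a = true) ∧
      (T .guard = true → g = true) ∧ (T .goal = true → t = true) := by
  rw [below_row_iff]
  refine and_congr ⟨fun h a => by simpa [fullExcept] using h i a, fun h j a => ?_⟩ Iff.rfl
  by_cases hj : j = i
  · subst hj
    simpa [fullExcept] using h a
  · simp [fullExcept, hj, blockFull]

theorem emptyExcept_below_iff {T : x.Attr → Bool} {i : Fin x.k} {β : (x.L i).Block} :
    Below (row (x.emptyExcept i β) false false) T ↔ ∀ a, β a = true → T (.cell i a) = true := by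
  rw [row_below_iff]
  refine ⟨fun h a => by simpa [emptyExcept] using h.1 i a, fun h => ⟨fun j a => ?_, by simp⟩⟩
  by_cases hj : j = i
  · subst hj
    simpa [emptyExcept] using h a
  · simp [emptyExcept, hj, blockEmpty]

theorem pair_below_iff {T : x.Attr → Bool} {i : Fin x.k} {p q : (x.L i).Elem} :
    Below (x.joinImp i p q).1 T ↔
      T (.cell i (some (p, false))) = true ∧ T (.cell i (some (q, true))) = true := by
  rw [joinImp, emptyExcept_below_iff]
  constructor
  · exact fun h => ⟨h _ (by simp [blockPair]), h _ (by simp [blockPair])⟩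
  · rintro ⟨h1, h2⟩ (_ | ⟨z, _ | _⟩) ha <;> simp [blockPair] at ha <;> subst ha <;> assumption

theorem join_below_iff {T : x.Attr → Bool} {i : Fin x.k} {p q : (x.L i).Elem} :
    Below (x.joinImp i p q).2 T ↔ T (.cell i none) = true ∧
      ∀ z c, (x.L i).belowJoin p q z = true → T (.cell i (some (z, c))) = true := by
  rw [joinImp, emptyExcept_below_iff]
  constructor
  · exact fun h => ⟨h _ rfl, fun z c hz => h _ hz⟩
  · rintro ⟨h1, h2⟩ (_ | ⟨z, c⟩) ha
    · exact h1
    · exact h2 z c ha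

theorem mem_imps {p : (x.Attr → Bool) × (x.Attr → Bool)} :
    p ∈ x.imps ↔ (∃ i a b, p = x.joinImp i a b) ∨ ∃ a ∈ x.A, p = x.goalImp a := by
  simp only [imps, List.mem_append, List.mem_flatMap, List.mem_map, List.mem_finRange, true_and,
    ExplicitLattice.mem_elems, eq_comm (a := p)]

theorem mem_objs {o : x.Attr → Bool} :
    o ∈ x.objs ↔ (∃ i p, o ∈ x.elemObjects i p) ∨ (∃ b ∈ x.B, o = row (x.ideal b) true false) ∨
      o = row (fun _ => blockFull) false true ∨ o = row (fun _ => blockFull) false false := by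
  simp only [objs, List.mem_append, List.mem_flatMap, List.mem_map, List.mem_finRange, true_and,
    ExplicitLattice.mem_elems, eq_comm (b := o), List.mem_cons, List.not_mem_nil, or_false]

/-- An attribute set respecting the join implications. -/
def JoinClosed (T : x.Attr → Bool) : Prop :=
  ∀ i p q, T (.cell i (some (p, false))) = true → T (.cell i (some (q, true))) = true →
    T (.cell i none) = true ∧
      ∀ z c, (x.L i).belowJoin p q z = true → T (.cell i (some (z, c))) = true

/-- The block of a goal premise is the ideal of the join of an element with itself, that is, its
principal ideal. This turns the premises into conditions on the order. -/
theorem respects_iff {T : x.Attr → Bool} : Respects x.imps T ↔ JoinClosed T ∧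
    ∀ a ∈ x.A, T .guard = true → (∀ i, T (.cell i none) = true) →
      (∀ i z c, z ≤ a i → T (.cell i (some (z, c))) = true) → T .goal = true := by
  have hgoal : ∀ a : ∀ i, (x.L i).Elem, Below (x.goalImp a).1 T ↔ T .guard = true ∧
      (∀ i, T (.cell i none) = true) ∧
        ∀ i z c, z ≤ a i → T (.cell i (some (z, c))) = true := by
    intro a
    rw [goalImp, row_below_iff]
    constructor
    · exact fun h => ⟨h.2.1 rfl, fun i => h.1 i none rfl,
        fun i z c hz => h.1 i _ (ExplicitLattice.belowJoin_self.2 hz)⟩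
    · rintro ⟨h1, h2, h3⟩
      refine ⟨fun i b hb => ?_, fun _ => h1, by simp⟩
      rcases b with _ | ⟨z, c⟩
      · exact h2 i
      · exact h3 i z c (ExplicitLattice.belowJoin_self.1 hb)
  have hgoal2 : ∀ a : ∀ i, (x.L i).Elem, Below (x.goalImp a).2 T ↔ T .goal = true := by
    intro a
    rw [goalImp, row_below_iff]
    simp [blockEmpty]
  constructor
  · intro h
    refine ⟨fun i p q h1 h2 => join_below_iff.1 (h _ (mem_imps.2 (.inl ⟨i, p, q, rfl⟩))
      (pair_below_iff.2 ⟨h1, h2⟩)), fun a ha h1 h2 h3 => ?_⟩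
    exact (hgoal2 a).1 (h _ (mem_imps.2 (.inr ⟨a, ha, rfl⟩)) ((hgoal a).2 ⟨h1, h2, h3⟩))
  · rintro ⟨h1, h2⟩ p hp
    obtain ⟨i, p, q, rfl⟩ | ⟨a, ha, rfl⟩ := mem_imps.1 hp
    · exact fun h => join_below_iff.2 (h1 i p q (pair_below_iff.1 h).1 (pair_below_iff.1 h).2)
    · rw [hgoal, hgoal2]
      exact fun h => h2 a ha h.1 h.2.1 h.2.2

/-- Every block of a join-closed set misses one of the copies or is a principal ideal. -/
theorem JoinClosed.side_or_ideal {T : x.Attr → Bool} (hT : JoinClosed T) (i : Fin x.k) :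
    (∃ c, ∀ z, T (.cell i (some (z, !c))) = false) ∨
      T (.cell i none) = true ∧ ∃ r, ∀ z c, T (.cell i (some (z, c))) = true ↔ z ≤ r := by
  by_contra! hcon
  obtain ⟨h1, h2⟩ := hcon
  obtain ⟨q, hq⟩ := h1 false
  obtain ⟨p, hp⟩ := h1 true
  simp only [Bool.not_false, Bool.not_true, ne_eq, Bool.not_eq_false] at hp hq
  -- Once both copies are met, the two copies agree: z lies below its join with any element of the
  -- other copy.
  have h01 : ∀ z c, T (.cell i (some (z, c))) = true → ∀ c', T (.cell i (some (z, c'))) = true := by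
    intro z c hz c'
    cases c
    · exact (hT i z q hz hq).2 z c' (ExplicitLattice.belowJoin_iff.2 fun u h _ => h)
    · exact (hT i p z hp hz).2 z c' (ExplicitLattice.belowJoin_iff.2 fun u _ h => h)
  -- A maximal element is the greatest one, since its join with any other element is again present.
  -- The join implication for r with itself then yields the whole ideal.
  obtain ⟨r, hr⟩ := (Set.toFinite {z | T (.cell i (some (z, false))) = true}).exists_maximal ⟨p, hp⟩
  obtain ⟨z, c, hzc⟩ := h2 (hT i p q hp hq).1 r
  rcases hzc with ⟨hz, hzr⟩ | ⟨hz, hzr⟩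
  · obtain ⟨s, hrs, hzs, hs⟩ := (x.L i).exists_sup r z
    have hsT : T (.cell i (some (s, false))) = true :=
      (hT i r z hr.prop (h01 z c hz true)).2 s false (ExplicitLattice.belowJoin_iff.2 hs)
    exact hzr (le_trans (show z ≤ s from hzs) (hr.le_of_ge hsT hrs))
  · have := (hT i r r hr.prop (h01 r false hr.prop true)).2 z c
      (ExplicitLattice.belowJoin_self.2 hzr)
    exact hz this

end DPLInstance

end LatticeDuality

/-! ### Correctness of the reduction and minimality of the implications -/

namespace LatticeDuality

open Function

/-- A set of attributes of a block that respects the join implications. -/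
def BlockClosed {L : ExplicitLattice} (β : L.Block) : Prop :=
  ∀ p q, β (some (p, false)) = true → β (some (q, true)) = true →
    β none = true ∧ ∀ z c, L.belowJoin p q z = true → β (some (z, c)) = true

section Blocks

variable {L : ExplicitLattice}

theorem blockClosed_full : BlockClosed (blockFull : L.Block) :=
  fun _ _ _ _ => ⟨rfl, fun _ _ _ => rfl⟩

theorem blockClosed_empty : BlockClosed (blockEmpty : L.Block) :=
  fun _ _ h => by simp [blockEmpty] at h

theorem blockClosed_ideal (p q : L.Elem) : BlockClosed (blockIdeal p q) := by
  refine fun p' q' hp hq => ⟨rfl, fun z c hz => ExplicitLattice.belowJoin_iff.2 fun u h1 h2 => ?_⟩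
  exact ExplicitLattice.belowJoin_iff.1 hz u (ExplicitLattice.belowJoin_iff.1 hp u h1 h2)
    (ExplicitLattice.belowJoin_iff.1 hq u h1 h2)

/-- A join premise meets both copies, so no join implication applies inside one copy. -/
theorem blockClosed_side (c b : Bool) : BlockClosed (blockSide c b : L.Block) := by
  intro p q hp hq
  cases c <;> simp [blockSide] at hp hq

theorem blockClosed_sideErase (c : Bool) (p : L.Elem) : BlockClosed (blockSideErase c p) := by
  intro p q hp hq
  cases c <;> simp [blockSideErase] at hp hq

end Blocks

namespace DPLInstance

variable {x : DPLInstance}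

theorem joinClosed_row {β : ∀ i, (x.L i).Block} {g t : Bool} (h : ∀ i, BlockClosed (β i)) :
    JoinClosed (row β g t) := fun i => h i

theorem blockClosed_fullExcept {i : Fin x.k} {β : (x.L i).Block} (h : BlockClosed β)
    (j : Fin x.k) : BlockClosed (x.fullExcept i β j) := by
  by_cases hj : j = i
  · subst hj
    simpa [fullExcept] using h
  · simpa [fullExcept, hj] using blockClosed_full

theorem blockClosed_emptyExcept {i : Fin x.k} {β : (x.L i).Block} (h : BlockClosed β)
    (j : Fin x.k) : BlockClosed (x.emptyExcept i β j) := by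
  by_cases hj : j = i
  · subst hj
    simpa [emptyExcept] using h
  · simpa [emptyExcept, hj] using blockClosed_empty

theorem respects_of_guard {T : x.Attr → Bool} (hT : JoinClosed T) (h : T .guard = false) :
    Respects x.imps T :=
  respects_iff.2 ⟨hT, fun _ _ h' => by simp [h] at h'⟩

theorem respects_of_goal {T : x.Attr → Bool} (hT : JoinClosed T) (h : T .goal = true) :
    Respects x.imps T :=
  respects_iff.2 ⟨hT, fun _ _ _ _ _ => h⟩

/-- All blocks of the objects are join-closed. The goal implications hold because the object has
`goal`, lacks `guard`, misses a copy in some block, or belongs to B and contains no ideal of a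
member of A by separation. -/
theorem respects_of_mem_objs {o : x.Attr → Bool} (ho : o ∈ x.objs) : Respects x.imps o := by
  have hside : ∀ i p c, o ∈ x.sideObjects i p c → Respects x.imps o := by
    intro i p c ho
    simp only [sideObjects, List.mem_cons, List.not_mem_nil, or_false] at ho
    rcases ho with rfl | rfl | rfl | rfl
    · refine respects_iff.2
        ⟨joinClosed_row (blockClosed_fullExcept (blockClosed_side _ _)), fun a _ _ _ h => ?_⟩
      have := h i (a i) (!c) le_rfl
      simp [row, fullExcept, blockSide] at this
    · exact respects_of_goal (joinClosed_row (blockClosed_fullExcept (blockClosed_side _ _))) rfl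
    · exact respects_of_goal (joinClosed_row (blockClosed_fullExcept (blockClosed_side _ _))) rfl
    · exact respects_of_goal
        (joinClosed_row (blockClosed_fullExcept (blockClosed_sideErase _ _))) rfl
  rcases mem_objs.1 ho with ⟨i, p, ho⟩ | ⟨b, hb, rfl⟩ | rfl | rfl
  · simp only [elemObjects, List.mem_cons, List.mem_append] at ho
    rcases ho with rfl | ho | ho
    · exact respects_of_goal (joinClosed_row (blockClosed_fullExcept (blockClosed_ideal _ _))) rfl
    · exact hside _ _ _ ho
    · exact hside _ _ _ ho
  · refine respects_iff.2 ⟨joinClosed_row fun i => blockClosed_ideal _ _, fun a ha _ _ h => ?_⟩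
    exact absurd (fun i => ExplicitLattice.belowJoin_self.1 (h i (a i) false le_rfl))
      (x.separated a ha b hb)
  · exact respects_of_goal (joinClosed_row fun i => blockClosed_full) rfl
  · exact respects_of_guard (joinClosed_row fun i => blockClosed_full) rfl

/-- If the antichains cover the product, then every model is an intersection of objects. -/
theorem exists_obj_of_cover
    (hcov : ∀ P : ∀ i, (x.L i).Elem, (∃ b ∈ x.B, P ≤ b) ∨ ∃ a ∈ x.A, a ≤ P)
    {T : x.Attr → Bool} (hT : Respects x.imps T) {a : x.Attr} (ha : T a = false) :
    ∃ o ∈ x.objs, Below T o ∧ o a = false := by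
  obtain ⟨hJ, hA⟩ := respects_iff.1 hT
  have hmem : ∀ i p c, ∀ o ∈ x.sideObjects i p c, o ∈ x.objs := fun i p c o ho =>
    mem_objs.2 (.inl ⟨i, p, by cases c <;> simp [elemObjects, ho]⟩)
  have hbool : ∀ c c' : Bool, c ≠ c' → c = !c' := by decide
  rcases a with ⟨i, a⟩ | _ | _
  -- An object that is full outside block i suffices. If T uses only copy c there, the object omits
  -- the extra attribute, one element of copy c, or the other copy. If the block is the ideal of r,
  -- the object of this ideal has the same block.
  · rcases hJ.side_or_ideal i with ⟨c, hc⟩ | ⟨hn, r, hr⟩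
    · rcases a with _ | ⟨z, c'⟩
      -- This object is listed under every lattice element without depending on it, so any element
      -- will do; index 0 exists as the lattice is non-empty.
      · refine ⟨row (x.fullExcept i (blockSide c false)) true true,
          hmem i ⟨0, (x.L i).card_pos⟩ c _ (by simp [sideObjects]),
          below_fullExcept_iff.2 ⟨?_, fun _ => rfl, fun _ => rfl⟩,
          by simp [row, fullExcept, blockSide]⟩
        rintro (_ | ⟨z, c'⟩) h
        · rw [ha] at h
          cases h
        · by_contra hne
          rw [hbool c' c (by simpa [blockSide] using hne), hc] at h
          cases h
      · by_cases hcc : c' = c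
        · subst hcc
          refine ⟨row (x.fullExcept i (blockSideErase c' z)) true true,
            hmem i z c' _ (by simp [sideObjects]),
            below_fullExcept_iff.2 ⟨?_, fun _ => rfl, fun _ => rfl⟩,
            by simp [row, fullExcept, blockSideErase]⟩
          rintro (_ | ⟨z', c⟩) h
          · rfl
          · by_cases hc' : c = c'
            · subst hc'
              simp only [blockSideErase, beq_self_eq_true, Bool.true_and, Bool.not_eq_true',
                decide_eq_false_iff_not]
              rintro rfl
              rw [ha] at h
              cases h
            · rw [hbool c c' hc', hc] at h
              cases h
        · refine ⟨row (x.fullExcept i (blockSide c true)) true true,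
            hmem i z c _ (by simp [sideObjects]),
            below_fullExcept_iff.2 ⟨?_, fun _ => rfl, fun _ => rfl⟩,
            by simp [row, fullExcept, blockSide, hcc]⟩
          rintro (_ | ⟨z', c''⟩) h
          · rfl
          · by_contra hne
            rw [hbool c'' c (by simpa [blockSide] using hne), hc] at h
            cases h
    · refine ⟨row (x.fullExcept i (blockIdeal r r)) true true,
        mem_objs.2 (.inl ⟨i, r, by simp [elemObjects]⟩),
        below_fullExcept_iff.2 ⟨?_, fun _ => rfl, fun _ => rfl⟩, ?_⟩
      · rintro (_ | ⟨z, c⟩) h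
        · rfl
        · exact ExplicitLattice.belowJoin_self.2 ((hr z c).1 h)
      · rcases a with _ | ⟨z, c⟩
        · rw [hn] at ha
          cases ha
        · simp only [row, fullExcept, update_self]
          refine Bool.eq_false_iff.2 fun h => ?_
          rw [(hr z c).2 (ExplicitLattice.belowJoin_self.1 h)] at ha
          cases ha
  · exact ⟨_, mem_objs.2 (.inr (.inr (.inl rfl))),
      below_row_iff.2 ⟨fun _ _ _ => rfl, by simp [ha], by simp⟩, rfl⟩
  · rcases hg : T .guard with _ | _
    · exact ⟨_, mem_objs.2 (.inr (.inr (.inr rfl))),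
        below_row_iff.2 ⟨fun _ _ _ => rfl, by simp [hg], by simp [ha]⟩, rfl⟩
    -- With `guard` present and `goal` missing, a block using one copy only is still handled by a
    -- side object without `goal`. Otherwise T is a point r of the product.
    · by_cases hs : ∃ i c, ∀ z, T (.cell i (some (z, !c))) = false
      · obtain ⟨i, c, hc⟩ := hs
        refine ⟨row (x.fullExcept i (blockSide c true)) true false,
          hmem i ⟨0, (x.L i).card_pos⟩ c _ (by simp [sideObjects]),
          below_fullExcept_iff.2 ⟨?_, fun _ => rfl, by simp [ha]⟩, rfl⟩
        rintro (_ | ⟨z', c''⟩) h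
        · rfl
        · by_contra hne
          rw [hbool c'' c (by simpa [blockSide] using hne), hc] at h
          cases h
      · have h2 := fun i => (hJ.side_or_ideal i).resolve_left fun h => hs ⟨i, h⟩
        choose hn r hr using h2
        -- This is the only use of the covering hypothesis: either the object of b separates `goal`
        -- from T, or the goal implication of a puts `goal` into T.
        rcases hcov r with ⟨b, hb, hrb⟩ | ⟨a, haA, har⟩
        · refine ⟨_, mem_objs.2 (.inr (.inl ⟨b, hb, rfl⟩)),
            below_row_iff.2 ⟨?_, fun _ => rfl, by simp [ha]⟩, rfl⟩
          rintro i (_ | ⟨z, c⟩) h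
          · rfl
          · exact ExplicitLattice.belowJoin_self.2 (((hr i z c).1 h).trans (hrb i))
        · rw [hA a haA hg hn fun i z c hz => (hr i z c).2 (hz.trans (har i))] at ha
          cases ha

/-- The ideal of an uncovered point P together with `guard` is a model without `goal`. An object
separating it from `goal` must contain both copies of every component of P, which leaves only the
objects of B. -/
theorem cover_of_exists_obj
    (h : ∀ T, Respects x.imps T → ∀ a, T a = false → ∃ o ∈ x.objs, Below T o ∧ o a = false)
    (P : ∀ i, (x.L i).Elem) : (∃ b ∈ x.B, P ≤ b) ∨ ∃ a ∈ x.A, a ≤ P := by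
  by_contra! hcon
  obtain ⟨hB, hA⟩ := hcon
  obtain ⟨o, ho, hTo, hgoal⟩ := h (row (x.ideal P) true false)
    (respects_iff.2 ⟨joinClosed_row fun i => blockClosed_ideal _ _, fun a ha _ _ h' =>
      absurd (fun i => ExplicitLattice.belowJoin_self.1 (h' i (a i) false le_rfl)) (hA a ha)⟩)
    .goal rfl
  have hP : ∀ i c, o (.cell i (some (P i, c))) = true := fun i c =>
    hTo (.cell i (some (P i, c))) (ExplicitLattice.belowJoin_self.2 le_rfl)
  rcases mem_objs.1 ho with ⟨i, p, ho⟩ | ⟨b, hb, rfl⟩ | rfl | rfl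
  · have hside : ∀ c, o ∉ x.sideObjects i p c := by
      intro c ho
      simp only [sideObjects, List.mem_cons, List.not_mem_nil, or_false] at ho
      rcases ho with rfl | rfl | rfl | rfl
      -- The only side object without `goal` lacks one copy completely, but both copies of P i are
      -- present.
      · have := hP i (!c)
        simp [row, fullExcept, blockSide] at this
      all_goals cases hgoal
    simp only [elemObjects, List.mem_cons, List.mem_append, hside, or_false] at ho
    subst ho
    cases hgoal
  · exact hB b hb fun i => ExplicitLattice.belowJoin_self.1 (hP i false)
  · cases hgoal
  · cases hTo .guard rfl

theorem generates_toMIBR_iff : Generates x.toMIBR.I x.toMIBR.implications ↔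
    AreDual {a | a ∈ x.A} {b | b ∈ x.B} := by
  rw [toMIBR, generates_ofLists_iff nodup_attrs mem_attrs]
  constructor
  · exact fun h => ⟨x.antichain_A, x.antichain_B, x.separated, cover_of_exists_obj h.2⟩
  · exact fun h => ⟨fun p hp o ho => respects_of_mem_objs ho p hp,
      fun T hT a ha => exists_obj_of_cover h.cover hT ha⟩

theorem joinClosed_and {T T' : x.Attr → Bool} (h : JoinClosed T) (h' : JoinClosed T') :
    JoinClosed fun a => T a && T' a := by
  intro i p q hp hq
  simp only [Bool.and_eq_true] at hp hq ⊢
  obtain ⟨h1, h2⟩ := h i p q hp.1 hq.1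
  obtain ⟨h3, h4⟩ := h' i p q hp.2 hq.2
  exact ⟨⟨h1, h3⟩, fun z c hz => ⟨h2 z c hz, h4 z c hz⟩⟩

/-- A proper part of the premise of a join implication is join-closed. -/
theorem joinClosed_of_below {T : x.Attr → Bool} {i : Fin x.k} {p q : (x.L i).Elem}
    (hT : Below T (x.joinImp i p q).1) (h : ¬ Below (x.joinImp i p q).1 T) : JoinClosed T := by
  intro j p' q' hp hq
  exfalso
  have h1 := hT _ hp
  have h2 := hT _ hq
  by_cases hj : j = i
  · subst hj
    simp [joinImp, row, emptyExcept, blockPair] at h1 h2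
    subst h1 h2
    exact h (pair_below_iff.2 ⟨hp, hq⟩)
  · simp [joinImp, row, emptyExcept, hj, blockEmpty] at h1

theorem joinClosed_goalImp (a : ∀ i, (x.L i).Elem) : JoinClosed (x.goalImp a).1 :=
  joinClosed_row fun _ => blockClosed_ideal _ _

/-- If the join premise lies in the goal premise, so does its conclusion, which is a model because
it lacks `guard`. Otherwise the intersection of the premises is a proper part of the join premise
and is itself a model. -/
theorem exists_respects_join_goal (i : Fin x.k) (p q : (x.L i).Elem) (a : ∀ i, (x.L i).Elem) :
    ∃ T, Respects x.imps T ∧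
      (∀ b, (x.joinImp i p q).1 b = true → (x.goalImp a).1 b = true → T b = true) ∧
        (Below T (x.joinImp i p q).1 ∨ Below T (x.goalImp a).1) := by
  by_cases h : Below (x.joinImp i p q).1 (x.goalImp a).1
  · refine ⟨(x.joinImp i p q).2, respects_of_guard
      (joinClosed_row (blockClosed_emptyExcept (blockClosed_ideal _ _))) rfl, fun b hb _ => ?_, .inr ?_⟩
    · have : Below (x.joinImp i p q).1 (x.joinImp i p q).2 := pair_below_iff.2
        ⟨by simp +contextual [joinImp, row, emptyExcept, blockIdeal,
            ExplicitLattice.belowJoin_iff],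
          by simp +contextual [joinImp, row, emptyExcept, blockIdeal,
            ExplicitLattice.belowJoin_iff]⟩
      exact this b hb
    · obtain ⟨h1, h2⟩ := pair_below_iff.1 h
      exact join_below_iff.2 (joinClosed_goalImp a i p q h1 h2)
  · refine ⟨fun b => (x.joinImp i p q).1 b && (x.goalImp a).1 b,
      respects_of_guard (joinClosed_of_below (i := i) (p := p) (q := q) ?_ fun h' => h ?_) rfl,
      by simp +contextual, .inl ?_⟩
    · exact fun b hb => (Bool.and_eq_true_iff.1 hb).1
    · exact fun b hb => (Bool.and_eq_true_iff.1 (h' b hb)).2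
    · exact fun b hb => (Bool.and_eq_true_iff.1 hb).1

/-- The criterion of `Generates.isMinimum` is verified for each kind of pair: two join implications,
a join and a goal implication, two goal implications. -/
theorem isMinimum_of_generates (h : Generates x.toMIBR.I x.toMIBR.implications) :
    IsMinimumImplicationBase x.toMIBR.I x.toMIBR.implications := by
  refine isMinimum_ofLists mem_attrs h (fun p hp => ?_) fun p hp q hq hpq => ?_
  · obtain ⟨i, p, q, rfl⟩ | ⟨a, ha, rfl⟩ := mem_imps.1 hp
    · intro h
      -- The extra attribute makes the conclusion exceed the premise even when p and q are both the
      -- least element.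
      have := h (.cell i none) (by simp [joinImp, row, emptyExcept, blockIdeal])
      simp [joinImp, row, emptyExcept, blockPair] at this
    · intro h
      cases h .goal rfl
  · obtain ⟨i, p, q, rfl⟩ | ⟨a, ha, rfl⟩ := mem_imps.1 hp
    · obtain ⟨j, p', q', rfl⟩ | ⟨a, ha, rfl⟩ := mem_imps.1 hq
      · refine ⟨fun b => (x.joinImp i p q).1 b && (x.joinImp j p' q').1 b,
          respects_of_guard (joinClosed_of_below (i := i) (p := p) (q := q) ?_ fun h' => hpq ?_) rfl,
          by simp +contextual, .inl ?_⟩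
        · exact fun b hb => (Bool.and_eq_true_iff.1 hb).1
        · obtain ⟨h1, h2⟩ := pair_below_iff.1 fun b hb => (Bool.and_eq_true_iff.1 (h' b hb)).2
          by_cases hij : i = j
          · subst hij
            simp [joinImp, row, emptyExcept, blockPair] at h1 h2
            rw [h1, h2]
          · simp [joinImp, row, emptyExcept, hij, blockEmpty] at h1
        · exact fun b hb => (Bool.and_eq_true_iff.1 hb).1
      · exact exists_respects_join_goal i p q a
    · obtain ⟨j, p', q', rfl⟩ | ⟨a', ha', rfl⟩ := mem_imps.1 hq
      · obtain ⟨T, h1, h2, h3⟩ := exists_respects_join_goal j p' q' a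
        exact ⟨T, h1, fun b h h' => h2 b h' h, h3.symm⟩
      -- The intersection of two goal premises is a model: a third premise inside it would belong to
      -- some a'' below both a and a', and the antichain property would make all three equal.
      · refine ⟨fun b => (x.goalImp a).1 b && (x.goalImp a').1 b, respects_iff.2
          ⟨joinClosed_and (joinClosed_goalImp a) (joinClosed_goalImp a'), fun a'' ha'' _ _ h' => ?_⟩,
          by simp +contextual, .inl fun b hb => (Bool.and_eq_true_iff.1 hb).1⟩
        exfalso
        have h1 : a'' ≤ a := fun i => ExplicitLattice.belowJoin_self.1
          (Bool.and_eq_true_iff.1 (h' i (a'' i) false le_rfl)).1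
        have h2 : a'' ≤ a' := fun i => ExplicitLattice.belowJoin_self.1
          (Bool.and_eq_true_iff.1 (h' i (a'' i) false le_rfl)).2
        exact hpq (by rw [← x.antichain_A.eq ha'' ha h1, ← x.antichain_A.eq ha'' ha' h2])

end DPLInstance

end LatticeDuality

namespace LatticeDuality

open Function

/-! ### Rules for reasoning about loop programs -/

namespace Cmd

variable {V : Type} [DecidableEq V]

infixr:60 " ;; " => Cmd.seq

/-- Does the program contain a command that changes `v`? -/
def writes : Cmd V → V → Bool
  | skip, _ => false
  | push w _, v => decide (v = w)
  | pop w, v => decide (v = w)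
  | test _ cn cf ct, v => cn.writes v || cf.writes v || ct.writes v
  | seq c d, v => c.writes v || d.writes v
  | copy _ w, v => decide (v = w)
  | scan u w, v => decide (v = u) || decide (v = w)
  | loop _ c, v => c.writes v

/-- The frame rule; for concrete programs its hypothesis is settled by evaluation. -/
theorem run_of_not_writes {c : Cmd V} {v : V} (h : c.writes v = false) :
    ∀ s : Store V, c.run s v = s v := by
  induction c with
  | skip => exact fun _ => rfl
  | push w b => exact fun s => update_of_ne (of_decide_eq_false h) _ _
  | pop w => exact fun s => update_of_ne (of_decide_eq_false h) _ _
  | test w cn cf ct ihn ihf iht =>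
    intro s
    simp only [writes, Bool.or_eq_false_iff] at h
    rcases hw : (s w).head? with _ | _ | _
    · simpa [run, hw] using ihn h.1.1 s
    · simpa [run, hw] using ihf h.1.2 s
    · simpa [run, hw] using iht h.2 s
  | seq c d ihc ihd =>
    intro s
    simp only [writes, Bool.or_eq_false_iff] at h
    exact (ihd h.2 _).trans (ihc h.1 s)
  | copy w u => exact fun s => update_of_ne (of_decide_eq_false h) _ _
  | scan u w =>
    intro s
    simp only [writes, Bool.or_eq_false_iff, decide_eq_false_iff_not] at h
    simp [run, h.1, h.2]
  | loop u c ih =>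
    intro s
    have : ∀ n, (c.run^[n] s) v = s v := by
      intro n
      induction n with
      | zero => rfl
      | succ n ihn => rw [iterate_succ_apply', ih h, ihn]
    exact this _

/-- The invariant rule for loops. -/
theorem loop_nat {v : V} {c : Cmd V} {s : Store V} (P : ℕ → Store V → Prop) (h0 : P 0 s)
    (hstep : ∀ j < (s v).length, ∀ t, (∀ u, c.writes u = false → t u = s u) → P j t →
      P (j + 1) (c.run t)) : P (s v).length ((loop v c).run s) := by
  have : ∀ n ≤ (s v).length, P n (c.run^[n] s) := by
    intro n
    induction n with
    | zero => exact fun _ => h0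
    | succ n ih =>
      intro hn
      rw [iterate_succ_apply']
      refine hstep n (by omega) _ (fun u hu => ?_) (ih (by omega))
      have : ∀ n, (c.run^[n] s) u = s u := by
        intro n
        induction n with
        | zero => rfl
        | succ n ihn => rw [iterate_succ_apply', run_of_not_writes hu, ihn]
      exact this n
  exact this _ le_rfl

/-- The invariant rule for loops over the entries of a list. -/
theorem loop_list {α : Type} {v : V} {c : Cmd V} {s : Store V} (l : List α)
    (hl : (s v).length = l.length) (P : List α → List α → Store V → Prop) (h0 : P [] l s)
    (hstep : ∀ pre a post t, l = pre ++ a :: post → (∀ u, c.writes u = false → t u = s u) →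
      P pre (a :: post) t → P (pre ++ [a]) post (c.run t)) : P l [] ((loop v c).run s) := by
  have := loop_nat (v := v) (c := c) (s := s) (fun j t => P (l.take j) (l.drop j) t) (by simpa) ?_
  · simpa [hl] using this
  · intro j hj t hu hP
    rw [hl] at hj
    rw [List.drop_eq_getElem_cons hj] at hP
    have := hstep _ _ _ t (by rw [← List.drop_eq_getElem_cons hj, List.take_append_drop]) hu hP
    rwa [List.take_concat_get' l j hj] at this

/-- Assign `v` to `w`. -/
def assign (v w : V) : Cmd V := clear w ;; copy v w

@[simp] theorem run_seq (c d : Cmd V) (s : Store V) : (c ;; d).run s = d.run (c.run s) := rfl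

@[simp] theorem run_push (v : V) (b : Bool) (s : Store V) :
    (push v b).run s = update s v (b :: s v) := rfl

@[simp] theorem run_pop (v : V) (s : Store V) : (pop v).run s = update s v (s v).tail := rfl

@[simp] theorem run_copy (v w : V) (s : Store V) :
    (copy v w).run s = update s w (s v ++ s w) := rfl

attribute [simp] run_clear

theorem run_assign {v w : V} (h : v ≠ w) (s : Store V) : (assign v w).run s = update s w (s v) := by
  funext u
  by_cases hu : u = w
  · subst hu; simp [assign, h]
  · simp [assign, hu]

/-- Drop as many bits from `w` as `v` has. -/
theorem run_loop_pop {v w : V} (s : Store V) :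
    (loop v (pop w)).run s = update s w ((s w).drop (s v).length) := by
  have : ∀ n, (pop w).run^[n] s = update s w ((s w).drop n) := by
    intro n
    induction n with
    | zero => simp
    | succ n ih => rw [iterate_succ_apply', ih]; simp
  exact this _

/-- Drop as many bits from `w` as the square of the length of `v`. -/
theorem run_loop_loop_pop {u v w : V} (h : v ≠ w) (s : Store V) :
    (loop u (loop v (pop w))).run s = update s w ((s w).drop ((s u).length * (s v).length)) := by
  have : ∀ n, (loop v (pop w)).run^[n] s = update s w ((s w).drop (n * (s v).length)) := by
    intro n
    induction n with
    | zero => simp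
    | succ n ih =>
      rw [iterate_succ_apply', ih, run_loop_pop]
      simp [h, Nat.succ_mul, Nat.add_comm]
  exact this _

theorem run_loop_push {v w : V} {b : Bool} (s : Store V) :
    (loop v (push w b)).run s = update s w (List.replicate (s v).length b ++ s w) := by
  have : ∀ n, (push w b).run^[n] s = update s w (List.replicate n b ++ s w) := by
    intro n
    induction n with
    | zero => simp
    | succ n ih => rw [iterate_succ_apply', ih]; simp [List.replicate_succ]
  exact this _

theorem run_scan {v w : V} {n : ℕ} {l : List Bool} {s : Store V}
    (h : s v = encodeNat n ++ l) :
    (scan v w).run s = update (update s v l) w (List.replicate n true ++ s w) := by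
  have h1 : List.takeWhile id (s v) = List.replicate n true := by
    rw [h, encodeNat, List.append_assoc, List.takeWhile_append_of_pos (by simp)]
    simp
  have h2 : List.dropWhile id (s v) = false :: l := by
    rw [h, encodeNat, List.append_assoc, List.dropWhile_append_of_pos (by simp)]
    simp
  simp [run, h1, h2]

/-- Push the reversal of `v` on `w`, using `r` as a buffer. -/
def pushReverse (v r w : V) : Cmd V :=
  assign v r ;; loop v (test r skip (push w false) (push w true) ;; pop r)

theorem run_pushReverse {v r w : V} (hvr : v ≠ r) (hrw : r ≠ w) (s : Store V) :
    (pushReverse v r w).run s w = (s v).reverse ++ s w := by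
  simp only [pushReverse, run_seq, run_assign hvr]
  have := loop_nat (v := v) (c := test r skip (push w false) (push w true) ;; pop r)
    (s := update s r (s v)) (fun j t => t r = (s v).drop j ∧ t w = ((s v).take j).reverse ++ s w)
    (by simp [hrw.symm]) ?_
  · simpa [hvr] using this.2
  · rintro j hj t - ⟨h1, h2⟩
    simp only [update_of_ne hvr] at hj
    have hd := List.drop_eq_getElem_cons hj
    rw [hd] at h1
    have ht : ((s v).take (j + 1)).reverse = (s v)[j] :: ((s v).take j).reverse := by
      rw [← List.take_concat_get' _ j hj, List.reverse_append]
      rfl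
    rw [ht]
    rcases hb : (s v)[j] with _ | _ <;>
      simp [run, h1, hb, h2, hrw, hrw.symm]

end Cmd

end LatticeDuality

namespace LatticeDuality

open Function Cmd

/-! ### The program computing the reduction -/

/-- The variables of the program. -/
inductive Var
  | inp | text | lats | width | lat | card | suf | pre | ix | jx | iy | jy | mx | my | mz | rx | ry
  | flag | cnt | idx | objCount | objRows | impCount | impRows | buf | out
  deriving DecidableEq

namespace Var

instance : Fintype Var where
  elems := {inp, text, lats, width, lat, card, suf, pre, ix, jx, iy, jy, mx, my, mz, rx, ry,
    flag, cnt, idx, objCount, objRows, impCount, impRows, buf, out}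
  complete v := by cases v <;> decide

/-- The ranks of the variables. -/
def rank : Var → ℕ
  | inp => 0 | text => 1 | lats => 2 | width => 5 | lat => 3 | card => 4 | suf => 6 | pre => 5
  | ix => 5 | jx => 5 | iy => 6 | jy => 6 | mx => 5 | my => 6 | mz => 5 | rx => 7 | ry => 7
  | flag => 7 | cnt => 2 | idx => 3 | objCount => 8 | objRows => 8 | impCount => 8 | impRows => 8
  | buf => 9 | out => 10

/-- The variables collecting the output. -/
def isOut : Var → Bool
  | objCount | objRows | impCount | impRows => true
  | _ => false

/-- The variables that are neither scratch variables nor collect the output. -/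
def isEnv : Var → Bool
  | mz | rx | ry | flag | objCount | objRows | impCount | impRows => false
  | _ => true

end Var

namespace Reduction

open Var

/-- Push the characteristic function of the principal ideal generated by the join of two elements.
The matrix of the lattice is on top of `lat`, and the rows of the elements are on top of `mx` and
`my`. -/
def pushIdeal (o : Var) : Cmd Var :=
  assign lat mz ;; loop card (
    (clear flag ;; assign mx rx ;; assign my ry) ;;
    loop card (
      test rx skip skip (test ry skip skip (test mz skip (push flag true) skip)) ;;
      pop rx ;; pop ry ;; pop mz) ;;
    test flag (push o true) (push o false) (push o false))

def pushBlockIdeal (o : Var) : Cmd Var := pushIdeal o ;; pushIdeal o ;; push o true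

def pushBlockSide (o : Var) (c b : Bool) : Cmd Var :=
  loop card (push o (!c)) ;; loop card (push o c) ;; push o b

/-- Push a bit for every element of the lattice that is `b` at the position given by the lengths of
`i` and `j` only. -/
def pushPoint (o i j : Var) (b : Bool) : Cmd Var :=
  loop i (push o (!b)) ;; push o b ;; loop j (push o (!b))

def pushBlockSideErase (o : Var) : Bool → Cmd Var
  | false => pushPoint o ix jx false ;; loop card (push o false) ;; push o true
  | true => loop card (push o false) ;; pushPoint o ix jx false ;; push o true

def pushBlockPair (o : Var) : Cmd Var :=
  pushPoint o ix jx true ;; pushPoint o iy jy true ;; push o false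

/-- Complete a block to a row that is constant on the other blocks. -/
def pushRow (o : Var) (b : Bool) (c : Cmd Var) (g t : Bool) : Cmd Var :=
  loop pre (push o b) ;; c ;; loop suf (push o b) ;; push o g ;; push o t

def pushSideObjects (c : Bool) : Cmd Var :=
  pushRow objRows true (pushBlockSide objRows c true) true false ;;
  pushRow objRows true (pushBlockSide objRows c true) true true ;;
  pushRow objRows true (pushBlockSide objRows c false) true true ;;
  pushRow objRows true (pushBlockSideErase objRows c) true true

def pushMany (o : Var) : ℕ → Cmd Var
  | 0 => skip
  | n + 1 => push o true ;; pushMany o n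

def pushElemObjects : Cmd Var :=
  (pushRow objRows true (pushBlockIdeal objRows) true true ;;
    pushSideObjects false ;; pushSideObjects true) ;; pushMany objCount 9

def pushJoinImp : Cmd Var :=
  (pushRow impRows false (pushBlockPair impRows) false false ;;
    pushRow impRows false (pushBlockIdeal impRows) false false) ;; pushMany impCount 1

/-- `iy` and `jy` count the elements before and after the current second element. Hence `jy` is
shortened before the rows are emitted and `iy` lengthened afterwards, when `my` advances by one
matrix row. -/
def stepSnd : Cmd Var :=
  pop jy ;; pushJoinImp ;; push iy true ;; loop card (pop my)

/-- `my` first repeats the row in `mx`, because the principal ideals needed for the objects are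
joins of an element with itself. It is then reset to the whole matrix for the loop over second
elements. -/
def stepFst : Cmd Var :=
  (pop jx ;; assign mx my) ;; pushElemObjects ;; (assign lat my ;; clear iy ;; assign card jy) ;;
    loop card stepSnd ;; push ix true ;; loop card (pop mx)

/-- The block width, twice the cardinality plus one, is taken off `suf` before the rows are emitted
and added to `pre` afterwards, so the current block is counted in neither. `card` is cleared first
because `scan` adds to its target. -/
def stepLattice : Cmd Var :=
  (clear card ;; scan lat card ;; pop suf ;; loop card (pop suf) ;; loop card (pop suf)
    ;; assign lat mx ;; clear ix ;; assign card jx) ;;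
  loop card stepFst ;; loop card (loop card (pop lat)) ;;
    push pre true ;; loop card (push pre true) ;; loop card (push pre true)

def skipLattice : Cmd Var :=
  clear card ;; scan text card ;; push width true ;; loop card (push width true) ;;
    loop card (push width true) ;; loop card (loop card (pop text))

/-- Push the block of a component of a tuple. -/
def pushComponent (o : Var) : Cmd Var :=
  (clear card ;; scan lat card ;; clear idx ;; scan text idx ;; assign lat mx ;;
    loop idx (loop card (pop mx)) ;; assign mx my) ;;
  pushBlockIdeal o ;; loop card (loop card (pop lat))

/-- The lattices are read again from the untouched input for every tuple. Scanning into `flag`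
merely discards their number, since `pushIdeal` clears `flag` before using it. -/
def pushTuple (o : Var) : Cmd Var :=
  (assign inp lat ;; scan lat flag) ;; loop lats (pushComponent o)

def pushGoalImp : Cmd Var :=
  pushTuple impRows ;; push impRows true ;; push impRows false ;;
    loop width (push impRows false) ;; push impRows false ;; push impRows true ;;
    push impCount true

def pushTupleObject : Cmd Var :=
  pushTuple objRows ;; push objRows true ;; push objRows false ;; push objCount true

def pushLastObjects : Cmd Var :=
  loop width (push objRows true) ;; push objRows false ;; push objRows true ;;
  loop width (push objRows true) ;; push objRows false ;; push objRows false ;;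
  push objCount true ;; push objCount true

/-- A stack is written from its bottom, so the output is produced back to front; the collected rows
were stored in reverse as well and are turned around. The two extra `true` bits count `guard` and
`goal`. -/
def assemble : Cmd Var :=
  pushReverse impRows buf out ;; push out false ;; copy impCount out ;;
  pushReverse objRows buf out ;; push out false ;;
  copy width out ;; push out true ;; push out true ;; push out false ;; copy objCount out

/-- The program computing the reduction. -/
def program : Cmd Var :=
  (copy inp text ;; scan text lats) ;; loop lats skipLattice ;;
  (copy inp lat ;; scan lat flag ;; copy width suf) ;; loop lats stepLattice ;;
  scan text cnt ;; loop cnt pushGoalImp ;;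
  (clear cnt ;; scan text cnt) ;; loop cnt pushTupleObject ;;
  pushLastObjects ;; assemble

/-- Data flow from the input towards the output along increasing ranks. Shrinking a stack is
unrestricted, so loops may consume variables of any rank. -/
theorem ranked_program : Ranked rank 0 program := by
  simp [program, Ranked, skipLattice, stepLattice, stepFst, stepSnd, pushElemObjects, pushJoinImp,
    pushGoalImp, pushTupleObject, pushLastObjects, assemble, pushTuple, pushComponent, pushMany,
    pushSideObjects, pushRow, pushBlockPair, pushBlockSideErase, pushPoint, pushBlockSide,
    pushBlockIdeal, pushIdeal, clear, assign, pushReverse, rank]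

/-! ### Emitted bits -/

/-- In the environment `s`, the program appends the bits `f` to the output variables, in reverse
order, and does not change the environment. -/
def Emits (c : Cmd Var) (s : Store Var) (f : Store Var) : Prop :=
  ∀ t, (∀ v, v.isEnv = true → t v = s v) → (∀ v, v.isEnv = true → c.run t v = s v) ∧
    ∀ v, v.isOut = true → c.run t v = (f v).reverse ++ t v

theorem Emits.seq {c d : Cmd Var} {s f g : Store Var} (h : Emits c s f) (h' : Emits d s g) :
    Emits (c ;; d) s (fun v => f v ++ g v) := by
  intro t ht
  obtain ⟨h1, h2⟩ := h t ht
  obtain ⟨h3, h4⟩ := h' _ h1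
  exact ⟨h3, fun v hv => by rw [run_seq, h4 v hv, h2 v hv, List.reverse_append, List.append_assoc]⟩

/-- The program appends bits to a single output variable. -/
def EmitsTo (o : Var) (c : Cmd Var) (s : Store Var) (l : List Bool) : Prop := Emits c s (single o l)

theorem EmitsTo.seq {o : Var} {c d : Cmd Var} {s : Store Var} {l l' : List Bool}
    (h : EmitsTo o c s l) (h' : EmitsTo o d s l') : EmitsTo o (c ;; d) s (l ++ l') := by
  have := Emits.seq h h'
  unfold EmitsTo
  convert this using 2 with v
  unfold single
  split_ifs <;> simp

variable {o : Var}

theorem isEnv_of_isOut {v : Var} (ho : v.isOut = true) : v.isEnv = false := by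
  cases v <;> simp_all [isOut, isEnv]

theorem emitsTo_of_run (ho : o.isOut = true) {c : Cmd Var} {s : Store Var} {l : List Bool}
    (h : ∀ t, (∀ v, v.isEnv = true → t v = s v) → c.run t = update t o (l.reverse ++ t o)) :
    EmitsTo o c s l := by
  intro t ht
  rw [h t ht]
  refine ⟨fun v hv => ?_, fun v _ => ?_⟩
  · rw [update_of_ne, ht v hv]
    rintro rfl
    simp [isEnv_of_isOut ho] at hv
  · by_cases hvo : v = o
    · subst hvo; simp [single]
    · simp [single, hvo]

theorem emitsTo_push (ho : o.isOut = true) (b : Bool) (s : Store Var) :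
    EmitsTo o (push o b) s [b] :=
  emitsTo_of_run ho fun t _ => by simp

theorem emitsTo_loop_push (ho : o.isOut = true) {v : Var} (hv : v.isEnv = true) (b : Bool)
    (s : Store Var) : EmitsTo o (loop v (push o b)) s (List.replicate (s v).length b) :=
  emitsTo_of_run ho fun t ht => by rw [run_loop_push, ht v hv, List.reverse_replicate]

theorem emitsTo_pushMany (ho : o.isOut = true) (n : ℕ) (s : Store Var) :
    EmitsTo o (pushMany o n) s (List.replicate n true) := by
  induction n with
  | zero => exact emitsTo_of_run ho fun t _ => by simp [pushMany, run]
  | succ n ih => exact (emitsTo_push ho true s).seq ih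

/-- The bit computed by `pushIdeal`. -/
def idealBit (s : Store Var) (z : ℕ) : Bool :=
  decide (∀ u < (s card).length, (s mx)[u]? = some true → (s my)[u]? = some true →
    (s lat)[z * (s card).length + u]? ≠ some false)

/-- The bits computed by `pushIdeal`. -/
def idealBits (s : Store Var) : List Bool := (List.range (s card).length).map (idealBit s)

/-- An element lies below the join iff it lies below all common upper bounds. The inner loop scans
three matrix rows in parallel, and `flag` records a common upper bound of the two given elements
that is not above the current one. -/
theorem emitsTo_pushIdeal (ho : o = objRows ∨ o = impRows) (s : Store Var) :
    EmitsTo o (pushIdeal o) s (idealBits s) := by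
  intro t ht
  have hw : ∀ v, v.isEnv = true ∨ v.isOut = true ∧ v ≠ o → (pushIdeal o).writes v = false := by
    rcases ho with rfl | rfl <;> decide
  have hoo : o.isOut = true := by rcases ho with rfl | rfl <;> rfl
  refine ⟨fun v hv => by rw [run_of_not_writes (hw v (.inl hv)), ht v hv], fun v hv => ?_⟩
  by_cases hvo : v = o
  swap
  · rw [run_of_not_writes (hw v (.inr ⟨hv, hvo⟩))]
    simp [single, hvo]
  subst hvo
  have hvne : ∀ u : Var, u.isOut = false → u ≠ v := by
    rintro u hu rfl
    rw [hu] at hv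
    cases hv
  simp only [pushIdeal, run_seq, run_assign (show lat ≠ mz by decide)]
  have hn : (update t mz (t lat) card).length = (s card).length := by
    rw [update_of_ne (by decide), ht _ rfl]
  have key := loop_nat (v := card) (s := update t mz (t lat)) (c :=
    (clear flag ;; assign mx rx ;; assign my ry) ;;
    loop card (
      test rx skip skip (test ry skip skip (test mz skip (push flag true) skip)) ;;
      pop rx ;; pop ry ;; pop mz) ;;
    test flag (push v true) (push v false) (push v false))
    (fun z t' => t' mz = (s lat).drop (z * (s card).length) ∧
      t' v = ((List.range z).map (idealBit s)).reverse ++ t v)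
    ⟨by simp [ht lat rfl], by simp [(hvne mz rfl).symm]⟩ ?_
  · rw [hn] at key
    rw [key.2]
    simp [single, idealBits]
  · rintro z hz t1 hframe ⟨h1, h2⟩
    have hfr : ∀ u, u.isEnv = true → t1 u = s u := by
      intro u hu
      rw [hframe u, update_of_ne, ht u hu]
      · rintro rfl; cases hu
      · revert u
        rcases ho with rfl | rfl <;> decide
    obtain ⟨t2, ht2⟩ : ∃ t2, t2 = (clear flag ;; assign mx rx ;; assign my ry).run t1 := ⟨_, rfl⟩
    have ht2' : t2 = update (update (update t1 flag []) rx (s mx)) ry (s my) := by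
      rw [ht2]
      simp [run_assign, hfr mx rfl, hfr my rfl]
    have hn2 : (t2 card).length = (s card).length := by simp [ht2', hfr card rfl]
    let cond : ℕ → Prop := fun u => (s mx)[u]? = some true → (s my)[u]? = some true →
      (s lat)[z * (s card).length + u]? ≠ some false
    -- `flag` is empty exactly as long as no violation has been met. `mz` is never rewound: after
    -- one row it stands at the next one, as the outer invariant requires.
    have inner := loop_nat (v := card) (s := t2) (c :=
      test rx skip skip (test ry skip skip (test mz skip (push flag true) skip)) ;;
      pop rx ;; pop ry ;; pop mz)
      (fun u t' => t' rx = (s mx).drop u ∧ t' ry = (s my).drop u ∧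
        t' mz = (s lat).drop (z * (s card).length + u) ∧ (t' flag = [] ↔ ∀ u' < u, cond u'))
      ⟨by simp [ht2'], by simp [ht2'], by simp [ht2', h1], by simp [ht2']⟩ ?_
    · rw [hn2] at inner
      obtain ⟨-, -, i3, i4⟩ := inner
      have i5 := run_of_not_writes (v := v) (c := loop card (
        test rx skip skip (test ry skip skip (test mz skip (push flag true) skip)) ;;
        pop rx ;; pop ry ;; pop mz)) (by rcases ho with rfl | rfl <;> rfl) t2
      have i6 : t2 v = t1 v := by
        rw [ht2', update_of_ne (hvne ry rfl).symm, update_of_ne (hvne rx rfl).symm,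
          update_of_ne (hvne flag rfl).symm]
      rw [run_seq, run_seq, ← ht2]
      generalize (loop card _).run t2 = t3 at i3 i4 i5
      have hb : (test flag (push v true) (push v false) (push v false)).run t3 =
          update t3 v (idealBit s z :: t3 v) := by
        rcases hf : t3 flag with _ | ⟨b, l⟩
        · have : idealBit s z = true := decide_eq_true (i4.1 hf)
          simp [run, hf, this]
        · have : idealBit s z = false := decide_eq_false fun h => by
            rw [i4.2 h] at hf
            cases hf
          cases b <;> simp [run, hf, this]
      rw [hb]
      constructor
      · rw [update_of_ne (hvne mz rfl), i3, Nat.succ_mul]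
      · rw [update_self, i5, i6, h2, List.range_succ]
        simp
    · rintro u hu t4 - ⟨j1, j2, j3, j4⟩
      have hc : (∀ u' < u + 1, cond u') ↔ (∀ u' < u, cond u') ∧ cond u :=
        Nat.forall_lt_succ_right
      have e1 : (t4 rx).head? = (s mx)[u]? := by rw [j1, List.head?_drop]
      have e2 : (t4 ry).head? = (s my)[u]? := by rw [j2, List.head?_drop]
      have e3 : (t4 mz).head? = (s lat)[z * (s card).length + u]? := by rw [j3, List.head?_drop]
      rw [hc, ← j4]
      simp only [cond, ← e1, ← e2, ← e3]
      have hpop : ∀ t5 : Store Var, t5 rx = t4 rx → t5 ry = t4 ry → t5 mz = t4 mz →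
          ∃ t6, t6 = (pop rx ;; pop ry ;; pop mz).run t5 ∧ t6 rx = (s mx).drop (u + 1) ∧
            t6 ry = (s my).drop (u + 1) ∧
            t6 mz = (s lat).drop (z * (s card).length + (u + 1)) ∧ t6 flag = t5 flag := by
        intro t5 k1 k2 k3
        exact ⟨_, rfl, by simp [k1, j1], by simp [k2, j2], by simp [k3, j3, Nat.add_assoc],
          by simp⟩
      rw [run_seq]
      obtain ⟨t5, ht5⟩ : ∃ t5, t5 = (test rx skip skip (test ry skip skip
        (test mz skip (push flag true) skip))).run t4 := ⟨_, rfl⟩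
      obtain ⟨t6, ht6, k1, k2, k3, k4⟩ := hpop t5
        (by rw [ht5, run_of_not_writes rfl]) (by rw [ht5, run_of_not_writes rfl])
        (by rw [ht5, run_of_not_writes rfl])
      rw [← ht5, ← ht6]
      refine ⟨k1, k2, k3, ?_⟩
      rw [k4, ht5]
      rcases f1 : (t4 rx).head? with _ | _ | _ <;> rcases f2 : (t4 ry).head? with _ | _ | _ <;>
        rcases f3 : (t4 mz).head? with _ | _ | _ <;> simp [run, f1, f2, f3]

end Reduction

end LatticeDuality

namespace LatticeDuality

open Function Cmd

/-! ### The emitted rows are the rows of the constructed instance -/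

/-- The attributes of the block of a lattice. -/
def ExplicitLattice.blockList (L : ExplicitLattice) : List (Option (L.Elem × Bool)) :=
  L.elems.map (fun z => some (z, false)) ++ (L.elems.map (fun z => some (z, true)) ++ [none])

theorem ExplicitLattice.length_elems (L : ExplicitLattice) : L.elems.length = L.card :=
  List.length_finRange

/-- The number of attributes of the block of a lattice. -/
def ExplicitLattice.width (L : ExplicitLattice) : ℕ := L.blockList.length

theorem ExplicitLattice.width_eq (L : ExplicitLattice) : L.width = L.card + (L.card + 1) := by
  simp [width, blockList, length_elems]

theorem ExplicitLattice.map_blockList {L : ExplicitLattice} (β : L.Block) :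
    L.blockList.map β = L.elems.map (fun z => β (some (z, false))) ++
      (L.elems.map (fun z => β (some (z, true))) ++ [β none]) := by
  simp [blockList, comp_def]

theorem getElem?_encodeMatrix {n : ℕ} (a : Fin n → Fin n → Bool) (l : List Bool) (z u : Fin n) :
    (encodeMatrix a ++ l)[z.val * n + u.val]? = some (a z u) := by
  have h : encodeMatrix a = List.ofFn fun j : Fin (n * n) => a j.divNat j.modNat := by
    rw [encodeMatrix, encodeTuple, List.ofFn_mul]
    congr 2
    funext i
    rw [encodeTuple_bit]
    congr 1
    funext j
    have hn : 0 < n := Fin.pos j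
    congr 1
    · ext; simp [Fin.coe_divNat, Nat.add_comm, Nat.add_mul_div_right, hn]
    · ext; simp [Fin.coe_modNat, Nat.mod_eq_of_lt]
  have hlt : z.val * n + u.val < n * n := by
    calc z.val * n + u.val < z.val * n + n := by omega
      _ = (z.val + 1) * n := by rw [Nat.succ_mul]
      _ ≤ n * n := Nat.mul_le_mul_right n z.isLt
  have hn : 0 < n := Fin.pos u
  rw [h, List.getElem?_append_left (by simpa using hlt), List.getElem?_ofFn, dif_pos hlt]
  congr 2
  · ext; simp [Fin.coe_divNat, Nat.add_comm, Nat.add_mul_div_right, hn]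
  · ext; simp [Fin.coe_modNat, Nat.mod_eq_of_lt]

theorem length_encodeMatrix {n : ℕ} (a : Fin n → Fin n → Bool) :
    (encodeMatrix a).length = n * n := by
  rw [encodeMatrix, encodeTuple]
  simp only [encodeTuple_bit]
  simp [comp_def]

theorem map_point {α : Type} [DecidableEq α] {l il jl : List α} {p : α} (hl : l = il ++ p :: jl)
    (hnd : l.Nodup) (b : Bool) :
    l.map (fun z => if z = p then b else !b) =
      List.replicate il.length (!b) ++ (b :: List.replicate jl.length (!b)) := by
  subst hl
  rw [List.nodup_append, List.nodup_cons] at hnd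
  rw [List.map_append, List.map_cons, if_pos rfl]
  congr 1
  · refine List.eq_replicate_iff.2 ⟨by simp, fun c hc => ?_⟩
    obtain ⟨z, hz, rfl⟩ := List.mem_map.1 hc
    rw [if_neg (hnd.2.2 z hz p (by simp))]
  · congr 1
    refine List.eq_replicate_iff.2 ⟨by simp, fun c hc => ?_⟩
    obtain ⟨z, hz, rfl⟩ := List.mem_map.1 hc
    rw [if_neg]
    rintro rfl
    exact hnd.2.1.1 hz

theorem flatMap_replicate {α : Type} (l : List α) (f : α → ℕ) (b : Bool) :
    l.flatMap (fun a => List.replicate (f a) b) = List.replicate (l.map f).sum b := by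
  induction l with
  | nil => rfl
  | cons a l ih => simp [ih, List.replicate_append_replicate]

namespace DPLInstance

variable {x : DPLInstance}

theorem map_attrs_row (β : ∀ i, (x.L i).Block) (g t : Bool) :
    x.attrs.map (row β g t) =
      (List.finRange x.k).flatMap (fun i => (x.L i).blockList.map (β i)) ++ [g, t] := by
  simp only [attrs, List.map_append, List.map_flatMap, List.map_cons, List.map_nil]
  congr 1
  refine List.flatMap_congr fun i _ => ?_
  simp [blockAttrs, ExplicitLattice.blockList, row, comp_def]

/-- This is the shape produced by `pushRow`: constant bits for the blocks before and after the
current one, whose total widths are held in `pre` and `suf`. -/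
theorem map_attrs_update {il jl : List (Fin x.k)} {i : Fin x.k}
    (h : List.finRange x.k = il ++ i :: jl) (b : Bool) (β : (x.L i).Block) (g t : Bool) :
    x.attrs.map (row (update (fun _ _ => b) i β) g t) =
      List.replicate (il.map fun j => (x.L j).width).sum b ++ ((x.L i).blockList.map β ++
        (List.replicate (jl.map fun j => (x.L j).width).sum b ++ [g, t])) := by
  have hnd := List.nodup_finRange x.k
  rw [h, List.nodup_append, List.nodup_cons] at hnd
  rw [map_attrs_row, h, List.flatMap_append, List.flatMap_cons, update_self,
    ← flatMap_replicate, ← flatMap_replicate]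
  simp only [List.append_assoc]
  congr 1
  · refine List.flatMap_congr fun j hj => ?_
    rw [update_of_ne (hnd.2.2 j hj i (by simp)), List.map_const']
    rfl
  · congr 2
    refine List.flatMap_congr fun j hj => ?_
    rw [update_of_ne, List.map_const']
    · rfl
    · rintro rfl
      exact hnd.2.1.1 hj

end DPLInstance

namespace Reduction

open Var DPLInstance

variable {x : DPLInstance} {L : ExplicitLattice} {s : Store Var} {o : Var}

/-- The variables `card` and `lat` hold a lattice. -/
structure HoldsLattice (L : ExplicitLattice) (s : Store Var) : Prop where
  card_eq : s card = List.replicate L.card true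
  lat_eq : ∃ l, s lat = encodeMatrix L.leq ++ l

/-- The row of an element of the lattice is on top of `v`. -/
def HoldsRow (v : Var) (p : L.Elem) (s : Store Var) : Prop :=
  s v = (s lat).drop (Fin.val p * L.card)

/-- Further bits may follow the rows and the matrix on the stacks, but only positions inside the
matrix are inspected. -/
theorem idealBits_eq (hL : HoldsLattice L s) {p q : L.Elem} (hp : HoldsRow mx p s)
    (hq : HoldsRow my q s) : idealBits s = L.elems.map (L.belowJoin p q) := by
  obtain ⟨l, hl⟩ := hL.lat_eq
  have hn : (s card).length = L.card := by rw [hL.card_eq, List.length_replicate]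
  have hrow : ∀ {v : Var} {p : L.Elem}, HoldsRow v p s → ∀ u : Fin L.card,
      (s v)[u.val]? = some (L.leq p u) := by
    intro v p hp u
    rw [hp, List.getElem?_drop, hl]
    exact getElem?_encodeMatrix _ _ _ _
  rw [idealBits, hn, ← List.map_coe_finRange_eq_range, List.map_map]
  refine List.map_congr_left fun z _ => ?_
  have hz : ∀ u : Fin L.card, (s lat)[Fin.val z * L.card + u.val]? = some (L.leq z u) := by
    intro u
    rw [hl]
    exact getElem?_encodeMatrix _ _ _ _
  simp only [comp_apply, idealBit, hn, ExplicitLattice.belowJoin]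
  refine decide_eq_decide.2 ⟨fun h u => ?_, fun h u hu => ?_⟩
  · have := h u.val u.isLt
    rw [hrow hp, hrow hq, hz] at this
    simpa using this
  · have := h ⟨u, hu⟩
    have h1 := hrow hp ⟨u, hu⟩
    have h2 := hrow hq ⟨u, hu⟩
    have h3 := hz ⟨u, hu⟩
    simp only at h1 h2 h3
    rw [h1, h2, h3]
    simpa using this

theorem isOut_of_or (ho : o = objRows ∨ o = impRows) : o.isOut = true := by
  rcases ho with rfl | rfl <;> rfl

theorem EmitsTo.congr {c : Cmd Var} {l l' : List Bool}
    (h : EmitsTo o c s l) (hl : l = l') : EmitsTo o c s l' := hl ▸ h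

theorem emitsTo_pushBlockIdeal (ho : o = objRows ∨ o = impRows) (hL : HoldsLattice L s)
    {p q : L.Elem} (hp : HoldsRow mx p s) (hq : HoldsRow my q s) :
    EmitsTo o (pushBlockIdeal o) s (L.blockList.map (blockIdeal p q)) := by
  have h := emitsTo_pushIdeal ho s
  rw [idealBits_eq hL hp hq] at h
  rw [ExplicitLattice.map_blockList]
  exact h.seq (h.seq (emitsTo_push (isOut_of_or ho) _ _))

theorem emitsTo_loop_card (ho : o.isOut = true) (hL : HoldsLattice L s) (b : Bool) :
    EmitsTo o (loop card (push o b)) s (L.elems.map fun _ => b) := by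
  have := emitsTo_loop_push ho (v := card) rfl b s
  rwa [hL.card_eq, List.length_replicate, ← L.length_elems, ← List.map_const'] at this

theorem emitsTo_pushBlockSide (ho : o.isOut = true) (hL : HoldsLattice L s) (c b : Bool) :
    EmitsTo o (pushBlockSide o c b) s (L.blockList.map (blockSide c b)) := by
  refine ((emitsTo_loop_card ho hL (!c)).seq
    ((emitsTo_loop_card ho hL c).seq (emitsTo_push ho b s))).congr ?_
  rw [ExplicitLattice.map_blockList]
  cases c <;> rfl

theorem emitsTo_pushPoint (ho : o.isOut = true) {i j : Var} (hi : i.isEnv = true)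
    (hj : j.isEnv = true) {p : L.Elem} {il jl : List L.Elem} (h : L.elems = il ++ p :: jl)
    (hil : (s i).length = il.length) (hjl : (s j).length = jl.length) (b : Bool) :
    EmitsTo o (pushPoint o i j b) s (L.elems.map fun z => if z = p then b else !b) := by
  rw [map_point h (List.nodup_finRange _), ← hil, ← hjl]
  exact (emitsTo_loop_push ho hi _ s).seq ((emitsTo_push ho b s).seq (emitsTo_loop_push ho hj _ s))

/-- The variables `i` and `j` hold the position of an element of the lattice. -/
def HoldsIndex (i j : Var) (p : L.Elem) (s : Store Var) : Prop :=
  ∃ il jl, L.elems = il ++ p :: jl ∧ (s i).length = il.length ∧ (s j).length = jl.length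

theorem emitsTo_pushBlockSideErase (ho : o.isOut = true) (hL : HoldsLattice L s) {p : L.Elem}
    (hp : HoldsIndex ix jx p s) (c : Bool) :
    EmitsTo o (pushBlockSideErase o c) s (L.blockList.map (blockSideErase c p)) := by
  obtain ⟨il, jl, h, hil, hjl⟩ := hp
  have h1 := emitsTo_pushPoint (s := s) ho rfl rfl h hil hjl false
  have h2 := emitsTo_loop_card ho hL false
  have h3 := emitsTo_push ho true s
  have h4 : ∀ z, blockSideErase c p (some (z, c)) = if z = p then false else !false := by
    intro z
    by_cases hz : z = p <;> simp [blockSideErase, hz]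
  rw [ExplicitLattice.map_blockList]
  cases c
  · refine (h1.seq (h2.seq h3)).congr ?_
    simp only [h4]
    rfl
  · refine (h2.seq (h1.seq h3)).congr ?_
    simp only [h4]
    rfl

theorem emitsTo_pushBlockPair (ho : o.isOut = true) {p q : L.Elem} (hp : HoldsIndex ix jx p s)
    (hq : HoldsIndex iy jy q s) :
    EmitsTo o (pushBlockPair o) s (L.blockList.map (blockPair p q)) := by
  obtain ⟨il, jl, h, hil, hjl⟩ := hp
  obtain ⟨il', jl', h', hil', hjl'⟩ := hq
  have h1 := emitsTo_pushPoint (s := s) ho rfl rfl h hil hjl true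
  have h2 := emitsTo_pushPoint (s := s) ho rfl rfl h' hil' hjl' true
  have h3 : ∀ z, blockPair p q (some (z, false)) = if z = p then true else !true := by
    intro z
    by_cases hz : z = p <;> simp [blockPair, hz]
  have h4 : ∀ z, blockPair p q (some (z, true)) = if z = q then true else !true := by
    intro z
    by_cases hz : z = q <;> simp [blockPair, hz]
  refine (h1.seq (h2.seq (emitsTo_push ho false s))).congr ?_
  rw [ExplicitLattice.map_blockList]
  simp only [h3, h4]
  rfl

/-- The variables `pre` and `suf` hold the numbers of attributes before and after a block. -/
structure HoldsPosition (x : DPLInstance) (i : Fin x.k) (s : Store Var) : Prop where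
  lattice : HoldsLattice (x.L i) s
  position : ∃ il jl, List.finRange x.k = il ++ i :: jl ∧
    (s pre).length = (il.map fun j => (x.L j).width).sum ∧
    (s suf).length = (jl.map fun j => (x.L j).width).sum

theorem emitsTo_pushRow (ho : o.isOut = true) {i : Fin x.k} (hi : HoldsPosition x i s)
    {c : Cmd Var} {β : (x.L i).Block} (hc : EmitsTo o c s ((x.L i).blockList.map β))
    (b g t : Bool) : EmitsTo o (pushRow o b c g t) s
      (x.attrs.map (row (update (fun _ _ => b) i β) g t)) := by
  obtain ⟨il, jl, h, h1, h2⟩ := hi.position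
  rw [map_attrs_update h, ← h1, ← h2]
  exact (emitsTo_loop_push ho rfl b s).seq (hc.seq ((emitsTo_loop_push ho rfl b s).seq
    ((emitsTo_push ho g s).seq (emitsTo_push ho t s))))

theorem emitsTo_pushSideObjects {i : Fin x.k} (hi : HoldsPosition x i s) {p : (x.L i).Elem}
    (hp : HoldsIndex ix jx p s) (c : Bool) : EmitsTo objRows (pushSideObjects c) s
      ((x.sideObjects i p c).flatMap fun o => x.attrs.map o) := by
  have h1 := emitsTo_pushBlockSide (o := objRows) rfl hi.lattice c true
  have h2 := emitsTo_pushBlockSide (o := objRows) rfl hi.lattice c false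
  have h3 := emitsTo_pushBlockSideErase (o := objRows) rfl hi.lattice hp c
  refine ((emitsTo_pushRow rfl hi h1 true true false).seq
    ((emitsTo_pushRow rfl hi h1 true true true).seq
    ((emitsTo_pushRow rfl hi h2 true true true).seq
    (emitsTo_pushRow rfl hi h3 true true true)))).congr ?_
  simp only [sideObjects, List.flatMap_cons, List.flatMap_nil, List.append_nil]
  rfl

theorem emits_pushElemObjects {i : Fin x.k} (hi : HoldsPosition x i s) {p : (x.L i).Elem}
    (hx : HoldsRow mx p s) (hy : HoldsRow my p s) (hp : HoldsIndex ix jx p s) :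
    Emits pushElemObjects s fun v =>
      single objRows ((x.elemObjects i p).flatMap fun o => x.attrs.map o) v ++
        single objCount (List.replicate 9 true) v := by
  have h1 := emitsTo_pushBlockIdeal (o := objRows) (.inl rfl) hi.lattice hx hy
  have h := ((emitsTo_pushRow rfl hi h1 true true true).seq
    ((emitsTo_pushSideObjects hi hp false).seq (emitsTo_pushSideObjects hi hp true))).congr
    (l' := (x.elemObjects i p).flatMap fun o => x.attrs.map o) (by
      rw [elemObjects, List.flatMap_cons, List.flatMap_append]
      rfl)
  exact Emits.seq h (emitsTo_pushMany rfl 9 s)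

theorem emits_pushJoinImp {i : Fin x.k} (hi : HoldsPosition x i s) {p q : (x.L i).Elem}
    (hx : HoldsRow mx p s) (hy : HoldsRow my q s) (hp : HoldsIndex ix jx p s)
    (hq : HoldsIndex iy jy q s) :
    Emits pushJoinImp s fun v =>
      single impRows (x.attrs.map (x.joinImp i p q).1 ++ x.attrs.map (x.joinImp i p q).2) v ++
        single impCount [true] v := by
  have h1 := emitsTo_pushBlockIdeal (o := impRows) (.inr rfl) hi.lattice hx hy
  have h2 := emitsTo_pushBlockPair (o := impRows) rfl hp hq
  exact Emits.seq ((emitsTo_pushRow rfl hi h2 false false false).seq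
    (emitsTo_pushRow rfl hi h1 false false false)) (emitsTo_pushMany rfl 1 s)

end Reduction

end LatticeDuality

/-! ### The loops over lattices and their elements -/

namespace LatticeDuality

open Function Cmd

namespace Reduction

open Var DPLInstance

variable {x : DPLInstance} {L : ExplicitLattice} {s t u : Store Var}

/-- Between the stores `s` and `t`, rows for the objects `O` and the implications `J` have been
added to the output. -/
structure Collects (x : DPLInstance) (O : List (x.Attr → Bool))
    (J : List ((x.Attr → Bool) × (x.Attr → Bool))) (s t : Store Var) : Prop where
  objRows_eq : t objRows = (O.flatMap fun o => x.attrs.map o).reverse ++ s objRows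
  objCount_eq : t objCount = List.replicate O.length true ++ s objCount
  impRows_eq : t impRows =
    (J.flatMap fun p => x.attrs.map p.1 ++ x.attrs.map p.2).reverse ++ s impRows
  impCount_eq : t impCount = List.replicate J.length true ++ s impCount

theorem Collects.trans {O O' : List (x.Attr → Bool)}
    {J J' : List ((x.Attr → Bool) × (x.Attr → Bool))} (h : Collects x O J s t)
    (h' : Collects x O' J' t u) : Collects x (O ++ O') (J ++ J') s u := by
  obtain ⟨h1, h2, h3, h4⟩ := h
  obtain ⟨k1, k2, k3, k4⟩ := h'
  constructor
  · rw [k1, h1, List.flatMap_append, List.reverse_append, List.append_assoc]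
  · rw [k2, h2, ← List.append_assoc, List.replicate_append_replicate, List.length_append,
      Nat.add_comm]
  · rw [k3, h3, List.flatMap_append, List.reverse_append, List.append_assoc]
  · rw [k4, h4, ← List.append_assoc, List.replicate_append_replicate, List.length_append,
      Nat.add_comm]

theorem Collects.of_eq (h : ∀ v, v.isOut = true → t v = s v) : Collects x [] [] s t := by
  constructor <;> simp [h objRows rfl, h objCount rfl, h impRows rfl, h impCount rfl]

theorem Collects.congr_left {O : List (x.Attr → Bool)}
    {J : List ((x.Attr → Bool) × (x.Attr → Bool))} (h : Collects x O J s t)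
    (hu : ∀ v, v.isOut = true → u v = s v) : Collects x O J u t := by
  simpa using (Collects.of_eq (x := x) (s := u) (t := s) fun v hv => (hu v hv).symm).trans h

theorem Collects.congr_right {O : List (x.Attr → Bool)}
    {J : List ((x.Attr → Bool) × (x.Attr → Bool))} (h : Collects x O J s t)
    (hu : ∀ v, v.isOut = true → u v = t v) : Collects x O J s u := by
  simpa using h.trans (Collects.of_eq hu)

theorem HoldsPosition.congr {i : Fin x.k} (h : HoldsPosition x i s)
    (ht : ∀ v ∈ [card, lat, pre, suf], t v = s v) : HoldsPosition x i t where
  lattice := ⟨by rw [ht card (by decide), h.lattice.card_eq],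
    by rw [ht lat (by decide)]; exact h.lattice.lat_eq⟩
  position := by rw [ht pre (by decide), ht suf (by decide)]; exact h.position

theorem length_of_finRange_eq {n : ℕ} {il jl : List (Fin n)} {p : Fin n}
    (h : List.finRange n = il ++ p :: jl) : p.val = il.length := by
  have h1 : (List.finRange n)[il.length]? = some p := by rw [h]; simp
  rw [List.getElem?_eq_some_iff] at h1
  obtain ⟨hlt, h1⟩ := h1
  rw [← h1]
  simp

theorem HoldsLattice.length_card (h : HoldsLattice L s) : (s card).length = L.card := by
  rw [h.card_eq, List.length_replicate]

theorem collects_stepSnd {i : Fin x.k} {p : (x.L i).Elem} (hi : HoldsPosition x i s)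
    (hx : HoldsRow mx p s) (hp : HoldsIndex ix jx p s) (hmy : s my = s lat) (hiy : s iy = [])
    (hjy : s jy = s card) :
    Collects x [] ((x.L i).elems.map (x.joinImp i p)) s ((loop card stepSnd).run s) := by
  have hn := hi.lattice.length_card
  have key := loop_list (v := card) (c := stepSnd) (s := s) (x.L i).elems
    (by rw [hn, ExplicitLattice.length_elems])
    (fun il jl t => t my = (s lat).drop (il.length * (x.L i).card) ∧ (t iy).length = il.length ∧
      (t jy).length = jl.length ∧ Collects x [] (il.map (x.joinImp i p)) s t)
    ⟨by simp [hmy], by simp [hiy], by rw [hjy, hn, ExplicitLattice.length_elems],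
      Collects.of_eq fun _ _ => rfl⟩ ?_
  · exact key.2.2.2
  · rintro il q jl t hq hfr ⟨h1, h2, h3, h4⟩
    -- The index of q is the number of elements already processed, so the invariant on `my` says
    -- that the row of q is on top.
    have hql : Fin.val q = il.length := length_of_finRange_eq hq
    obtain ⟨t1, ht1⟩ : ∃ t1, t1 = (pop jy).run t := ⟨_, rfl⟩
    have hts : ∀ v, stepSnd.writes v = false → t1 v = s v := by
      intro v hv
      rw [ht1, run_of_not_writes, hfr v hv]
      revert v
      decide
    have hE := emits_pushJoinImp (s := t1) (p := p) (q := q)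
      (hi.congr fun v hv => hts v (by revert v; decide))
      (by rw [HoldsRow, hts mx rfl, hts lat rfl]; exact hx)
      (by rw [HoldsRow, hts lat rfl, ht1, hql]; simpa using h1)
      (by rw [HoldsIndex, hts ix rfl, hts jx rfl]; exact hp)
      ⟨il, jl, hq, by rw [ht1]; simpa using h2, by rw [ht1]; simp [h3]⟩
    obtain ⟨he, ho⟩ := hE t1 fun _ _ => rfl
    simp only [stepSnd, run_seq, ← ht1]
    have hout1 : ∀ v, v.isOut = true → t1 v = t v := by
      intro v hv
      rw [ht1, run_of_not_writes]
      revert v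
      decide
    generalize pushJoinImp.run t1 = t2 at he ho
    have hcard : (t2 card).length = (x.L i).card := by rw [he card rfl, hts card rfl, hn]
    refine ⟨?_, ?_, ?_, ?_⟩
    · rw [run_loop_pop]
      simp [he my rfl, hcard, ht1, h1, Nat.succ_mul]
    · rw [run_loop_pop]
      simp [he iy rfl, ht1, h2]
    · rw [run_loop_pop]
      simp [he jy rfl, ht1, h3]
    · have h5 : Collects x [] [x.joinImp i p q] t1 t2 := by
        constructor <;> rw [ho _ rfl] <;> simp [single]
      have h6 := h4.trans ((h5.congr_left fun v hv => (hout1 v hv).symm))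
      rw [List.map_append]
      refine (by simpa using h6 : Collects x [] _ s t2).congr_right fun v hv => ?_
      rw [run_loop_pop, run_push, update_of_ne, update_of_ne] <;> rintro rfl <;> cases hv

/-- The objects contributed by a lattice. -/
def latticeObjects (x : DPLInstance) (i : Fin x.k) : List (x.Attr → Bool) :=
  (x.L i).elems.flatMap (x.elemObjects i)

/-- The implications contributed by a lattice. -/
def latticeImps (x : DPLInstance) (i : Fin x.k) : List ((x.Attr → Bool) × (x.Attr → Bool)) :=
  (x.L i).elems.flatMap fun p => (x.L i).elems.map (x.joinImp i p)

theorem collects_stepFst {i : Fin x.k} (hi : HoldsPosition x i s) (hmx : s mx = s lat)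
    (hix : s ix = []) (hjx : s jx = s card) :
    Collects x (latticeObjects x i) (latticeImps x i) s ((loop card stepFst).run s) := by
  have hn := hi.lattice.length_card
  have key := loop_list (v := card) (c := stepFst) (s := s) (x.L i).elems
    (by rw [hn, ExplicitLattice.length_elems])
    (fun il jl t => t mx = (s lat).drop (il.length * (x.L i).card) ∧ (t ix).length = il.length ∧
      (t jx).length = jl.length ∧ Collects x (il.flatMap (x.elemObjects i))
        (il.flatMap fun p => (x.L i).elems.map (x.joinImp i p)) s t)
    ⟨by simp [hmx], by simp [hix], by rw [hjx, hn, ExplicitLattice.length_elems],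
      Collects.of_eq fun _ _ => rfl⟩ ?_
  · exact key.2.2.2
  · rintro il p jl t hq hfr ⟨h1, h2, h3, h4⟩
    have hpl : Fin.val p = il.length := length_of_finRange_eq hq
    obtain ⟨t1, ht1⟩ : ∃ t1, t1 = (pop jx ;; assign mx my).run t := ⟨_, rfl⟩
    have ht1' : t1 = update (update t jx (t jx).tail) my (t mx) := by
      rw [ht1, run_seq, run_assign (by decide)]
      simp
    have hts : ∀ v, stepFst.writes v = false → t1 v = s v := by
      intro v hv
      rw [ht1, run_of_not_writes, hfr v hv]
      revert v
      decide
    have hpos : HoldsPosition x i t1 := hi.congr fun v hv => hts v (by revert v; decide)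
    have hrow : HoldsRow mx p t1 := by
      rw [HoldsRow, hts lat rfl, ht1', hpl]
      simpa using h1
    have hrowy : HoldsRow my p t1 := by
      rw [HoldsRow, hts lat rfl, ht1', hpl]
      simpa using h1
    have hidx : HoldsIndex ix jx p t1 :=
      ⟨il, jl, hq, by rw [ht1']; simpa using h2, by rw [ht1']; simp [h3]⟩
    obtain ⟨he, ho⟩ := emits_pushElemObjects hpos hrow hrowy hidx t1 fun _ _ => rfl
    simp only [stepFst, run_seq]
    rw [← run_seq (pop jx), ← ht1]
    have hout1 : ∀ v, v.isOut = true → t1 v = t v := by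
      intro v hv
      rw [ht1, run_of_not_writes]
      revert v
      decide
    generalize pushElemObjects.run t1 = t2 at he ho
    have h5 : Collects x (x.elemObjects i p) [] t1 t2 := by
      constructor <;> rw [ho _ rfl] <;> simp [single, elemObjects, sideObjects]
    -- The inner loop starts from the initial state expected by `collects_stepSnd`; the position of
    -- p in `mx`, `ix` and `jx` is untouched.
    obtain ⟨t3, ht3⟩ : ∃ t3, t3 = (assign card jy).run ((clear iy).run ((assign lat my).run t2)) :=
      ⟨_, rfl⟩
    have ht3' : t3 = update (update (update t2 my (t2 lat)) iy []) jy (t2 card) := by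
      rw [ht3, run_assign (by decide), run_assign (by decide)]
      simp
    rw [← ht3]
    have hpos3 : HoldsPosition x i t3 := hpos.congr fun v hv => by
      rw [← he v (by revert v; decide), ht3, run_of_not_writes, run_of_not_writes,
        run_of_not_writes] <;> revert v <;> decide
    have h6 := collects_stepSnd (s := t3) (p := p) hpos3
      (by rw [HoldsRow] at hrow ⊢; rw [ht3']; simpa [he mx rfl, he lat rfl] using hrow)
      (by rw [HoldsIndex] at hidx ⊢; rw [ht3']; simpa [he ix rfl, he jx rfl] using hidx)
      (by rw [ht3']; simp) (by rw [ht3']; simp) (by rw [ht3']; simp)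
    obtain ⟨t4, ht4⟩ : ∃ t4, t4 = (loop card stepSnd).run t3 := ⟨_, rfl⟩
    rw [← ht4] at h6 ⊢
    have hcard : (t4 card).length = (x.L i).card := by
      rw [ht4, run_of_not_writes rfl, hpos3.lattice.length_card]
    have h42 : ∀ v ∈ [mx, ix, jx], t4 v = t1 v := by
      intro v hv
      rw [← he v (by revert v; decide), ht4, run_of_not_writes, ht3, run_of_not_writes,
        run_of_not_writes, run_of_not_writes] <;> revert v <;> decide
    refine ⟨?_, ?_, ?_, ?_⟩
    · rw [run_loop_pop]
      simp [h42 mx (by decide), hcard, ht1', h1, Nat.succ_mul]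
    · rw [run_loop_pop]
      simp [h42 ix (by decide), ht1', h2]
    · rw [run_loop_pop]
      simp [h42 jx (by decide), ht1', h3]
    · have h7 := h4.trans (h5.congr_left fun v hv => (hout1 v hv).symm)
      have h8 := h7.trans (h6.congr_left (u := t2) fun v hv => by
        rw [ht3', update_of_ne, update_of_ne, update_of_ne] <;> rintro rfl <;> cases hv)
      simp only [List.flatMap_append, List.flatMap_cons, List.flatMap_nil, List.append_nil] at h8 ⊢
      refine h8.congr_right fun v hv => ?_
      rw [run_loop_pop, run_push, update_of_ne, update_of_ne] <;> rintro rfl <;> cases hv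

/-- The encodings of the lattices with the given indices. -/
def latticeCodes (x : DPLInstance) (l : List (Fin x.k)) : List Bool :=
  l.flatMap fun i => (x.L i).encode

theorem collects_stepLattice {rest : List Bool} (hk : (s lats).length = x.k)
    (hlat : s lat = latticeCodes x (List.finRange x.k) ++ rest) (hpre : s pre = [])
    (hsuf : (s suf).length = ((List.finRange x.k).map fun j => (x.L j).width).sum) :
    Collects x ((List.finRange x.k).flatMap (latticeObjects x))
      ((List.finRange x.k).flatMap (latticeImps x)) s ((loop lats stepLattice).run s) := by
  have key := loop_list (v := lats) (c := stepLattice) (s := s) (List.finRange x.k)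
    (by rw [hk, List.length_finRange])
    (fun il jl t => t lat = latticeCodes x jl ++ rest ∧
      (t pre).length = (il.map fun j => (x.L j).width).sum ∧
      (t suf).length = (jl.map fun j => (x.L j).width).sum ∧
      Collects x (il.flatMap (latticeObjects x)) (il.flatMap (latticeImps x)) s t)
    ⟨hlat, by simp [hpre], hsuf, Collects.of_eq fun _ _ => rfl⟩ ?_
  · exact key.2.2.2
  · rintro il i jl t hi hfr ⟨h1, h2, h3, h4⟩
    have h1' : t lat = encodeNat (x.L i).card ++
        (encodeMatrix (x.L i).leq ++ (latticeCodes x jl ++ rest)) := by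
      simpa [latticeCodes, ExplicitLattice.encode] using h1
    obtain ⟨t1, ht1⟩ : ∃ t1, t1 = (clear card ;; scan lat card ;; pop suf ;;
      loop card (pop suf) ;; loop card (pop suf) ;; assign lat mx ;; clear ix ;;
      assign card jx).run t := ⟨_, rfl⟩
    have ht1' : t1 = update (update (update (update (update (update t card
        (List.replicate (x.L i).card true)) lat
        (encodeMatrix (x.L i).leq ++ (latticeCodes x jl ++ rest))) suf
        ((t suf).drop (x.L i).width)) mx
        (encodeMatrix (x.L i).leq ++ (latticeCodes x jl ++ rest))) ix []) jx
        (List.replicate (x.L i).card true) := by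
      rw [ht1]
      simp only [run_seq]
      rw [run_clear, run_scan (n := (x.L i).card)
        (l := encodeMatrix (x.L i).leq ++ (latticeCodes x jl ++ rest)) (by simpa using h1'),
        run_pop, run_loop_pop, run_loop_pop, run_assign (by decide), run_clear,
        run_assign (by decide)]
      funext v
      cases v <;> simp [ExplicitLattice.width_eq, Nat.add_comm, Nat.add_left_comm]
    have hpos : HoldsPosition x i t1 := by
      refine ⟨⟨by rw [ht1']; simp, ⟨_, by rw [ht1']; simp; rfl⟩⟩, il, jl, hi, ?_, ?_⟩
      · rw [ht1']
        simpa using h2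
      · rw [ht1']
        simp [h3]
    have h5 := collects_stepFst hpos (by rw [ht1']; simp) (by rw [ht1']; simp) (by rw [ht1']; simp)
    have e : stepLattice.run t = (loop card (loop card (pop lat)) ;; push pre true ;;
      loop card (push pre true) ;; loop card (push pre true)).run
        ((loop card stepFst).run t1) := by rw [ht1]; rfl
    rw [e]
    obtain ⟨t2, ht2⟩ : ∃ t2, t2 = (loop card stepFst).run t1 := ⟨_, rfl⟩
    rw [← ht2] at h5 ⊢
    have hfr2 : ∀ v ∈ [card, lat, pre, suf], t2 v = t1 v := by
      intro v hv
      rw [ht2, run_of_not_writes]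
      revert v
      decide
    simp only [run_seq]
    rw [run_loop_loop_pop (by decide), run_push, run_loop_push, run_loop_push]
    have hcard : t2 card = List.replicate (x.L i).card true := by
      rw [hfr2 card (by decide), ht1']
      simp
    refine ⟨?_, ?_, ?_, ?_⟩
    · have : t2 lat = encodeMatrix (x.L i).leq ++ (latticeCodes x jl ++ rest) := by
        rw [hfr2 lat (by decide), ht1']
        simp
      simp [this, hcard, ← length_encodeMatrix (x.L i).leq]
    · have : t2 pre = t pre := by
        rw [hfr2 pre (by decide), ht1']
        simp
      simp [this, hcard, h2, ExplicitLattice.width_eq]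
      omega
    · have : t2 suf = (t suf).drop (x.L i).width := by
        rw [hfr2 suf (by decide), ht1']
        simp
      simp [this, h3]
    · have h6 := h4.trans (h5.congr_left (u := t) fun v hv => by
        rw [ht1']
        simp only [update_of_ne (show v ≠ card by rintro rfl; cases hv),
          update_of_ne (show v ≠ lat by rintro rfl; cases hv),
          update_of_ne (show v ≠ suf by rintro rfl; cases hv),
          update_of_ne (show v ≠ mx by rintro rfl; cases hv),
          update_of_ne (show v ≠ ix by rintro rfl; cases hv),
          update_of_ne (show v ≠ jx by rintro rfl; cases hv)])
      simp only [List.flatMap_append, List.flatMap_cons, List.flatMap_nil, List.append_nil] at h6 ⊢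
      refine h6.congr_right fun v hv => ?_
      simp only [update_of_ne (show v ≠ lat by rintro rfl; cases hv),
        update_of_ne (show v ≠ pre by rintro rfl; cases hv)]

end Reduction

end LatticeDuality

/-! ### Reading tuples and assembling the output -/

namespace LatticeDuality

open Function Cmd

namespace Reduction

open Var DPLInstance

variable {x : DPLInstance} {s : Store Var} {o : Var} {rest : List Bool}

theorem latticeCodes_cons (i : Fin x.k) (l : List (Fin x.k)) :
    latticeCodes x (i :: l) ++ rest = encodeNat (x.L i).card ++
      (encodeMatrix (x.L i).leq ++ (latticeCodes x l ++ rest)) := by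
  simp [latticeCodes, ExplicitLattice.encode]

/-- The number of attributes of all blocks. -/
def totalWidth (x : DPLInstance) : ℕ := ((List.finRange x.k).map fun j => (x.L j).width).sum

theorem run_loop_skipLattice (hk : (s lats).length = x.k)
    (htext : s text = latticeCodes x (List.finRange x.k) ++ rest) (hw : s width = []) :
    ((loop lats skipLattice).run s) text = rest ∧
      ((loop lats skipLattice).run s) width = List.replicate (totalWidth x) true := by
  have key := loop_list (v := lats) (c := skipLattice) (s := s) (List.finRange x.k)
    (by rw [hk, List.length_finRange])
    (fun il jl t => t text = latticeCodes x jl ++ rest ∧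
      t width = List.replicate (il.map fun j => (x.L j).width).sum true)
    ⟨htext, hw⟩ ?_
  · exact key
  · rintro il i jl t - - ⟨h1, h2⟩
    rw [latticeCodes_cons] at h1
    simp only [skipLattice, run_seq]
    rw [run_clear, run_scan (n := (x.L i).card)
      (l := encodeMatrix (x.L i).leq ++ (latticeCodes x jl ++ rest)) (by simpa using h1), run_push,
      run_loop_push, run_loop_push, run_loop_loop_pop (by decide)]
    constructor
    · simp [← length_encodeMatrix (x.L i).leq]
    · simp [h2, ExplicitLattice.width_eq, ← List.replicate_succ, List.replicate_append_replicate]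
      omega

/-- The code of a tuple. -/
def tupleCode (x : DPLInstance) (a : ∀ i, (x.L i).Elem) (l : List (Fin x.k)) : List Bool :=
  l.flatMap fun i => (x.L i).encodeElem (a i)

/-- The data on the lattices that the program uses for reading tuples. -/
structure HoldsInput (x : DPLInstance) (s : Store Var) : Prop where
  inp_eq : ∃ l, s inp = encodeNat x.k ++ (latticeCodes x (List.finRange x.k) ++ l)
  length_lats : (s lats).length = x.k
  width_eq : s width = List.replicate (totalWidth x) true

theorem HoldsInput.congr {t : Store Var} (h : HoldsInput x s)
    (ht : ∀ v ∈ [inp, lats, width], t v = s v) : HoldsInput x t := by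
  obtain ⟨h1, h2, h3⟩ := h
  exact ⟨by rwa [ht inp (by decide)], by rwa [ht lats (by decide)], by rwa [ht width (by decide)]⟩

/-- The index of p is read in unary and used to skip that many matrix rows. Equal contents of `mx`
and `my` then yield the principal ideal of p. -/
theorem run_pushComponent (ho : o = objRows ∨ o = impRows) {L : ExplicitLattice} {p : L.Elem}
    {rest' : List Bool} (hlat : s lat = L.encode ++ rest) (htext : s text = L.encodeElem p ++ rest') :
    (pushComponent o).run s lat = rest ∧ (pushComponent o).run s text = rest' ∧
      (pushComponent o).run s o = (L.blockList.map (blockIdeal p p)).reverse ++ s o := by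
  have hlat' : s lat = encodeNat L.card ++ (encodeMatrix L.leq ++ rest) := by
    simpa [ExplicitLattice.encode] using hlat
  have htext' : s text = encodeNat (Fin.val p) ++ rest' := htext
  obtain ⟨t, ht⟩ : ∃ t, t = (clear card ;; scan lat card ;; clear idx ;; scan text idx ;;
    assign lat mx ;; loop idx (loop card (pop mx)) ;; assign mx my).run s := ⟨_, rfl⟩
  have ht' : t = update (update (update (update (update (update s card
      (List.replicate L.card true)) lat (encodeMatrix L.leq ++ rest)) text rest') idx
      (List.replicate (Fin.val p) true)) mx ((encodeMatrix L.leq ++ rest).drop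
        (Fin.val p * L.card))) my ((encodeMatrix L.leq ++ rest).drop (Fin.val p * L.card)) := by
    rw [ht]
    simp only [run_seq]
    rw [run_clear, run_scan (v := lat) (n := L.card) (l := encodeMatrix L.leq ++ rest)
      (by simpa using hlat'), run_clear, run_scan (v := text) (n := Fin.val p) (l := rest')
      (by simpa using htext'),
      run_assign (by decide), run_loop_loop_pop (by decide), run_assign (by decide)]
    funext v
    cases v <;> simp [Nat.mul_comm]
  have hL : HoldsLattice L t := ⟨by rw [ht']; simp, _, by rw [ht']; simp; rfl⟩
  obtain ⟨he, hout⟩ := emitsTo_pushBlockIdeal ho hL (p := p) (q := p)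
    (by rw [HoldsRow, ht']; simp) (by rw [HoldsRow, ht']; simp) t fun _ _ => rfl
  have e : (pushComponent o).run s =
      (loop card (loop card (pop lat))).run ((pushBlockIdeal o).run t) := by rw [ht]; rfl
  have hcard : ((pushBlockIdeal o).run t card).length = L.card := by
    rw [he card rfl, hL.card_eq, List.length_replicate]
  have hoo : (pushBlockIdeal o).run t o = (L.blockList.map (blockIdeal p p)).reverse ++ s o := by
    rw [hout o (isOut_of_or ho), ht', single, if_pos rfl]
    rcases ho with rfl | rfl <;> simp
  rw [e, run_loop_loop_pop (by decide), hcard]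
  refine ⟨?_, ?_, ?_⟩
  · rw [update_self, he lat rfl, ht']
    simp [← length_encodeMatrix L.leq]
  · rw [update_of_ne (by decide), he text rfl, ht']
    simp
  · rw [update_of_ne (by rcases ho with rfl | rfl <;> decide), hoo]

theorem run_pushTuple (ho : o = objRows ∨ o = impRows) (hs : HoldsInput x s)
    {a : ∀ i, (x.L i).Elem} (htext : s text = tupleCode x a (List.finRange x.k) ++ rest) :
    (pushTuple o).run s text = rest ∧ (pushTuple o).run s o =
      ((List.finRange x.k).flatMap fun i => (x.L i).blockList.map (x.ideal a i)).reverse ++ s o := by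
  obtain ⟨l, hl⟩ := hs.inp_eq
  obtain ⟨t, ht⟩ : ∃ t, t = (assign inp lat ;; scan lat flag).run s := ⟨_, rfl⟩
  have ht' : t = update (update s lat (latticeCodes x (List.finRange x.k) ++ l)) flag
      (List.replicate x.k true ++ s flag) := by
    rw [ht, run_seq, run_assign (by decide), run_scan (n := x.k)
      (l := latticeCodes x (List.finRange x.k) ++ l) (by simpa using hl)]
    simp
  have hto : t o = s o := by
    rw [ht', update_of_ne, update_of_ne] <;> rcases ho with rfl | rfl <;> decide
  have key := loop_list (v := lats) (c := pushComponent o) (s := t) (List.finRange x.k)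
    (by rw [ht']; simpa using hs.length_lats)
    (fun il jl u => u lat = latticeCodes x jl ++ l ∧ u text = tupleCode x a jl ++ rest ∧
      u o = (il.flatMap fun i => (x.L i).blockList.map (x.ideal a i)).reverse ++ s o)
    ⟨by rw [ht']; simp, by rw [ht']; simpa using htext, by rw [hto]; rfl⟩ ?_
  · rw [pushTuple, run_seq, ← ht]
    exact ⟨by simpa [tupleCode] using key.2.1, key.2.2⟩
  · rintro il i jl u - - ⟨h1, h2, h3⟩
    obtain ⟨h4, h5, h6⟩ := run_pushComponent ho (s := u) (L := x.L i) (p := a i)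
      (rest := latticeCodes x jl ++ l) (rest' := tupleCode x a jl ++ rest)
      (by rw [h1]; simp [latticeCodes]) (by rw [h2]; simp [tupleCode])
    refine ⟨h4, h5, ?_⟩
    rw [h6, h3]
    simp [ideal]

theorem map_attrs_row_const (b g t : Bool) :
    x.attrs.map (row (fun _ _ => b) g t) = List.replicate (totalWidth x) b ++ [g, t] := by
  rw [map_attrs_row, totalWidth, ← flatMap_replicate]
  congr 1
  refine List.flatMap_congr fun i _ => ?_
  rw [List.map_const']
  rfl

/-- The code of a list of tuples without its length. -/
def tupleCodes (x : DPLInstance) (l : List (∀ i, (x.L i).Elem)) : List Bool :=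
  l.flatMap fun a => tupleCode x a (List.finRange x.k)

theorem collects_pushGoalImp (hs : HoldsInput x s) {a : ∀ i, (x.L i).Elem}
    (htext : s text = tupleCode x a (List.finRange x.k) ++ rest) :
    pushGoalImp.run s text = rest ∧ Collects x [] [x.goalImp a] s (pushGoalImp.run s) := by
  obtain ⟨h1, h2⟩ := run_pushTuple (o := impRows) (.inr rfl) hs htext
  obtain ⟨t, ht⟩ : ∃ t, t = (pushTuple impRows).run s := ⟨_, rfl⟩
  have hfr : ∀ v, (pushTuple impRows).writes v = false → t v = s v := fun v hv => by
    rw [ht, run_of_not_writes hv]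
  rw [← ht] at h1 h2
  have hw : t width = List.replicate (totalWidth x) true := by rw [hfr width rfl, hs.width_eq]
  have hr1 : x.attrs.map (x.goalImp a).1 = _ := map_attrs_row (x.ideal a) true false
  have hr2 : x.attrs.map (x.goalImp a).2 = _ := map_attrs_row_const false false true
  simp only [pushGoalImp, run_seq, ← ht, run_loop_push, run_push]
  refine ⟨by simpa using h1, ?_⟩
  constructor
  · simp [hfr objRows rfl]
  · simp [hfr objCount rfl]
  · simp [hr1, hr2, h2, hw]
  · simp [hfr impCount rfl]

theorem collects_loop_pushGoalImp (hs : HoldsInput x s) (l : List (∀ i, (x.L i).Elem))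
    (hcnt : (s cnt).length = l.length) (htext : s text = tupleCodes x l ++ rest) :
    (loop cnt pushGoalImp).run s text = rest ∧
      Collects x [] (l.map x.goalImp) s ((loop cnt pushGoalImp).run s) := by
  refine loop_list (v := cnt) (c := pushGoalImp) (s := s) l hcnt
    (fun il jl t => t text = tupleCodes x jl ++ rest ∧ Collects x [] (il.map x.goalImp) s t)
    ⟨htext, Collects.of_eq fun _ _ => rfl⟩ ?_
  rintro il a jl t - hfr ⟨h1, h2⟩
  have hs' : HoldsInput x t := hs.congr fun v hv => hfr v (by revert v; decide)
  obtain ⟨h3, h4⟩ := collects_pushGoalImp hs' (a := a) (rest := tupleCodes x jl ++ rest)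
    (by rw [h1]; simp [tupleCodes])
  exact ⟨h3, by simpa using h2.trans h4⟩

theorem collects_pushTupleObject (hs : HoldsInput x s) {b : ∀ i, (x.L i).Elem}
    (htext : s text = tupleCode x b (List.finRange x.k) ++ rest) :
    pushTupleObject.run s text = rest ∧
      Collects x [row (x.ideal b) true false] [] s (pushTupleObject.run s) := by
  obtain ⟨h1, h2⟩ := run_pushTuple (o := objRows) (.inl rfl) hs htext
  obtain ⟨t, ht⟩ : ∃ t, t = (pushTuple objRows).run s := ⟨_, rfl⟩
  have hfr : ∀ v, (pushTuple objRows).writes v = false → t v = s v := fun v hv => by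
    rw [ht, run_of_not_writes hv]
  rw [← ht] at h1 h2
  simp only [pushTupleObject, run_seq, ← ht, run_push]
  refine ⟨by simpa using h1, ?_⟩
  constructor
  · simp [map_attrs_row, h2]
  · simp [hfr objCount rfl]
  · simp [hfr impRows rfl]
  · simp [hfr impCount rfl]

theorem collects_loop_pushTupleObject (hs : HoldsInput x s) (l : List (∀ i, (x.L i).Elem))
    (hcnt : (s cnt).length = l.length) (htext : s text = tupleCodes x l ++ rest) :
    Collects x (l.map fun b => row (x.ideal b) true false) [] s
      ((loop cnt pushTupleObject).run s) := by
  refine (loop_list (v := cnt) (c := pushTupleObject) (s := s) l hcnt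
    (fun il jl t => t text = tupleCodes x jl ++ rest ∧
      Collects x (il.map fun b => row (x.ideal b) true false) [] s t)
    ⟨htext, Collects.of_eq fun _ _ => rfl⟩ ?_).2
  rintro il b jl t - hfr ⟨h1, h2⟩
  have hs' : HoldsInput x t := hs.congr fun v hv => hfr v (by revert v; decide)
  obtain ⟨h3, h4⟩ := collects_pushTupleObject hs' (b := b) (rest := tupleCodes x jl ++ rest)
    (by rw [h1]; simp [tupleCodes])
  exact ⟨h3, by simpa using h2.trans h4⟩

theorem collects_pushLastObjects (hs : HoldsInput x s) :
    Collects x [row (fun _ => blockFull) false true, row (fun _ => blockFull) false false] [] s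
      (pushLastObjects.run s) := by
  have hr : ∀ t, x.attrs.map (row (fun _ => blockFull) false t) = _ :=
    fun t => map_attrs_row_const true false t
  have hw := hs.width_eq
  simp only [pushLastObjects, run_seq, run_loop_push, run_push]
  constructor
  · simp [hr, hw]
  · simp [List.replicate_succ]
  · simp
  · simp

theorem length_attrs (x : DPLInstance) : x.attrs.length = totalWidth x + 2 := by
  have := congrArg List.length (map_attrs_row_const (x := x) false false false)
  simpa using this

/-- Counts are kept in unary on stacks, so a copied count followed by a single `false` is already
the code of a number. -/
theorem run_assemble {O : List (x.Attr → Bool)} {J : List ((x.Attr → Bool) × (x.Attr → Bool))}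
    {t : Store Var} (h : Collects x O J t s) (ht : ∀ v, v.isOut = true → t v = [])
    (hw : s width = List.replicate (totalWidth x) true) (hout : s out = []) :
    assemble.run s out = (MIBRInstance.ofLists x.attrs O J).encode := by
  obtain ⟨h1, h2, h3, h4⟩ := h
  rw [ht _ rfl, List.append_nil] at h1 h2 h3 h4
  obtain ⟨s1, hs1⟩ : ∃ s1, s1 = (pushReverse impRows buf out ;; push out false ;;
    copy impCount out).run s := ⟨_, rfl⟩
  have hfr1 : ∀ v, v ≠ buf → v ≠ out → s1 v = s v := by
    intro v hb ho
    rw [hs1, run_of_not_writes]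
    cases v <;> first | rfl | exact absurd rfl hb | exact absurd rfl ho
  have ho1 : s1 out =
      encodeNat J.length ++ J.flatMap fun p => x.attrs.map p.1 ++ x.attrs.map p.2 := by
    have : (pushReverse impRows buf out).run s impCount = s impCount := run_of_not_writes rfl _
    rw [hs1]
    simp [run_pushReverse, this, h3, h4, hout, encodeNat]
  have e : assemble.run s = (pushReverse objRows buf out ;; push out false ;; copy width out ;;
    push out true ;; push out true ;; push out false ;; copy objCount out).run s1 := by
    rw [hs1]; rfl
  have hr : ∀ v, v ≠ buf → v ≠ out → (pushReverse objRows buf out).run s1 v = s v := by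
    intro v hb ho
    rw [run_of_not_writes, hfr1 v hb ho]
    cases v <;> first | rfl | exact absurd rfl hb | exact absurd rfl ho
  rw [e, MIBRInstance.encode_ofLists, length_attrs]
  simp [run_pushReverse, hr width, hr objCount, hfr1 objRows, h1, h2, ho1, hw, encodeNat,
    List.replicate_succ]

end Reduction

end LatticeDuality

/-! ### Correctness of the whole program -/

namespace LatticeDuality

open Function Cmd

namespace Reduction

open Var DPLInstance

variable {x : DPLInstance}

theorem encodeTuple_eq_flatMap {k : ℕ} {α : Fin k → Type} (enc : ∀ i, α i → List Bool)
    (f : ∀ i, α i) : encodeTuple enc f = (List.finRange k).flatMap fun i => enc i (f i) := by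
  rw [encodeTuple, List.ofFn_eq_map]
  rfl

theorem encode_eq (x : DPLInstance) : x.encode = encodeNat x.k ++
    (latticeCodes x (List.finRange x.k) ++ (encodeNat x.A.length ++ (tupleCodes x x.A ++
      (encodeNat x.B.length ++ tupleCodes x x.B)))) := by
  have h : (encodeTuple fun i => (x.L i).encodeElem) = fun a => tupleCode x a (List.finRange x.k) :=
    funext fun a => encodeTuple_eq_flatMap _ a
  rw [DPLInstance.encode, encodeTuple_eq_flatMap, h]
  simp [encodeList, tupleCodes, latticeCodes]

theorem run_program (x : DPLInstance) :
    program.run (single inp x.encode) out = x.toMIBR.encode := by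
  have hx := encode_eq x
  obtain ⟨s, hs⟩ : ∃ s, s = single inp x.encode := ⟨_, rfl⟩
  rw [← hs]
  have hnil : ∀ v, v ≠ inp → s v = [] := fun v hv => by rw [hs, single, if_neg hv]
  have hinp : s inp = x.encode := by rw [hs, single, if_pos rfl]
  obtain ⟨rest, hrest⟩ : ∃ l, l = encodeNat x.A.length ++ (tupleCodes x x.A ++
    (encodeNat x.B.length ++ tupleCodes x x.B)) := ⟨_, rfl⟩
  rw [← hrest] at hx
  obtain ⟨s1, hs1⟩ : ∃ t, t = (copy inp text ;; scan text lats).run s := ⟨_, rfl⟩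
  have hs1' : s1 = update (update s text (latticeCodes x (List.finRange x.k) ++ rest)) lats
      (List.replicate x.k true) := by
    rw [hs1, run_seq, run_copy, run_scan (n := x.k)
      (l := latticeCodes x (List.finRange x.k) ++ rest) (by simp [hinp, hnil, hx])]
    simp [hnil]
  obtain ⟨s2, hs2⟩ : ∃ t, t = (loop lats skipLattice).run s1 := ⟨_, rfl⟩
  obtain ⟨h2t, h2w⟩ := run_loop_skipLattice (x := x) (s := s1) (rest := rest)
    (by rw [hs1']; simp) (by rw [hs1']; simp) (by rw [hs1']; simp [hnil])
  rw [← hs2] at h2t h2w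
  have hfr2 : ∀ v, (loop lats skipLattice).writes v = false → s2 v = s1 v := fun v hv => by
    rw [hs2, run_of_not_writes hv]
  have hin2 : HoldsInput x s2 :=
    ⟨⟨rest, by rw [hfr2 inp rfl, hs1']; simp [hinp, hx]⟩,
      by rw [hfr2 lats rfl, hs1']; simp, h2w⟩
  obtain ⟨s3, hs3⟩ : ∃ t, t = (copy inp lat ;; scan lat flag ;; copy width suf).run s2 := ⟨_, rfl⟩
  have hs3' : s3 = update (update (update s2 lat (latticeCodes x (List.finRange x.k) ++ rest)) flag
      (List.replicate x.k true)) suf (List.replicate (totalWidth x) true) := by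
    have e1 : s2 inp = x.encode := by rw [hfr2 inp rfl, hs1']; simp [hinp]
    have e2 : ∀ v ∈ [lat, flag, suf], s2 v = [] := fun v hv => by
      rw [hfr2 v (by revert v; decide), hs1', update_of_ne, update_of_ne, hnil] <;> revert v <;>
        decide
    rw [hs3]
    simp only [run_seq]
    rw [run_copy, run_scan (n := x.k)
      (l := latticeCodes x (List.finRange x.k) ++ rest) (by simp [e1, e2, hx])]
    simp [e2, h2w]
  have h4 := collects_stepLattice (x := x) (s := s3) (rest := rest)
    (by rw [hs3']; simpa using hin2.length_lats) (by rw [hs3']; simp)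
    (by rw [hs3']; simp [hfr2 pre rfl, hs1', hnil]) (by rw [hs3']; simp [totalWidth])
  obtain ⟨s4, hs4⟩ : ∃ t, t = (loop lats stepLattice).run s3 := ⟨_, rfl⟩
  rw [← hs4] at h4
  have hfr4 : ∀ v ∈ [inp, text, lats, width, cnt, out], s4 v = s2 v := by
    intro v hv
    rw [hs4, run_of_not_writes (by revert v; decide), hs3, run_of_not_writes (by revert v; decide)]
  obtain ⟨s5, hs5⟩ : ∃ t, t = (scan text cnt).run s4 := ⟨_, rfl⟩
  have hs5' : s5 = update (update s4 text (tupleCodes x x.A ++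
      (encodeNat x.B.length ++ tupleCodes x x.B))) cnt (List.replicate x.A.length true) := by
    have e : s4 cnt = [] := by
      rw [hfr4 cnt (by decide), hfr2 cnt rfl, hs1']
      simp [hnil]
    rw [hs5, run_scan (n := x.A.length) (by rw [hfr4 text (by decide), h2t, hrest]), e,
      List.append_nil]
  have hin5 : HoldsInput x s5 := hin2.congr fun v hv => by
    rw [← hfr4 v (by revert v; decide), hs5, run_of_not_writes]
    revert v
    decide
  obtain ⟨h6t, h6⟩ := collects_loop_pushGoalImp hin5 x.A
    (rest := encodeNat x.B.length ++ tupleCodes x x.B) (by rw [hs5']; simp) (by rw [hs5']; simp)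
  obtain ⟨s6, hs6⟩ : ∃ t, t = (loop cnt pushGoalImp).run s5 := ⟨_, rfl⟩
  rw [← hs6] at h6t h6
  have hfr6 : ∀ v ∈ [inp, lats, width, out], s6 v = s5 v := by
    intro v hv
    rw [hs6, run_of_not_writes (by revert v; decide)]
  obtain ⟨s7, hs7⟩ : ∃ t, t = (clear cnt ;; scan text cnt).run s6 := ⟨_, rfl⟩
  have hs7' : s7 = update (update s6 text (tupleCodes x x.B)) cnt
      (List.replicate x.B.length true) := by
    rw [hs7, run_seq, run_clear, run_scan (n := x.B.length) (l := tupleCodes x x.B)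
      (by simpa using h6t)]
    funext v
    cases v <;> simp
  have hin7 : HoldsInput x s7 := hin5.congr fun v hv => by
    rw [← hfr6 v (by revert v; decide), hs7, run_of_not_writes]
    revert v
    decide
  have h8 := collects_loop_pushTupleObject hin7 x.B (rest := []) (by rw [hs7']; simp)
    (by rw [hs7']; simp)
  obtain ⟨s8, hs8⟩ : ∃ t, t = (loop cnt pushTupleObject).run s7 := ⟨_, rfl⟩
  rw [← hs8] at h8
  have hfr8 : ∀ v ∈ [inp, lats, width, out], s8 v = s7 v := by
    intro v hv
    rw [hs8, run_of_not_writes (by revert v; decide)]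
  have hin8 : HoldsInput x s8 := hin7.congr fun v hv => hfr8 v (by revert v; decide)
  have h9 := collects_pushLastObjects hin8
  have e5 : ∀ v, v.isOut = true → s5 v = s4 v := fun v hv => by
    rw [hs5, run_of_not_writes]
    revert v
    decide
  have e7 : ∀ v, v.isOut = true → s7 v = s6 v := fun v hv => by
    rw [hs7, run_of_not_writes]
    revert v
    decide
  -- The phases are chained in the order in which `objs` and `imps` list their members; the commands
  -- between them do not touch the collecting variables.
  have hall := ((h4.congr_right e5).trans (h6.congr_right e7)).trans (h8.trans h9)
  have hrun : program.run s = assemble.run (pushLastObjects.run s8) := by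
    rw [hs8, hs7, hs6, hs5, hs4, hs3, hs2, hs1]
    rfl
  have hlast : ∀ v ∈ [width, out], pushLastObjects.run s8 v = s8 v := fun v hv => by
    rw [run_of_not_writes]
    revert v
    decide
  have hpre3 : ∀ v, v.isOut = true ∨ v = out → s3 v = [] := fun v hv => by
    rw [hs3, run_of_not_writes (by revert v; decide), hfr2 v (by revert v; decide), hs1,
      run_of_not_writes (by revert v; decide), hnil v (by revert v; decide)]
  rw [hrun, run_assemble hall (fun v hv => hpre3 v (.inl hv))
    (by rw [hlast width (by decide)]; exact hin8.width_eq)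
    (by
      rw [hlast out (by decide), hfr8 out (by decide), hs7, run_of_not_writes rfl,
        hfr6 out (by decide), hs5, run_of_not_writes rfl, hs4, run_of_not_writes rfl,
        hpre3 out (.inr rfl)])]
  rw [toMIBR, objs, imps]
  simp only [List.append_nil]
  rfl

end Reduction

theorem DPLInstance.computable_toMIBR : Nonempty
    (Turing.TM2ComputableInPolyTime DPLInstance.encode MIBRInstance.encode DPLInstance.toMIBR) :=
  computableInPolyTime Reduction.program Reduction.ranked_program Reduction.run_program

end LatticeDuality

/-- One map serves all three problems: for its images, generating, being inclusion-minimal and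
having minimum cardinality coincide. -/
theorem mainTheorem5 :
    LatticeDuality.KarpReducible LatticeDuality.DPL LatticeDuality.MIBR ∧
    LatticeDuality.KarpReducible LatticeDuality.DPL LatticeDuality.GeneratingSetRecognition ∧
    LatticeDuality.KarpReducible LatticeDuality.DPL
      LatticeDuality.CardinalityMinimumBaseRecognition := by
  refine ⟨⟨_, LatticeDuality.DPLInstance.computable_toMIBR, fun x => ?_⟩,
    ⟨_, LatticeDuality.DPLInstance.computable_toMIBR, fun x => x.generates_toMIBR_iff.symm⟩,
    ⟨_, LatticeDuality.DPLInstance.computable_toMIBR, fun x => ?_⟩⟩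
  · exact x.generates_toMIBR_iff.symm.trans
      ⟨fun h => (x.isMinimum_of_generates h).isImplicationBase x.toMIBR.finite_implications,
        fun h => h.prop⟩
  · exact x.generates_toMIBR_iff.symm.trans ⟨x.isMinimum_of_generates, fun h => h.1⟩
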